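/- Let $k$ be a field. A \emph{tensor category} over $k$ is an essentially small $k$-linear abelian monoidal category with $k$-linear tensor product, in which $k\to\mathrm{End}(\mathbb{1})$ is an isomorphism and every object has a left and a right dual (no braiding is assumed); it is \emph{artinian} if its objects have finite length and its morphism spaces are finite dimensional over $k$. For a field extension $K/k$, let $K\stackrel{.}{\otimes}_k\mathbf{T}$ be the pseudo-abelian envelope of the category with the same objects as $\mathbf{T}$ and morphism spaces $K\otimes_k\mathbf{T}(X,Y)$, with its induced monoidal structure. Let $(\mathrm{Ind}\,\mathbf{T})_K$ be the category of $K$-modules in $\mathrm{Ind}\,\mathbf{T}$, with tensor product $\otimes_K$, and let $\mathbf{T}_K$ be its full monoidal subcategory of compact objects. The tensor category $\mathbf{T}$ is \emph{absolute} if $\mathbf{T}_K$ is a tensor category over $K$ for every field extension $K/k$. \textbf{Theorem.} Let $\mathbf{T}$ be a semisimple artinian tensor category over $k$. Then: \begin{enumerate} \item for every object $X$ of $\mathbf{T}$, the endomorphism algebra $\mathrm{End}(X)$ is a separable $k$-algebra; \item for every field extension $K/k$, the category $K\stackrel{.}{\otimes}_k\mathbf{T}$ is a semisimple tensor category over $K$,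 and it equals $\mathbf{T}_K$, that is, the canonical $K$-linear monoidal functor $K\stackrel{.}{\otimes}_k\mathbf{T}\to\mathbf{T}_K$, $X\mapsto K\otimes X$, is an equivalence; \item $\mathbf{T}$ is absolute. \end{enumerate} -/

import Mathlib

open CategoryTheory MonoidalCategory Limits Opposite
open scoped TensorProduct

universe v u v' u'

set_option linter.unusedSectionVars false

noncomputable section

namespace ScalarExtension

/-- A (not necessarily commutative) `k`-algebra `A` is separable if it has a separability idempotent,
that is, an element `e` of `A ⊗ A` with `mul e = 1` and `(a ⊗ 1) e = e (1 ⊗ a)` for the bimodule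
structure on the outer factors. Equivalently, the multiplication `A ⊗ A → A` splits as a map of
`A`-bimodules. -/
def IsSeparableAlgebra (k A : Type*) [CommRing k] [Ring A] [Algebra k A] : Prop :=
  ∃ e : A ⊗[k] A, LinearMap.mul' k A e = 1 ∧
    ∀ a : A, LinearMap.rTensor A (LinearMap.mulLeft k a) e =
      LinearMap.lTensor A (LinearMap.mulRight k a) e

/-- The preadditive category `C` is abelian: the fields of Mathlib's `Abelian`, as a proposition about
the given preadditive structure. -/
structure IsAbelianCategory (C : Type u') [Category.{v'} C] [Preadditive C] : Prop where
  hasFiniteProducts : HasFiniteProducts C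
  hasKernels : HasKernels C
  hasCokernels : HasCokernels C
  normalMono : IsNormalMonoCategory C
  normalEpi : IsNormalEpiCategory C

/-- A tensor category over `k`: a `k`-linear monoidal category (`k`-linear tensor product) that is
essentially small, abelian, has `k → End(𝟙)` an isomorphism, and in which every object has a left
and a right dual. No braiding and no finiteness is assumed. -/
structure IsTensorCategory (k : Type v) [Field k] (C : Type u') [Category.{v'} C] [Preadditive C]
    [Linear k C] [MonoidalCategory C] [MonoidalPreadditive C] [MonoidalLinear k C] : Prop where
  essentiallySmall : EssentiallySmall.{v} C
  bijective_algebraMap_end_unit : Function.Bijective (algebraMap k (End (𝟙_ C)))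
  rigid : ∀ X : C, Nonempty (HasLeftDual X) ∧ Nonempty (HasRightDual X)
  abelian : IsAbelianCategory C

/-- A `k`-linear category is artinian over `k` if its objects have finite length and its morphism
spaces are finite dimensional. -/
structure IsArtinianCategory (k : Type v) [Field k] (C : Type u') [Category.{v'} C]
    [Preadditive C] [Linear k C] : Prop where
  finiteLength : ∀ X : C, IsNoetherianObject X ∧ IsArtinianObject X
  finite_hom : ∀ X Y : C, Module.Finite k (X ⟶ Y)

/-- Every object is a finite direct sum of simple objects. -/
def IsSemisimpleCategory (C : Type u') [Category.{v'} C] [Preadditive C] : Prop :=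
  ∀ X : C, ∃ (n : ℕ) (S : Fin n → C) (b : Bicone S),
    (∀ i, Simple (S i)) ∧ Nonempty b.IsBilimit ∧ Nonempty (X ≅ b.pt)

/-- The naive extension of scalars `K ⊗ D` of a `k`-linear category `D`: the same objects as `D`, and
morphism spaces `K ⊗[k] D(X, Y)`. -/
structure Naive (k : Type v) (K : Type v) (D : Type u) where
  /-- the underlying object of `D` -/
  obj : D

section naive

variable (k : Type v) [Field k] (K : Type v) [Field K] [Algebra k K]
  {D : Type u} [Category.{v} D] [Preadditive D] [Linear k D]

/-- Composition `(a ⊗ f) ≫ (b ⊗ g) = ab ⊗ (f ≫ g)`, extended bilinearly. -/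
def compNaive (X Y Z : D) :
    (K ⊗[k] (X ⟶ Y)) →ₗ[k] (K ⊗[k] (Y ⟶ Z)) →ₗ[k] (K ⊗[k] (X ⟶ Z)) :=
  TensorProduct.map₂ (LinearMap.mul k K) (Linear.comp X Y Z)

@[simp] lemma compNaive_tmul {X Y Z : D} (a b : K) (f : X ⟶ Y) (g : Y ⟶ Z) :
    compNaive k K X Y Z (a ⊗ₜ f) (b ⊗ₜ g) = (a * b) ⊗ₜ (f ≫ g) := rfl

instance : Category.{v} (Naive k K D) where
  Hom X Y := K ⊗[k] (X.obj ⟶ Y.obj)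
  id X := 1 ⊗ₜ 𝟙 X.obj
  comp {X Y Z} f g := compNaive k K X.obj Y.obj Z.obj f g
  id_comp f := by
    induction f using TensorProduct.induction_on with
    | zero => simp
    | tmul a f => simp
    | add x y hx hy => rw [map_add, hx, hy]
  comp_id f := by
    induction f using TensorProduct.induction_on with
    | zero => simp
    | tmul a f => simp
    | add x y hx hy => rw [map_add, LinearMap.add_apply, hx, hy]
  assoc f g h := by
    induction f using TensorProduct.induction_on with
    | zero => simp
    | add x y hx hy => simp only [map_add, LinearMap.add_apply, hx, hy]
    | tmul a f =>
      induction g using TensorProduct.induction_on with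
      | zero => simp
      | add x y hx hy => simp only [map_add, LinearMap.add_apply, hx, hy]
      | tmul b g =>
        induction h using TensorProduct.induction_on with
        | zero => simp
        | add x y hx hy => simp only [map_add, hx, hy]
        | tmul c h => simp [mul_assoc]

namespace Naive

variable {k K}

/-- The morphism `a ⊗ f`. -/
def tm {X Y : Naive k K D} (a : K) (f : X.obj ⟶ Y.obj) : X ⟶ Y :=
  (a ⊗ₜ[k] f : K ⊗[k] (X.obj ⟶ Y.obj))

instance : Preadditive (Naive k K D) where
  homGroup X Y := inferInstanceAs (AddCommGroup (K ⊗[k] (X.obj ⟶ Y.obj)))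
  add_comp X Y Z f f' g := LinearMap.map_add₂ (compNaive k K X.obj Y.obj Z.obj) f f' g
  comp_add X Y Z f g g' := (compNaive k K X.obj Y.obj Z.obj f).map_add g g'

@[elab_as_elim]
lemma hom_induction {X Y : Naive k K D} {P : (X ⟶ Y) → Prop} (f : X ⟶ Y)
    (zero : P 0) (tmul : ∀ a f, P (tm a f)) (add : ∀ f g, P f → P g → P (f + g)) : P f :=
  TensorProduct.induction_on f zero tmul add

lemma tm_comp {X Y Z : Naive k K D} (a b : K) (f : X.obj ⟶ Y.obj) (g : Y.obj ⟶ Z.obj) :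
    (tm a f : X ⟶ Y) ≫ (tm b g : Y ⟶ Z) = tm (a * b) (f ≫ g) := rfl

lemma id_eq (X : Naive k K D) : 𝟙 X = tm 1 (𝟙 X.obj) := rfl

instance (X Y : Naive k K D) : Module K (X ⟶ Y) :=
  inferInstanceAs (Module K (K ⊗[k] (X.obj ⟶ Y.obj)))

lemma smul_tm {X Y : Naive k K D} (r a : K) (f : X.obj ⟶ Y.obj) :
    r • (tm a f : X ⟶ Y) = tm (r * a) f := rfl

instance : Linear K (Naive k K D) where
  homModule X Y := inferInstance
  smul_comp X Y Z r f g := by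
    induction f using hom_induction with
    | zero => simp
    | add f f' hf hf' => simp only [smul_add, Preadditive.add_comp, hf, hf']
    | tmul a f =>
      induction g using hom_induction with
      | zero => simp
      | add f f' hf hf' => simp only [smul_add, Preadditive.comp_add, hf, hf']
      | tmul b g => simp only [smul_tm, tm_comp, mul_assoc]
  comp_smul X Y Z f r g := by
    induction f using hom_induction with
    | zero => simp
    | add f f' hf hf' => simp only [smul_add, Preadditive.add_comp, hf, hf']
    | tmul a f =>
      induction g using hom_induction with
      | zero => simp
      | add f f' hf hf' => simp only [smul_add, Preadditive.comp_add, hf, hf']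
      | tmul b g => simp only [smul_tm, tm_comp, mul_left_comm]

section monoidal

variable [MonoidalCategory D] [MonoidalPreadditive D] [MonoidalLinear k D]

variable (k) in
/-- The tensor product of morphisms of a `k`-linear monoidal category as a bilinear map. -/
def tensorBilin (X Y X' Y' : D) : (X ⟶ Y) →ₗ[k] (X' ⟶ Y') →ₗ[k] (X ⊗ X' ⟶ Y ⊗ Y') :=
  LinearMap.mk₂ k (fun f g => f ⊗ₘ g)
    (by intros; simp [MonoidalCategory.tensorHom_def]) (by intros; simp [MonoidalCategory.tensorHom_def])
    (by intros; simp [MonoidalCategory.tensorHom_def]) (by intros; simp [MonoidalCategory.tensorHom_def])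

/-- The tensor product of morphisms: `(a ⊗ f) ⊗ (b ⊗ g) = ab ⊗ (f ⊗ g)`, extended bilinearly. -/
def tensorNaive {X Y X' Y' : Naive k K D} (f : X ⟶ Y) (g : X' ⟶ Y') :
    (⟨X.obj ⊗ X'.obj⟩ : Naive k K D) ⟶ ⟨Y.obj ⊗ Y'.obj⟩ :=
  TensorProduct.map₂ (LinearMap.mul k K) (tensorBilin k X.obj Y.obj X'.obj Y'.obj) f g

lemma tensorNaive_tm {X Y X' Y' : Naive k K D} (a b : K) (f : X.obj ⟶ Y.obj)
    (g : X'.obj ⟶ Y'.obj) : tensorNaive (tm a f : X ⟶ Y) (tm b g : X' ⟶ Y') =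
      tm (a * b) (f ⊗ₘ g) := rfl

lemma tensorNaive_add_left {X Y X' Y' : Naive k K D} (f f' : X ⟶ Y) (g : X' ⟶ Y') :
    tensorNaive (f + f') g = tensorNaive f g + tensorNaive f' g :=
  LinearMap.map_add₂ (TensorProduct.map₂ (LinearMap.mul k K)
    (tensorBilin k X.obj Y.obj X'.obj Y'.obj)) f f' g

lemma tensorNaive_add_right {X Y X' Y' : Naive k K D} (f : X ⟶ Y) (g g' : X' ⟶ Y') :
    tensorNaive f (g + g') = tensorNaive f g + tensorNaive f g' :=
  map_add (TensorProduct.map₂ (LinearMap.mul k K)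
    (tensorBilin k X.obj Y.obj X'.obj Y'.obj) f) g g'

lemma tensorNaive_zero_left {X Y X' Y' : Naive k K D} (g : X' ⟶ Y') :
    tensorNaive (0 : X ⟶ Y) g = 0 :=
  LinearMap.map_zero₂ (TensorProduct.map₂ (LinearMap.mul k K)
    (tensorBilin k X.obj Y.obj X'.obj Y'.obj)) g

lemma tensorNaive_zero_right {X Y X' Y' : Naive k K D} (f : X ⟶ Y) :
    tensorNaive f (0 : X' ⟶ Y') = 0 :=
  map_zero (TensorProduct.map₂ (LinearMap.mul k K)
    (tensorBilin k X.obj Y.obj X'.obj Y'.obj) f)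

lemma tensorNaive_smul_left {X Y X' Y' : Naive k K D} (r : K) (f : X ⟶ Y) (g : X' ⟶ Y') :
    tensorNaive (r • f) g = r • tensorNaive f g := by
  induction f using hom_induction with
  | zero => simp [tensorNaive_zero_left]
  | add f f' hf hf' => simp only [smul_add, tensorNaive_add_left, hf, hf']
  | tmul a f =>
    induction g using hom_induction with
    | zero => simp [tensorNaive_zero_right]
    | add f f' hf hf' => simp only [smul_add, tensorNaive_add_right, hf, hf']
    | tmul b g => simp only [smul_tm, tensorNaive_tm, mul_assoc]

lemma tensorNaive_smul_right {X Y X' Y' : Naive k K D} (r : K) (f : X ⟶ Y) (g : X' ⟶ Y') :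
    tensorNaive f (r • g) = r • tensorNaive f g := by
  induction f using hom_induction with
  | zero => simp [tensorNaive_zero_left]
  | add f f' hf hf' => simp only [smul_add, tensorNaive_add_left, hf, hf']
  | tmul a f =>
    induction g using hom_induction with
    | zero => simp [tensorNaive_zero_right]
    | add f f' hf hf' => simp only [smul_add, tensorNaive_add_right, hf, hf']
    | tmul b g => simp only [smul_tm, tensorNaive_tm, mul_left_comm]

/-- An isomorphism of `D` viewed as an isomorphism of the naive extension of scalars. -/
def isoOf {X Y : D} (e : X ≅ Y) : (⟨X⟩ : Naive k K D) ≅ ⟨Y⟩ where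
  hom := tm 1 e.hom
  inv := tm 1 e.inv
  hom_inv_id := by rw [tm_comp, id_eq, mul_one, e.hom_inv_id]
  inv_hom_id := by rw [tm_comp, id_eq, mul_one, e.inv_hom_id]

instance : MonoidalCategoryStruct (Naive k K D) where
  tensorObj X Y := ⟨X.obj ⊗ Y.obj⟩
  tensorUnit := ⟨𝟙_ D⟩
  tensorHom f g := tensorNaive f g
  whiskerLeft X _ _ f := tensorNaive (𝟙 X) f
  whiskerRight f Y := tensorNaive f (𝟙 Y)
  associator X Y Z := isoOf (α_ X.obj Y.obj Z.obj)
  leftUnitor X := isoOf (λ_ X.obj)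
  rightUnitor X := isoOf (ρ_ X.obj)

lemma tensorHom_tm {X Y X' Y' : Naive k K D} (a b : K) (f : X.obj ⟶ Y.obj)
    (g : X'.obj ⟶ Y'.obj) : (tm a f : X ⟶ Y) ⊗ₘ (tm b g : X' ⟶ Y') =
      (tm (a * b) (f ⊗ₘ g) : X ⊗ X' ⟶ Y ⊗ Y') := rfl

lemma associator_hom (X Y Z : Naive k K D) :
    (α_ X Y Z).hom = (tm 1 (α_ X.obj Y.obj Z.obj).hom : (X ⊗ Y) ⊗ Z ⟶ X ⊗ (Y ⊗ Z)) := rfl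

lemma leftUnitor_hom (X : Naive k K D) :
    (λ_ X).hom = (tm 1 (λ_ X.obj).hom : 𝟙_ (Naive k K D) ⊗ X ⟶ X) := rfl

lemma rightUnitor_hom (X : Naive k K D) :
    (ρ_ X).hom = (tm 1 (ρ_ X.obj).hom : X ⊗ 𝟙_ (Naive k K D) ⟶ X) := rfl

lemma add_tensorHom {X Y X' Y' : Naive k K D} (f f' : X ⟶ Y) (g : X' ⟶ Y') :
    (f + f') ⊗ₘ g = f ⊗ₘ g + f' ⊗ₘ g := tensorNaive_add_left f f' g

lemma tensorHom_add {X Y X' Y' : Naive k K D} (f : X ⟶ Y) (g g' : X' ⟶ Y') :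
    f ⊗ₘ (g + g') = f ⊗ₘ g + f ⊗ₘ g' := tensorNaive_add_right f g g'

lemma zero_tensorHom {X Y X' Y' : Naive k K D} (g : X' ⟶ Y') :
    (0 : X ⟶ Y) ⊗ₘ g = 0 := tensorNaive_zero_left g

lemma tensorHom_zero {X Y X' Y' : Naive k K D} (f : X ⟶ Y) :
    f ⊗ₘ (0 : X' ⟶ Y') = 0 := tensorNaive_zero_right f

instance : MonoidalCategory (Naive k K D) :=
  MonoidalCategory.ofTensorHom
    (id_tensorHom_id := fun X Y => by
      rw [id_eq, id_eq, tensorHom_tm, id_tensorHom_id, mul_one]; rfl)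
    (id_tensorHom := fun _ _ _ _ => rfl)
    (tensorHom_id := fun _ _ => rfl)
    (tensorHom_comp_tensorHom := fun {X₁ Y₁ Z₁ X₂ Y₂ Z₂} f₁ f₂ g₁ g₂ => by
      induction f₁ using hom_induction with
      | zero => simp [zero_tensorHom]
      | add f f' hf hf' => simp only [add_tensorHom, Preadditive.add_comp, hf, hf']
      | tmul a f =>
        induction f₂ using hom_induction with
        | zero => simp [tensorHom_zero]
        | add f f' hf hf' => simp only [tensorHom_add, Preadditive.add_comp, hf, hf']
        | tmul b f' =>
          induction g₁ using hom_induction with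
          | zero => simp [zero_tensorHom]
          | add f f' hf hf' => simp only [add_tensorHom, Preadditive.comp_add, hf, hf']
          | tmul c g =>
            induction g₂ using hom_induction with
            | zero => simp [tensorHom_zero]
            | add f f' hf hf' => simp only [tensorHom_add, Preadditive.comp_add, hf, hf']
            | tmul d g' =>
              simp only [tm_comp, tensorHom_tm]
              rw [MonoidalCategory.tensorHom_comp_tensorHom, mul_mul_mul_comm])
    (associator_naturality := fun {X₁ X₂ X₃ Y₁ Y₂ Y₃} f₁ f₂ f₃ => by
      induction f₁ using hom_induction with
      | zero => simp [zero_tensorHom]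
      | add f f' hf hf' =>
        simp only [add_tensorHom, Preadditive.add_comp, Preadditive.comp_add, hf, hf']
      | tmul a f =>
        induction f₂ using hom_induction with
        | zero => simp [tensorHom_zero, zero_tensorHom]
        | add f f' hf hf' =>
          simp only [tensorHom_add, add_tensorHom, Preadditive.add_comp,
            Preadditive.comp_add, hf, hf']
        | tmul b g =>
          induction f₃ using hom_induction with
          | zero => simp [tensorHom_zero]
          | add f f' hf hf' =>
            simp only [tensorHom_add, Preadditive.add_comp, Preadditive.comp_add, hf, hf']
          | tmul c h =>
            simp only [tensorHom_tm, associator_hom, tm_comp]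
            rw [one_mul, mul_one, mul_assoc, MonoidalCategory.associator_naturality])
    (leftUnitor_naturality := fun {X Y} f => by
      induction f using hom_induction with
      | zero => simp [tensorHom_zero]
      | add f f' hf hf' =>
        simp only [tensorHom_add, Preadditive.add_comp, Preadditive.comp_add, hf, hf']
      | tmul a f =>
        simp only [id_eq, leftUnitor_hom, tensorHom_tm, tm_comp, one_mul, mul_one]
        exact congrArg (tm a) ((id_tensorHom (𝟙_ D) f).symm ▸ MonoidalCategory.leftUnitor_naturality f))
    (rightUnitor_naturality := fun {X Y} f => by
      induction f using hom_induction with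
      | zero => simp [zero_tensorHom]
      | add f f' hf hf' =>
        simp only [add_tensorHom, Preadditive.add_comp, Preadditive.comp_add, hf, hf']
      | tmul a f =>
        simp only [id_eq, rightUnitor_hom, tensorHom_tm, tm_comp, one_mul, mul_one]
        exact congrArg (tm a) ((tensorHom_id f (𝟙_ D)).symm ▸ MonoidalCategory.rightUnitor_naturality f))
    (pentagon := fun W X Y Z => by
      simp only [id_eq, associator_hom, tensorHom_tm, tm_comp, one_mul]
      exact congrArg (tm 1) (by
        have := MonoidalCategory.pentagon W.obj X.obj Y.obj Z.obj
        rwa [← tensorHom_id, ← id_tensorHom] at this))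
    (triangle := fun X Y => by
      simp only [id_eq, associator_hom, leftUnitor_hom, rightUnitor_hom, tensorHom_tm, tm_comp,
        one_mul]
      exact congrArg (tm 1) (by
        have := MonoidalCategory.triangle X.obj Y.obj
        rwa [← tensorHom_id, ← id_tensorHom] at this))

instance : MonoidalPreadditive (Naive k K D) where
  whiskerLeft_zero := tensorNaive_zero_right _
  zero_whiskerRight := tensorNaive_zero_left _
  whiskerLeft_add f g := tensorNaive_add_right _ f g
  add_whiskerRight f g := tensorNaive_add_left f g _

instance : MonoidalLinear K (Naive k K D) where
  whiskerLeft_smul _ _ _ r f := tensorNaive_smul_right r _ f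
  smul_whiskerRight r _ _ f _ := tensorNaive_smul_left r f _

end monoidal
end Naive
end naive

section karoubi

open Idempotents

variable {C : Type u} [Category.{v} C] [Preadditive C]

instance karoubiSMul {K : Type*} [Field K] [Linear K C] (P Q : Karoubi C) : SMul K (P ⟶ Q) where
  smul r f := ⟨r • f.f, by rw [Linear.smul_comp, Linear.comp_smul, f.comm]⟩

lemma karoubi_smul_f {K : Type*} [Field K] [Linear K C] {P Q : Karoubi C} (r : K) (f : P ⟶ Q) :
    (r • f).f = r • f.f := rfl

instance karoubiModule {K : Type*} [Field K] [Linear K C] (P Q : Karoubi C) : Module K (P ⟶ Q) :=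
  Function.Injective.module K (Karoubi.inclusionHom P Q)
    (fun _ _ h => Karoubi.hom_ext _ _ h) (fun _ _ => rfl)

instance karoubiLinear {K : Type*} [Field K] [Linear K C] : Linear K (Karoubi C) where
  homModule P Q := karoubiModule P Q
  smul_comp _ _ _ r f g := by
    ext; exact Linear.smul_comp _ _ _ r f.f g.f
  comp_smul _ _ _ f r g := by
    ext; exact Linear.comp_smul _ _ _ f.f r g.f

variable [MonoidalCategory C]

/-- An isomorphism compatible with two idempotents induces an isomorphism of their images. -/
@[simps]
def karoubiIso {P Q : Karoubi C} (e : P.X ≅ Q.X) (h : P.p ≫ e.hom = e.hom ≫ Q.p) : P ≅ Q where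
  hom := ⟨P.p ≫ e.hom, by rw [h]; simp only [Category.assoc, Karoubi.idem]; rw [← h, P.idem_assoc]⟩
  inv := ⟨Q.p ≫ e.inv, by
    have h' : Q.p ≫ e.inv = e.inv ≫ P.p := by
      rw [Iso.comp_inv_eq, Category.assoc, h, e.inv_hom_id_assoc]
    rw [h']; simp only [Category.assoc, Karoubi.idem]; rw [← h', Q.idem_assoc]⟩
  hom_inv_id := by
    ext
    change (P.p ≫ e.hom) ≫ Q.p ≫ e.inv = P.p
    rw [Category.assoc, ← reassoc_of% h, e.hom_inv_id, Category.comp_id, P.idem]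
  inv_hom_id := by
    ext
    change (Q.p ≫ e.inv) ≫ P.p ≫ e.hom = Q.p
    rw [h, Category.assoc, e.inv_hom_id_assoc, Q.idem]

/-- `(X, p) ⊗ (Y, q) = (X ⊗ Y, p ⊗ q)`. -/
instance : MonoidalCategoryStruct (Karoubi C) where
  tensorObj P Q := ⟨P.X ⊗ Q.X, P.p ⊗ₘ Q.p, by
    rw [MonoidalCategory.tensorHom_comp_tensorHom, P.idem, Q.idem]⟩
  tensorUnit := ⟨𝟙_ C, 𝟙 _, by simp⟩
  tensorHom f g := ⟨f.f ⊗ₘ g.f, by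
    simp only [MonoidalCategory.tensorHom_comp_tensorHom, f.comm, g.comm]⟩
  whiskerLeft P _ _ f := ⟨P.p ⊗ₘ f.f, by
    simp only [MonoidalCategory.tensorHom_comp_tensorHom, f.comm, P.idem]⟩
  whiskerRight f Q := ⟨f.f ⊗ₘ Q.p, by
    simp only [MonoidalCategory.tensorHom_comp_tensorHom, f.comm, Q.idem]⟩
  associator P Q R := karoubiIso (α_ P.X Q.X R.X) (MonoidalCategory.associator_naturality _ _ _)
  leftUnitor P := karoubiIso (λ_ P.X) (by simp)
  rightUnitor P := karoubiIso (ρ_ P.X) (by simp)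

lemma karoubi_tensorObj_X (P Q : Karoubi C) : (P ⊗ Q).X = P.X ⊗ Q.X := rfl

lemma karoubi_tensorObj_p (P Q : Karoubi C) : (P ⊗ Q).p = P.p ⊗ₘ Q.p := rfl

lemma karoubi_tensorHom_f {P Q P' Q' : Karoubi C} (f : P ⟶ Q) (g : P' ⟶ Q') :
    (f ⊗ₘ g).f = f.f ⊗ₘ g.f := rfl

instance : MonoidalCategory (Karoubi C) :=
  MonoidalCategory.ofTensorHom
    (id_tensorHom_id := fun _ _ => rfl)
    (id_tensorHom := fun _ _ _ _ => rfl)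
    (tensorHom_id := fun _ _ => rfl)
    (tensorHom_comp_tensorHom := fun f₁ f₂ g₁ g₂ => by
      ext; exact MonoidalCategory.tensorHom_comp_tensorHom f₁.f f₂.f g₁.f g₂.f)
    (associator_naturality := fun {X₁ X₂ X₃ Y₁ Y₂ Y₃} f₁ f₂ f₃ => by
      ext
      change ((f₁.f ⊗ₘ f₂.f) ⊗ₘ f₃.f) ≫ ((Y₁.p ⊗ₘ Y₂.p) ⊗ₘ Y₃.p) ≫ (α_ _ _ _).hom =
        (((X₁.p ⊗ₘ X₂.p) ⊗ₘ X₃.p) ≫ (α_ _ _ _).hom) ≫ (f₁.f ⊗ₘ (f₂.f ⊗ₘ f₃.f))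
      rw [Category.assoc, ← MonoidalCategory.associator_naturality, ← Category.assoc,
        ← Category.assoc]
      simp only [MonoidalCategory.tensorHom_comp_tensorHom, Karoubi.p_comp, Karoubi.comp_p])
    (leftUnitor_naturality := fun {X Y} f => by
      ext
      change (𝟙 _ ⊗ₘ f.f) ≫ (𝟙 _ ⊗ₘ Y.p) ≫ (λ_ _).hom = ((𝟙 _ ⊗ₘ X.p) ≫ (λ_ _).hom) ≫ f.f
      simp)
    (rightUnitor_naturality := fun {X Y} f => by
      ext
      change (f.f ⊗ₘ 𝟙 _) ≫ (Y.p ⊗ₘ 𝟙 _) ≫ (ρ_ _).hom = ((X.p ⊗ₘ 𝟙 _) ≫ (ρ_ _).hom) ≫ f.f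
      simp)
    (pentagon := fun W X Y Z => by
      ext
      change ((((W.p ⊗ₘ X.p) ⊗ₘ Y.p) ≫ (α_ _ _ _).hom) ⊗ₘ Z.p) ≫
        (((W.p ⊗ₘ (X.p ⊗ₘ Y.p)) ⊗ₘ Z.p) ≫ (α_ _ _ _).hom) ≫
          (W.p ⊗ₘ (((X.p ⊗ₘ Y.p) ⊗ₘ Z.p) ≫ (α_ _ _ _).hom)) =
        ((((W.p ⊗ₘ X.p) ⊗ₘ Y.p) ⊗ₘ Z.p) ≫ (α_ _ _ _).hom) ≫
          ((W.p ⊗ₘ X.p) ⊗ₘ (Y.p ⊗ₘ Z.p)) ≫ (α_ _ _ _).hom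
      have hA : (((W.p ⊗ₘ X.p) ⊗ₘ Y.p) ⊗ₘ Z.p) ≫ (((W.p ⊗ₘ X.p) ⊗ₘ Y.p) ⊗ₘ Z.p) =
          (((W.p ⊗ₘ X.p) ⊗ₘ Y.p) ⊗ₘ Z.p) := by
        simp only [MonoidalCategory.tensorHom_comp_tensorHom, Karoubi.idem]
      have h₁ : ((((W.p ⊗ₘ X.p) ⊗ₘ Y.p) ≫ (α_ _ _ _).hom) ⊗ₘ Z.p) =
          (((W.p ⊗ₘ X.p) ⊗ₘ Y.p) ⊗ₘ Z.p) ≫ ((α_ _ _ _).hom ▷ Z.X) := by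
        rw [← tensorHom_id, MonoidalCategory.tensorHom_comp_tensorHom, Category.comp_id]
      have h₂ : (W.p ⊗ₘ (((X.p ⊗ₘ Y.p) ⊗ₘ Z.p) ≫ (α_ _ _ _).hom)) =
          (W.p ⊗ₘ ((X.p ⊗ₘ Y.p) ⊗ₘ Z.p)) ≫ (W.X ◁ (α_ _ _ _).hom) := by
        rw [← id_tensorHom, MonoidalCategory.tensorHom_comp_tensorHom, Category.comp_id]
      have h₃ : ((α_ W.X X.X Y.X).hom ▷ Z.X) ≫ ((W.p ⊗ₘ (X.p ⊗ₘ Y.p)) ⊗ₘ Z.p) =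
          (((W.p ⊗ₘ X.p) ⊗ₘ Y.p) ⊗ₘ Z.p) ≫ ((α_ _ _ _).hom ▷ Z.X) := by
        rw [← tensorHom_id, MonoidalCategory.tensorHom_comp_tensorHom,
          MonoidalCategory.tensorHom_comp_tensorHom, Category.comp_id, Category.id_comp,
          MonoidalCategory.associator_naturality]
      rw [h₁, h₂]
      simp only [Category.assoc]
      rw [← MonoidalCategory.associator_naturality_assoc,
        ← MonoidalCategory.associator_naturality_assoc, reassoc_of% h₃, reassoc_of% h₃,
        reassoc_of% hA, reassoc_of% hA, reassoc_of% hA, MonoidalCategory.pentagon])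
    (triangle := fun X Y => by
      ext
      change (((X.p ⊗ₘ 𝟙 _) ⊗ₘ Y.p) ≫ (α_ _ _ _).hom) ≫ (X.p ⊗ₘ ((𝟙 _ ⊗ₘ Y.p) ≫ (λ_ _).hom)) =
        ((X.p ⊗ₘ 𝟙 _) ≫ (ρ_ _).hom) ⊗ₘ Y.p
      have h₁ : (X.p ⊗ₘ ((𝟙 (𝟙_ C) ⊗ₘ Y.p) ≫ (λ_ _).hom)) =
          (X.p ⊗ₘ (𝟙 _ ⊗ₘ Y.p)) ≫ (X.X ◁ (λ_ _).hom) := by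
        rw [← id_tensorHom, MonoidalCategory.tensorHom_comp_tensorHom, Category.comp_id]
      have h₂ : (((X.p ⊗ₘ 𝟙 (𝟙_ C)) ≫ (ρ_ _).hom) ⊗ₘ Y.p) =
          ((X.p ⊗ₘ 𝟙 _) ⊗ₘ Y.p) ≫ ((ρ_ _).hom ▷ Y.X) := by
        rw [← tensorHom_id, MonoidalCategory.tensorHom_comp_tensorHom, Category.comp_id]
      have hA : ((X.p ⊗ₘ 𝟙 (𝟙_ C)) ⊗ₘ Y.p) ≫ ((X.p ⊗ₘ 𝟙 (𝟙_ C)) ⊗ₘ Y.p) =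
          ((X.p ⊗ₘ 𝟙 (𝟙_ C)) ⊗ₘ Y.p) := by
        simp only [MonoidalCategory.tensorHom_comp_tensorHom, Karoubi.idem, Category.comp_id]
      rw [h₁, h₂, Category.assoc, ← MonoidalCategory.associator_naturality_assoc,
        reassoc_of% hA, MonoidalCategory.triangle])

instance [MonoidalPreadditive C] : MonoidalPreadditive (Karoubi C) where
  whiskerLeft_zero {P _ _} := by
    ext
    change P.p ⊗ₘ 0 = 0
    simp [MonoidalCategory.tensorHom_def]
  zero_whiskerRight {P _ _} := by
    ext
    change 0 ⊗ₘ P.p = 0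
    simp [MonoidalCategory.tensorHom_def]
  whiskerLeft_add {P _ _} f g := by
    ext
    change P.p ⊗ₘ (f.f + g.f) = P.p ⊗ₘ f.f + P.p ⊗ₘ g.f
    simp [MonoidalCategory.tensorHom_def]
  add_whiskerRight {P _ _} f g := by
    ext
    change (f.f + g.f) ⊗ₘ P.p = f.f ⊗ₘ P.p + g.f ⊗ₘ P.p
    simp [MonoidalCategory.tensorHom_def]

instance {K : Type*} [Field K] [Linear K C] [MonoidalPreadditive C] [MonoidalLinear K C] :
    MonoidalLinear K (Karoubi C) where
  whiskerLeft_smul P _ _ r f := by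
    ext
    change P.p ⊗ₘ (r • f.f) = r • (P.p ⊗ₘ f.f)
    simp [MonoidalCategory.tensorHom_def]
  smul_whiskerRight r _ _ f P := by
    ext
    change (r • f.f) ⊗ₘ P.p = r • (f.f ⊗ₘ P.p)
    simp [MonoidalCategory.tensorHom_def]

end karoubi

section ind

variable (k : Type v) [Field k] (K : Type v) [Field K] [Algebra k K]
  (T : Type u) [Category.{v} T] [Preadditive T] [Linear k T]

/-- A presheaf of `K`-vector spaces on `T` that is `k`-linear as a functor. -/
def IsScalarLinear : ObjectProperty (Tᵒᵖ ⥤ ModuleCat.{v} K) := fun F =>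
  F.Additive ∧ ∀ ⦃X Y : T⦄ (r : k) (f : X ⟶ Y),
    F.map (r • f).op = algebraMap k K r • F.map f.op

/-- The category `(Ind T)_K` of `K`-modules in `Ind T`. For an essentially small `k`-linear abelian
category `T`, the category `Ind T` is the category of left exact `k`-linear functors from `Tᵒᵖ` to
`k`-vector spaces; an action of `K` by endomorphisms on such a functor is the same as a lift of the
functor to `K`-vector spaces (left exactness and `k`-linearity do not change). -/
abbrev IndExt : Type (max u (v + 1)) :=
  (ObjectProperty.preservesFiniteLimits ⊓ IsScalarLinear k K T).FullSubcategory

/-- The category `T_K`: the full subcategory of compact objects of `(Ind T)_K`, i.e. of those `M` for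
which `Hom(M, -)` commutes with filtered colimits. -/
abbrev CompactExt : Type (max u (v + 1)) :=
  (ObjectProperty.isFinitelyPresentable.{v} (IndExt k K T)).FullSubcategory

/-- The pseudo-abelian envelope of the naive extension of scalars `K ⊗ T`. Since `T` is additive in all
uses, so is the naive extension, and the envelope is its idempotent completion. -/
abbrev PseudoAbelianExt : Type (max u v) := Idempotents.Karoubi (Naive k K T)

variable {T} in
lemma smul_naive_eq {X Y : Naive k K T} (r : k) (f : X.obj ⟶ Y.obj) (a : K) :
    (Naive.tm a (r • f) : X ⟶ Y) = algebraMap k K r • Naive.tm a f := by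
  rw [Naive.smul_tm, ← Algebra.smul_def]
  exact (TensorProduct.smul_tmul r a f).symm

/-- The functor from `T` to its naive extension of scalars: `X ↦ X`, `f ↦ 1 ⊗ f` -/
@[simps]
def toNaive : T ⥤ Naive k K T where
  obj X := ⟨X⟩
  map f := Naive.tm 1 f
  map_id X := rfl
  map_comp f g := by rw [Naive.tm_comp, mul_one]

/-- An object `P` of the pseudo-abelian extension, viewed as the presheaf `X ↦ Hom(K ⊗ X, P)` of
`K`-vector spaces on `T`. For `P = K ⊗ Y` this is `K ⊗ Hom(-, Y)`, that is, the free `K`-module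
on the ind-object `Y`. -/
def restrictedYoneda : PseudoAbelianExt k K T ⥤ Tᵒᵖ ⥤ ModuleCat.{v} K :=
  linearYoneda K (PseudoAbelianExt k K T) ⋙
    (Functor.whiskeringLeft _ _ _).obj (toNaive k K T ⋙ Idempotents.toKaroubi _).op

/-- The object `K ⊗ X` in the pseudo-abelian extension. -/
abbrev free (X : T) : PseudoAbelianExt k K T :=
  (Idempotents.toKaroubi _).obj ((toNaive k K T).obj X)

variable {T} in
lemma restrictedYoneda_map_apply (P : PseudoAbelianExt k K T) {X Y : T} (f : X ⟶ Y)
    (x : free k K T Y ⟶ P) :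
    ((restrictedYoneda k K T).obj P).map f.op x =
      (Idempotents.toKaroubi _).map ((toNaive k K T).map f) ≫ x := rfl

variable {T} in
lemma toNaive_map_add {X Y : T} (f g : X ⟶ Y) :
    (toNaive k K T).map (f + g) = (toNaive k K T).map f + (toNaive k K T).map g :=
  TensorProduct.tmul_add (1 : K) f g

variable {T} in
lemma toNaive_map_smul {X Y : T} (r : k) (f : X ⟶ Y) :
    (toNaive k K T).map (r • f) = algebraMap k K r • (toNaive k K T).map f :=
  smul_naive_eq k K (X := ⟨X⟩) (Y := ⟨Y⟩) r f 1

lemma restrictedYoneda_linear (P : PseudoAbelianExt k K T) :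
    IsScalarLinear k K T ((restrictedYoneda k K T).obj P) := by
  refine ⟨⟨fun {X Y f g} => ?_⟩, fun X Y r f => ?_⟩
  · refine ModuleCat.hom_ext (LinearMap.ext fun x => ?_)
    refine (restrictedYoneda_map_apply k K P (f.unop + g.unop) x).trans ?_
    apply Idempotents.Karoubi.hom_ext
    refine (congrArg (· ≫ x.f) (toNaive_map_add k K f.unop g.unop)).trans ?_
    exact Preadditive.add_comp _ _ _ _ _ _
  · refine ModuleCat.hom_ext (LinearMap.ext fun x => ?_)
    refine (restrictedYoneda_map_apply k K P (r • f) x).trans ?_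
    apply Idempotents.Karoubi.hom_ext
    refine (congrArg (· ≫ x.f) (toNaive_map_smul k K r f)).trans ?_
    exact Linear.smul_comp _ _ _ _ _ _

variable {T} in
lemma freeIso_aux {X Y Z : T} (g : Z ⟶ Y) (x : K ⊗[k] (Y ⟶ X)) :
    compNaive k K Z Y X (1 ⊗ₜ g) x =
      LinearMap.lTensor K (Linear.leftComp k X g) x := by
  induction x using TensorProduct.induction_on with
  | zero => simp
  | tmul a f => simp
  | add x y hx hy => rw [map_add, map_add, hx, hy]

/-- On underlying sets, `K ⊗ X` is the presheaf `K ⊗ Hom(-, X)`. -/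
def freeIso (X : T) :
    (restrictedYoneda k K T).obj (free k K T X) ⋙ CategoryTheory.forget (ModuleCat.{v} K) ≅
    ((linearYoneda k T).obj X ⋙ tensorLeft (ModuleCat.of k K)) ⋙
      CategoryTheory.forget (ModuleCat.{v} k) :=
  NatIso.ofComponents (fun Y => Equiv.toIso
    { toFun := fun f => (f.f : K ⊗[k] (Y.unop ⟶ X))
      invFun := fun f => ⟨(f : K ⊗[k] (Y.unop ⟶ X)), by
        change 𝟙 (⟨Y.unop⟩ : Naive k K T) ≫ _ ≫ 𝟙 (⟨X⟩ : Naive k K T) = _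
        exact (Category.id_comp _).trans (Category.comp_id _)⟩
      left_inv := fun _ => rfl
      right_inv := fun _ => rfl }) (fun {Y Z} f => by
        ext x
        exact freeIso_aux k K f.unop x.f)

lemma preservesFiniteLimits_free (X : T) :
    PreservesFiniteLimits ((restrictedYoneda k K T).obj (free k K T X)) := by
  have h₁ : PreservesFiniteLimits (tensorLeft (ModuleCat.of k K)) := inferInstance
  have h₂ : PreservesFiniteLimits ((linearYoneda k T).obj X) := by
    have : PreservesFiniteLimits ((linearYoneda k T).obj X ⋙ CategoryTheory.forget (ModuleCat.{v} k)) :=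
      inferInstanceAs (PreservesFiniteLimits (yoneda.obj X))
    exact preservesFiniteLimits_of_reflects_of_preserves _ (CategoryTheory.forget (ModuleCat.{v} k))
  have : PreservesFiniteLimits ((restrictedYoneda k K T).obj (free k K T X) ⋙ CategoryTheory.forget (ModuleCat.{v} K)) :=
    preservesFiniteLimits_of_natIso (freeIso k K T X).symm
  exact preservesFiniteLimits_of_reflects_of_preserves _ (CategoryTheory.forget (ModuleCat.{v} K))

/-- Every object of the pseudo-abelian extension is a retract of some `K ⊗ X`. -/
def retractFree (P : PseudoAbelianExt k K T) : Retract P (free k K T P.X.obj) where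
  i := ⟨P.p, by change P.p ≫ P.p ≫ 𝟙 _ = _; simp⟩
  r := ⟨P.p, by change 𝟙 _ ≫ P.p ≫ P.p = _; simp⟩
  retract := by ext; exact P.idem

lemma preservesFiniteLimits_of_retract {C : Type*} [Category C] {D : Type*} [Category D]
    {F G : C ⥤ D} (h : Retract F G) [PreservesFiniteLimits G] : PreservesFiniteLimits F := by
  refine ⟨fun J _ _ => ⟨fun {L} => ⟨fun {c} hc => ⟨?_⟩⟩⟩⟩
  have hG := isLimitOfPreserves G hc
  have hr : ∀ X, h.i.app X ≫ h.r.app X = 𝟙 _ := fun X => by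
    rw [← NatTrans.comp_app, h.retract, NatTrans.id_app]
  let t : ∀ s : Cone (L ⋙ F), Cone (L ⋙ G) := fun s =>
    (Cone.postcompose (Functor.whiskerLeft L h.i)).obj s
  refine IsLimit.mk (fun s => hG.lift (t s) ≫ h.r.app c.pt) (fun s j => ?_) (fun s m hm => ?_)
  · have := hG.fac (t s) j
    dsimp [t] at this ⊢
    rw [Category.assoc, ← h.r.naturality, reassoc_of% this, hr, Category.comp_id]
  · have : m ≫ h.i.app c.pt = hG.lift (t s) := hG.hom_ext (fun j => by
      rw [hG.fac]
      have := hm j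
      dsimp [t] at this ⊢
      rw [Category.assoc, ← h.i.naturality, reassoc_of% this])
    rw [← this, Category.assoc, hr]; exact (Category.comp_id m).symm

lemma restrictedYoneda_mem (P : PseudoAbelianExt k K T) :
    (ObjectProperty.preservesFiniteLimits ⊓ IsScalarLinear k K T)
      ((restrictedYoneda k K T).obj P) :=
  ⟨by
    have := preservesFiniteLimits_free k K T P.X.obj
    exact preservesFiniteLimits_of_retract
      ((retractFree k K T P).map (restrictedYoneda k K T)), restrictedYoneda_linear k K T P⟩

/-- The canonical functor from the pseudo-abelian extension to `(Ind T)_K`. -/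
def toIndExt : PseudoAbelianExt k K T ⥤ IndExt k K T :=
  ObjectProperty.lift _ (restrictedYoneda k K T) (restrictedYoneda_mem k K T)

instance isScalarLinear_closed (J : Type v) [SmallCategory J] :
    (IsScalarLinear k K T).IsClosedUnderColimitsOfShape J where
  colimitsOfShape_le := by
    rintro G ⟨h⟩
    have hc : ∀ X, IsColimit (((evaluation _ _).obj X).mapCocone h.cocone) := fun X =>
      isColimitOfPreserves ((evaluation _ _).obj X) h.isColimit
    refine ⟨⟨fun {X Y f g} => (hc X).hom_ext fun j => ?_⟩,
      fun X Y r f => (hc (op Y)).hom_ext fun j => ?_⟩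
    · let φ : h.diag.obj j ⟶ G := h.ι.app j
      have h' : (h.diag.obj j).map (f + g) = (h.diag.obj j).map f + (h.diag.obj j).map g :=
        (h.prop_diag_obj j).1.map_add
      change φ.app X ≫ G.map (f + g) = φ.app X ≫ (G.map f + G.map g)
      rw [Preadditive.comp_add, ← NatTrans.naturality, ← NatTrans.naturality,
        ← NatTrans.naturality, h']
      exact Preadditive.add_comp _ _ _ _ _ _
    · let φ : h.diag.obj j ⟶ G := h.ι.app j
      have h' := (h.prop_diag_obj j).2 r f
      change φ.app (op Y) ≫ G.map (r • f).op =
        φ.app (op Y) ≫ (algebraMap k K r • G.map f.op)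
      rw [Linear.comp_smul, ← NatTrans.naturality, ← NatTrans.naturality, h']
      exact Linear.smul_comp _ _ _ _ _ _

variable {T} in
/-- The map `K ⊗ Hom(Y, X) → H(Y)`, `a ⊗ f ↦ a • H(f)(h)`. -/
def yonedaInv {H : Tᵒᵖ ⥤ ModuleCat.{v} K} (hH : IsScalarLinear k K T H) {X : T}
    (h : H.obj (op X)) (Y : T) : K ⊗[k] (Y ⟶ X) →ₗ[K] H.obj (op Y) :=
  letI : Module k (H.obj (op Y)) := Module.compHom _ (algebraMap k K)
  haveI : IsScalarTower k K (H.obj (op Y)) := ⟨fun r a x => by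
    rw [Algebra.smul_def, mul_smul]; rfl⟩
  TensorProduct.AlgebraTensorModule.lift
    (LinearMap.toSpanSingleton K _
      { toFun := fun f => H.map f.op h
        map_add' := fun f g => by
          have := hH.1.map_add (f := f.op) (g := g.op)
          exact congrArg (fun φ : H.obj (op X) ⟶ H.obj (op Y) => φ h) this
        map_smul' := fun r f =>
          congrArg (fun φ : H.obj (op X) ⟶ H.obj (op Y) => φ h) (hH.2 r f) })

variable {T} in
lemma yonedaInv_tmul {H : Tᵒᵖ ⥤ ModuleCat.{v} K} (hH : IsScalarLinear k K T H) {X : T}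
    (h : H.obj (op X)) (Y : T) (a : K) (f : Y ⟶ X) :
    yonedaInv k K hH h Y (a ⊗ₜ f) = a • H.map f.op h := rfl

variable {T} in
lemma yonedaInv_naturality {H : Tᵒᵖ ⥤ ModuleCat.{v} K} (hH : IsScalarLinear k K T H) {X : T}
    (h : H.obj (op X)) {Y Z : T} (g : Z ⟶ Y) (x : K ⊗[k] (Y ⟶ X)) :
    yonedaInv k K hH h Z (compNaive k K Z Y X (1 ⊗ₜ g) x) =
      H.map g.op (yonedaInv k K hH h Y x) := by
  induction x using TensorProduct.induction_on with
  | zero => simp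
  | add x y hx hy => rw [map_add, map_add, map_add, map_add, hx, hy]
  | tmul a f =>
    rw [compNaive_tmul, yonedaInv_tmul, yonedaInv_tmul, map_smul, one_mul, op_comp, H.map_comp]
    rfl

variable {T} in
lemma yonedaInv_app {H : Tᵒᵖ ⥤ ModuleCat.{v} K} (hH : IsScalarLinear k K T H) {X Y : T}
    (φ : (restrictedYoneda k K T).obj (free k K T X) ⟶ H) (f : free k K T Y ⟶ free k K T X) :
    yonedaInv k K hH (φ.app (op X) (𝟙 (free k K T X))) Y f.f = φ.app (op Y) f := by
  let ψ : K ⊗[k] (Y ⟶ X) →ₗ[K] H.obj (op Y) := (φ.app (op Y)).hom ∘ₗ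
    { toFun := fun x => (⟨x, (Category.id_comp _).trans (Category.comp_id _)⟩ :
        free k K T Y ⟶ free k K T X)
      map_add' := fun _ _ => rfl
      map_smul' := fun _ _ => rfl }
  have key : yonedaInv k K hH (φ.app (op X) (𝟙 (free k K T X))) Y = ψ := by
    refine LinearMap.ext fun x => ?_
    induction x using TensorProduct.induction_on with
    | zero => simp
    | add x y hx hy => rw [map_add, map_add, hx, hy]
    | tmul a g =>
      rw [yonedaInv_tmul]
      have h₁ : H.map g.op (φ.app (op X) (𝟙 (free k K T X))) = ψ (1 ⊗ₜ g) := by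
        refine (congrArg (fun m => m (𝟙 (free k K T X))) (φ.naturality g.op)).symm.trans ?_
        refine congrArg (φ.app (op Y)).hom ?_
        apply Idempotents.Karoubi.hom_ext
        exact Category.comp_id _
      rw [h₁, ← map_smul, TensorProduct.smul_tmul', smul_eq_mul, mul_one]
  exact congrArg (fun m => m f.f) key

/-- The Yoneda lemma: a morphism `K ⊗ X ⟶ H` is an element of `H(X)`. -/
def freeHomEquiv (X : T) (H : Tᵒᵖ ⥤ ModuleCat.{v} K) (hH : IsScalarLinear k K T H) :
    ((restrictedYoneda k K T).obj (free k K T X) ⟶ H) ≃ H.obj (op X) where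
  toFun φ := φ.app (op X) (𝟙 (free k K T X))
  invFun h :=
    { app := fun Y => ModuleCat.ofHom
        { toFun := fun f => yonedaInv k K hH h Y.unop f.f
          map_add' := fun f g => map_add (yonedaInv k K hH h Y.unop) _ _
          map_smul' := fun r f => map_smul (yonedaInv k K hH h Y.unop) _ _ }
      naturality := fun Y Z g => by
        refine ModuleCat.hom_ext (LinearMap.ext fun f => ?_)
        exact yonedaInv_naturality k K hH h g.unop f.f }
  left_inv φ := by
    ext Y f
    exact yonedaInv_app k K hH φ f
  right_inv h := by
    refine (yonedaInv_tmul k K hH h X 1 (𝟙 X)).trans ?_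
    rw [one_smul, op_id, H.map_id]; rfl

/-- The functor represented by `K ⊗ X` on `(Ind T)_K` is evaluation at `X`. -/
def coyonedaFreeIso (X : T) :
    coyoneda.obj (op ((toIndExt k K T).obj (free k K T X))) ≅
      (ObjectProperty.ι _ ⋙ (evaluation _ _).obj (op X) ⋙
        CategoryTheory.forget (ModuleCat.{v} K)) ⋙ uliftFunctor.{u, v} :=
  NatIso.ofComponents (fun H => Equiv.toIso
    (((ObjectProperty.fullyFaithfulι _).homEquiv.trans
      (freeHomEquiv k K T X H.obj H.property.2)).trans Equiv.ulift.symm)) (fun {H H'} f => by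
        ext x; rfl)

section
attribute [local instance] Cardinal.fact_isRegular_aleph0

lemma isFinitelyPresentable_toIndExt (P : PseudoAbelianExt k K T) :
    ObjectProperty.isFinitelyPresentable.{v} (IndExt k K T) ((toIndExt k K T).obj P) := by
  have h : IsFinitelyPresentable.{v} ((toIndExt k K T).obj (free k K T P.X.obj)) := by
    rw [isFinitelyPresentable_iff_preservesFilteredColimitsOfSize]
    refine ⟨fun J _ _ => ?_⟩
    have hl : (IsScalarLinear k K T).IsClosedUnderColimitsOfShape J := inferInstance
    have hp : (ObjectProperty.preservesFiniteLimits :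
      ObjectProperty (Tᵒᵖ ⥤ ModuleCat.{v} K)).IsClosedUnderColimitsOfShape J := inferInstance
    have hc : (ObjectProperty.preservesFiniteLimits ⊓ IsScalarLinear k K T).IsClosedUnderColimitsOfShape J :=
      ⟨fun G ⟨h⟩ => ⟨hp.colimitsOfShape_le _ ⟨⟨h.toColimitPresentation, fun j => (h.prop_diag_obj j).1⟩⟩,
        hl.colimitsOfShape_le _ ⟨⟨h.toColimitPresentation, fun j => (h.prop_diag_obj j).2⟩⟩⟩⟩
    have : PreservesColimitsOfShape J (ObjectProperty.preservesFiniteLimits ⊓ IsScalarLinear k K T).ι := inferInstance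
    have := PreservesColimitsOfShape J (CategoryTheory.forget (ModuleCat.{v} K))
    exact preservesColimitsOfShape_of_natIso (coyonedaFreeIso k K T P.X.obj).symm
  exact ((retractFree k K T P).map (toIndExt k K T)).isCardinalPresentable _

end

/-- The canonical functor from the pseudo-abelian extension to `T_K`, sending `K ⊗ X` to the free
`K`-module on `X`. -/
def toCompactExt : PseudoAbelianExt k K T ⥤ CompactExt k K T :=
  ObjectProperty.lift _ (toIndExt k K T) (isFinitelyPresentable_toIndExt k K T)

end ind

section tensor

variable (k : Type v) [Field k] (K : Type v) [Field K] [Algebra k K]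
  {T : Type u} [Category.{v} T] [Preadditive T] [Linear k T] [MonoidalCategory T]

/-- A `K`-bilinear natural family of maps `M(X) × N(Y) → H(X ⊗ Y)`. For `K`-modules `M`, `N`, `H` in
`Ind T` this is the same as a `K`-balanced `K`-linear morphism `M ⊗ N ⟶ H` (tensor product of
`Ind T`), hence the same as a morphism `M ⊗_K N ⟶ H` of `K`-modules. -/
@[ext]
structure BilinearTransformation (M N H : Tᵒᵖ ⥤ ModuleCat.{v} K) where
  /-- the bilinear maps -/
  app : ∀ X Y : T, M.obj (op X) →ₗ[K] N.obj (op Y) →ₗ[K] H.obj (op (X ⊗ Y))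
  naturality : ∀ {X X' Y Y' : T} (f : X' ⟶ X) (g : Y' ⟶ Y) (m : M.obj (op X)) (n : N.obj (op Y)),
    app X' Y' (M.map f.op m) (N.map g.op n) = H.map (f ⊗ₘ g).op (app X Y m n)

variable {K} in
/-- Composition of a bilinear transformation with a morphism. -/
def BilinearTransformation.postcomp {M N H H' : Tᵒᵖ ⥤ ModuleCat.{v} K}
    (β : BilinearTransformation K M N H) (φ : H ⟶ H') : BilinearTransformation K M N H' where
  app X Y := (β.app X Y).compr₂ (φ.app (op (X ⊗ Y))).hom
  naturality f g m n := by
    simp only [LinearMap.compr₂_apply, β.naturality]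
    exact congrArg (fun ψ => ψ (β.app _ _ m n)) (φ.naturality (f ⊗ₘ g).op)

variable (T) in
/-- The statement (as data) that the given monoidal structure on `T_K` is the tensor product of
`K`-modules in `Ind T`: the object `M ⊗ N` is the relative tensor product `M ⊗_K N` formed in
`(Ind T)_K`, i.e. it carries a bilinear transformation `(m, n) ↦ m ⊗ n` that is universal among
those with values in arbitrary objects of `(Ind T)_K`; the unit is the free `K`-module on the unit
of `T`, i.e. it carries a universal element over the unit of `T`; and the tensor product of
morphisms, the associator and the unitors are the canonical ones, i.e.
`(φ ⊗ ψ)(m ⊗ n) = φ m ⊗ ψ n`, `(m ⊗ n) ⊗ p ↦ m ⊗ (n ⊗ p)`, `1 ⊗ m ↦ m` and `m ⊗ 1 ↦ m`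
up to the constraints of `T`. By the universal properties, this determines the monoidal structure
up to a unique isomorphism. -/
structure RelativeTensor [MonoidalCategory (CompactExt k K T)] where
  /-- `(m, n) ↦ m ⊗ n` -/
  mul : ∀ M N : CompactExt k K T,
    BilinearTransformation K M.obj.obj N.obj.obj (M ⊗ N).obj.obj
  /-- the unit element -/
  one : (𝟙_ (CompactExt k K T)).obj.obj.obj (op (𝟙_ T))
  mul_universal : ∀ (M N : CompactExt k K T) (H : IndExt k K T),
    Function.Bijective fun φ : (M ⊗ N).obj.obj ⟶ H.obj => (mul M N).postcomp φ
  one_universal : ∀ H : IndExt k K T,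
    Function.Bijective fun φ : (𝟙_ (CompactExt k K T)).obj.obj ⟶ H.obj => φ.app (op (𝟙_ T)) one
  tensorHom_mul : ∀ {M M' N N' : CompactExt k K T} (φ : M ⟶ M') (ψ : N ⟶ N') (X Y : T)
    (m : M.obj.obj.obj (op X)) (n : N.obj.obj.obj (op Y)),
    (φ ⊗ₘ ψ).hom.hom.app (op (X ⊗ Y)) ((mul M N).app X Y m n) =
      (mul M' N').app X Y (φ.hom.hom.app (op X) m) (ψ.hom.hom.app (op Y) n)
  associator_mul : ∀ (M N P : CompactExt k K T) (X Y Z : T)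
    (m : M.obj.obj.obj (op X)) (n : N.obj.obj.obj (op Y)) (p : P.obj.obj.obj (op Z)),
    (α_ M N P).hom.hom.hom.app (op ((X ⊗ Y) ⊗ Z))
        ((mul (M ⊗ N) P).app (X ⊗ Y) Z ((mul M N).app X Y m n) p) =
      (M ⊗ (N ⊗ P)).obj.obj.map (α_ X Y Z).hom.op
        ((mul M (N ⊗ P)).app X (Y ⊗ Z) m ((mul N P).app Y Z n p))
  leftUnitor_mul : ∀ (M : CompactExt k K T) (X : T) (m : M.obj.obj.obj (op X)),
    (λ_ M).hom.hom.hom.app (op (𝟙_ T ⊗ X)) ((mul (𝟙_ _) M).app (𝟙_ T) X one m) =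
      M.obj.obj.map (λ_ X).hom.op m
  rightUnitor_mul : ∀ (M : CompactExt k K T) (X : T) (m : M.obj.obj.obj (op X)),
    (ρ_ M).hom.hom.hom.app (op (X ⊗ 𝟙_ T)) ((mul M (𝟙_ _)).app X (𝟙_ T) m one) =
      M.obj.obj.map (ρ_ X).hom.op m

/-- `T_K`, with the tensor product of `K`-modules in `Ind T`, is a tensor category over `K`. In
particular the tensor product over `K` of two compact objects exists and is compact. -/
def ScalarExtensionIsTensorCategory (T : Type u) [Category.{v} T] [Preadditive T] [Linear k T]
    [MonoidalCategory T] : Prop :=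
  ∃ (_ : MonoidalCategory (CompactExt k K T)) (_ : RelativeTensor k K T)
    (_ : MonoidalPreadditive (CompactExt k K T)) (_ : MonoidalLinear K (CompactExt k K T)),
    IsTensorCategory K (CompactExt k K T)

/-- A tensor category `T` over `k` is absolute if `T_K` is a tensor category over `K` for every field
extension `K` of `k`. -/
def IsAbsolute (T : Type u) [Category.{v} T] [Preadditive T] [Linear k T]
    [MonoidalCategory T] : Prop :=
  ∀ (K : Type v) [Field K] [Algebra k K], ScalarExtensionIsTensorCategory k K T

variable [MonoidalPreadditive T] [MonoidalLinear k T]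

/-- The monoidal structure on the canonical functor `Φ` to `T_K` is the canonical one: over
elements `f` of `Φ P` and `g` of `Φ Q`, i.e. morphisms `f : K ⊗ X ⟶ P` and `g : K ⊗ Y ⟶ Q`, the
isomorphism `Φ P ⊗ Φ Q ⟶ Φ (P ⊗ Q)` sends `f ⊗ g` to the tensor product of morphisms
`f ⊗ g : K ⊗ (X ⊗ Y) ⟶ P ⊗ Q`, and the isomorphism `𝟙 ⟶ Φ 𝟙` sends `1` to the identity. -/
structure IsCanonicalMonoidal [MonoidalCategory (CompactExt k K T)] (R : RelativeTensor k K T)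
    [(toCompactExt k K T).Monoidal] : Prop where
  tensor : ∀ (P Q : PseudoAbelianExt k K T) (X Y : T) (f : free k K T X ⟶ P)
    (g : free k K T Y ⟶ Q),
    (((Functor.LaxMonoidal.μ (toCompactExt k K T) P Q).hom.hom.app (op (X ⊗ Y))
      ((R.mul ((toCompactExt k K T).obj P) ((toCompactExt k K T).obj Q)).app X Y f g) :
        free k K T (X ⊗ Y) ⟶ P ⊗ Q)).f = f.f ⊗ₘ g.f
  unit : (((Functor.LaxMonoidal.ε (toCompactExt k K T)).hom.hom.app (op (𝟙_ T)) R.one :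
      free k K T (𝟙_ T) ⟶ 𝟙_ (PseudoAbelianExt k K T))).f = 𝟙 (𝟙_ (Naive k K T))

variable (T) in
/-- The pseudo-abelian extension equals `T_K`: the canonical functor is a `K`-linear monoidal
equivalence, for the tensor product of `K`-modules in `Ind T` on the target. -/
def ScalarExtensionEqPseudoAbelian : Prop :=
  (toCompactExt k K T).IsEquivalence ∧ (toCompactExt k K T).Additive ∧
    (toCompactExt k K T).Linear K ∧
    ∃ (_ : MonoidalCategory (CompactExt k K T)) (R : RelativeTensor k K T)
      (_ : (toCompactExt k K T).Monoidal), IsCanonicalMonoidal k K R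

end tensor
end ScalarExtension
end

noncomputable section

namespace ScalarExtension

/-! Everything rests on one property: each morphism `f` has some `g` with `f ≫ g ≫ f = f`
(`IsRegularCategory`). A semisimple category with kernels has it. Conversely, an additive idempotent
complete category with it is abelian (`IsRegularCategory.isAbelianCategory`), and it is also
semisimple once its morphism spaces are finite dimensional over a field
(`IsRegularCategory.isSemisimpleCategory`). The property survives idempotent completion and
equivalence, so the essential question is whether it survives extension of scalars. This is where
separability enters.

Separability. Let `Y` be the right dual of `X`. By regularity and `End 𝟙 = k`, the composition
pairing of `Hom(𝟙, Y ⊗ X)` with `Hom(Y ⊗ X, 𝟙) ≅ End X` is perfect, so `End X ⊗ End Z` is the space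
of linear maps from `Hom(𝟙, Y ⊗ X)` to `End Z`. Without a braiding or pivotal structure there is no
preferred `v : 𝟙 ⟶ Y ⊗ X` with which to close a loop, but all `v` may be used at once: partial trace
along a variable `v` is a bimodule retraction of `End (X ⊗ Z)` onto `End X ⊗ End Z`. Since `End (X ⊗
Z)` is von Neumann regular, so is `End X ⊗ End Z` (`regular_end_tensor_end`). For `Z = Y` the second
factor is the opposite algebra of `End X`, and regularity of the enveloping algebra provides a
separability idempotent (`isSeparableAlgebra_of_regular`).

Extension of scalars. Averaging a linear projection with a separability idempotent shows that every
right ideal of `K ⊗ End X` has a left identity (`IsSeparableAlgebra.exists_left_identity`). Hence `K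
⊗ T` is regular, and its envelope is abelian and semisimple; duals and the endomorphisms of the unit
extend directly.

Comparison with `T_K`. Full faithfulness is the Yoneda lemma. As `T` is regular, every additive
presheaf on it is left exact; so a compact `M` is the filtered union, inside `(Ind T)_K`, of its
subobjects generated by finitely many sections. Compactness makes `M` equal to one of these, hence a
quotient of some `K ⊗ X` (`exists_surjective_from_free`). The relations are governed by a right
ideal of `End (K ⊗ X)`, whose left identity `e` is idempotent, and `M` is the image of `1 - e`
(`exists_iso_restrictedYoneda`). Finally the monoidal structure transported along this equivalence
is the relative tensor product, because a bilinear transformation out of two objects of the envelope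
is determined by its value on one generic pair of sections. -/

/-- A category in which every morphism `f` has a quasi-inverse `g`, in the sense that
`f ≫ g ≫ f = f`. -/
def IsRegularCategory (C : Type u') [Category.{v'} C] : Prop :=
  ∀ ⦃X Y : C⦄ (f : X ⟶ Y), ∃ g : Y ⟶ X, f ≫ g ≫ f = f

/-! ### Quasi-inverses, semisimplicity and abelian categories -/

section regular

variable {C : Type u'} [Category.{v'} C]

lemma IsRegularCategory.exists_retraction (h : IsRegularCategory C) {X Y : C} (f : X ⟶ Y)
    [Mono f] : ∃ g : Y ⟶ X, f ≫ g = 𝟙 X := by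
  obtain ⟨g, hg⟩ := h f
  exact ⟨g, by rw [← cancel_mono f, Category.assoc, hg, Category.id_comp]⟩

lemma IsRegularCategory.exists_section (h : IsRegularCategory C) {X Y : C} (f : X ⟶ Y)
    [Epi f] : ∃ g : Y ⟶ X, g ≫ f = 𝟙 Y := by
  obtain ⟨g, hg⟩ := h f
  exact ⟨g, by rw [← cancel_epi f, hg, Category.comp_id]⟩

lemma IsRegularCategory.of_equivalence {D : Type*} [Category D] (h : IsRegularCategory C)
    (F : C ⥤ D) [F.IsEquivalence] : IsRegularCategory D := by
  intro X Y f
  obtain ⟨g, hg⟩ := h (F.inv.map f)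
  obtain ⟨g, rfl⟩ := F.inv.map_surjective g
  exact ⟨g, F.inv.map_injective (by simpa using hg)⟩

variable [Preadditive C]

/-- In a preadditive category a morphism out of a finite direct sum of simple objects has a
quasi-inverse, provided that nonzero morphisms from the summands to its target split. -/
lemma exists_quasi_inverse_of_sum {X Y : C} {J : Type*} [DecidableEq J] (S : J → C)
    (i : ∀ j, S j ⟶ X) (p : ∀ j, X ⟶ S j) (hid : ∀ j, i j ≫ p j = 𝟙 _)
    (hne : ∀ j j', j ≠ j' → i j ≫ p j' = 0)
    (hS : ∀ j (f : S j ⟶ Y), f ≠ 0 → ∃ r : Y ⟶ S j, f ≫ r = 𝟙 _)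
    (s : Finset J) (f : X ⟶ Y) :
    ∃ g : Y ⟶ X, ((∑ j ∈ s, p j ≫ i j) ≫ f) ≫ g ≫ ((∑ j ∈ s, p j ≫ i j) ≫ f) =
      (∑ j ∈ s, p j ≫ i j) ≫ f := by
  induction s using Finset.induction_on generalizing f with
  | empty => exact ⟨0, by simp⟩
  | insert a s ha ih =>
    rw [Finset.sum_insert ha]
    set e := ∑ j ∈ s, p j ≫ i j with he
    have hae : i a ≫ e = 0 := by
      rw [he, Preadditive.comp_sum]
      refine Finset.sum_eq_zero fun j hj => ?_
      rw [← Category.assoc, hne a j (by rintro rfl; exact ha hj), zero_comp]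
    -- Gaussian elimination with pivot `u = i a ≫ f`: if it vanishes the summand `S a` contributes
    -- nothing, otherwise it is a split monomorphism.
    by_cases h0 : i a ≫ f = 0
    · have : (p a ≫ i a + e) ≫ f = e ≫ f := by
        rw [Preadditive.add_comp, Category.assoc, h0, comp_zero, zero_add]
      rw [this]
      exact ih f
    obtain ⟨r, hr⟩ := hS a _ h0
    set u := i a ≫ f with hu
    -- The endomorphism `𝟙 Y - r ≫ u` is the projection of `Y` that kills the pivot, so induction
    -- treats what is left of `f` on the remaining summands.
    obtain ⟨g, hg⟩ := ih (f ≫ (𝟙 Y - r ≫ u))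
    set h := e ≫ f ≫ (𝟙 Y - r ≫ u) with hh
    replace hg : h ≫ g ≫ h = h := hg
    set q : X ⟶ S a := p a + e ≫ f ≫ r with hq
    set F := (p a ≫ i a + e) ≫ f with hF
    have hr' : (𝟙 Y - r ≫ u) ≫ r = 0 := by
      rw [Preadditive.sub_comp, Category.assoc, hr]; simp
    have hu' : u ≫ (𝟙 Y - r ≫ u) = 0 := by
      rw [Preadditive.comp_sub, reassoc_of% hr]; simp
    have F_eq : F = q ≫ u + h := by
      simp only [hF, hq, hh, Preadditive.add_comp, Preadditive.comp_sub, Category.assoc, ← hu,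
        Category.comp_id]
      abel
    have hhr : h ≫ r = 0 := by rw [hh, Category.assoc, Category.assoc, hr', comp_zero, comp_zero]
    have hFr : F ≫ r = q := by rw [F_eq, Preadditive.add_comp, hhr, Category.assoc, hr]; simp
    have hF1 : F ≫ (𝟙 Y - r ≫ u) = h := by
      rw [Preadditive.comp_sub, reassoc_of% hFr, F_eq]; simp
    have hiF : i a ≫ F = u := by
      rw [hF, Preadditive.add_comp, Preadditive.comp_add, ← Category.assoc (i a) e, hae, zero_comp,
        add_zero, Category.assoc, ← Category.assoc (i a), hid, Category.id_comp]
    -- Block form of the quasi-inverse: `F = q ≫ u + h`, where `r` isolates `q` and `𝟙 Y - r ≫ u`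
    -- isolates `h` after `F`, while `i a` isolates `u` and `𝟙 X - q ≫ i a` isolates `h` before `F`.
    refine ⟨r ≫ i a + (𝟙 Y - r ≫ u) ≫ g ≫ (𝟙 X - q ≫ i a), ?_⟩
    have h1 : (𝟙 X - q ≫ i a) ≫ F = h := by
      rw [Preadditive.sub_comp, Category.assoc, hiF, F_eq]; simp
    have h2 : F ≫ (r ≫ i a + (𝟙 Y - r ≫ u) ≫ g ≫ (𝟙 X - q ≫ i a)) ≫ F =
        (F ≫ r) ≫ i a ≫ F + (F ≫ (𝟙 Y - r ≫ u)) ≫ g ≫ (𝟙 X - q ≫ i a) ≫ F := by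
      simp only [Preadditive.add_comp, Preadditive.comp_add, Category.assoc]
    rw [h2, hFr, hF1, h1, hiF, hg, F_eq]

/-- Every morphism of a semisimple category has a quasi-inverse. -/
theorem isRegularCategory_of_isSemisimpleCategory [HasKernels C]
    (hss : IsSemisimpleCategory C) : IsRegularCategory C := by
  classical
  -- Schur's lemma: some component of `f` into a simple summand of `Y` is nonzero, hence invertible.
  have split : ∀ {S Y : C} [Simple S] (f : S ⟶ Y), f ≠ 0 → ∃ r : Y ⟶ S, f ≫ r = 𝟙 _ := by
    intro S Y _ f hf
    obtain ⟨n, Z, b, hZ, ⟨hb⟩, ⟨e⟩⟩ := hss Y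
    have : ∃ j, f ≫ e.hom ≫ b.π j ≠ 0 := by
      by_contra! h
      apply hf
      rw [← cancel_mono e.hom, zero_comp]
      refine hb.isLimit.hom_ext fun ⟨j⟩ => ?_
      simpa using h j
    obtain ⟨j, hj⟩ := this
    have := hZ j
    have := isIso_of_hom_simple hj
    exact ⟨(e.hom ≫ b.π j) ≫ inv (f ≫ e.hom ≫ b.π j), by
      rw [← Category.assoc, IsIso.hom_inv_id]⟩
  intro X Y f
  obtain ⟨n, Z, b, hZ, ⟨hb⟩, ⟨e⟩⟩ := hss X
  obtain ⟨g, hg⟩ := exists_quasi_inverse_of_sum Z b.ι b.π (fun j => bicone_ι_π_self b j)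
    (fun j j' h => bicone_ι_π_ne b h) (fun j f hf => by have := hZ j; exact split f hf) Finset.univ
    (e.inv ≫ f)
  rw [IsBilimit.total hb, Category.id_comp] at hg
  exact ⟨g ≫ e.inv, by simpa using congrArg (e.hom ≫ ·) hg⟩

/-- If `g` is a quasi-inverse of `f`, then `f ≫ g` is idempotent and has the same kernel as `f`;
kernels of idempotents exist by idempotent completeness. -/
lemma IsRegularCategory.hasKernels (h : IsRegularCategory C) [IsIdempotentComplete C] :
    HasKernels C where
  has_limit {X Y} f := by
    obtain ⟨g, hg⟩ := h f
    have := (Idempotents.isIdempotentComplete_iff_idempotents_have_kernels C).1 inferInstance X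
      (f ≫ g) (by rw [Category.assoc, reassoc_of% hg])
    refine ⟨⟨⟨KernelFork.ofι (kernel.ι (f ≫ g)) (f := f) ?_, ?_⟩⟩⟩
    · have := kernel.condition (f ≫ g) =≫ f
      rwa [Category.assoc, Category.assoc, hg, zero_comp] at this
    · exact KernelFork.IsLimit.ofι _ _
        (fun s hs => kernel.lift (f ≫ g) s (by rw [reassoc_of% hs, zero_comp]))
        (fun s hs => kernel.lift_ι _ _ _)
        (fun s hs m hm => by rw [← cancel_mono (kernel.ι (f ≫ g)), hm, kernel.lift_ι])

lemma IsRegularCategory.op (h : IsRegularCategory C) : IsRegularCategory Cᵒᵖ := fun X Y f => by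
  obtain ⟨g, hg⟩ := h f.unop
  exact ⟨g.op, Quiver.Hom.unop_inj (by simpa using hg)⟩

lemma IsRegularCategory.hasCokernels (h : IsRegularCategory C) [IsIdempotentComplete C] :
    HasCokernels C where
  has_colimit {X Y} f := by
    have := h.op.hasKernels
    have : HasKernel f.op := inferInstance
    refine ⟨⟨⟨CokernelCofork.ofπ (kernel.ι f.op).unop (f := f) ?_, ?_⟩⟩⟩
    · exact Quiver.Hom.op_inj (kernel.condition f.op)
    · exact CokernelCofork.IsColimit.ofπ _ _
        (fun s hs => (kernel.lift f.op s.op (by rw [← op_comp, hs, op_zero])).unop)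
        (fun s hs => Quiver.Hom.op_inj (kernel.lift_ι f.op s.op _))
        (fun s hs m hm => Quiver.Hom.op_inj (by
          rw [← cancel_mono (kernel.ι f.op)]
          simpa using congrArg Quiver.Hom.op hm))

/-- An additive, idempotent complete category in which every morphism has a quasi-inverse is
abelian. -/
theorem IsRegularCategory.isAbelianCategory (h : IsRegularCategory C) [IsIdempotentComplete C]
    [HasFiniteProducts C] : IsAbelianCategory C where
  hasFiniteProducts := inferInstance
  hasKernels := h.hasKernels
  hasCokernels := h.hasCokernels
  normalMono := ⟨fun {X Y} f _ => by
    obtain ⟨g, hg⟩ := h.exists_retraction f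
    -- A split monomorphism is the kernel of the projection complementary to its image.
    exact ⟨⟨Y, 𝟙 Y - g ≫ f, by rw [Preadditive.comp_sub, reassoc_of% hg]; simp,
      KernelFork.IsLimit.ofι _ _ (fun s _ => s ≫ g)
        (fun s hs => by
          rw [Preadditive.comp_sub, sub_eq_zero] at hs
          simpa using hs.symm)
        (fun s hs m hm => by rw [← hm, Category.assoc, hg, Category.comp_id])⟩⟩⟩
  normalEpi := ⟨fun {X Y} f _ => by
    obtain ⟨g, hg⟩ := h.exists_section f
    exact ⟨⟨X, 𝟙 X - f ≫ g, by rw [Preadditive.sub_comp, Category.assoc, hg]; simp,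
      CokernelCofork.IsColimit.ofπ _ _ (fun s _ => g ≫ s)
        (fun s hs => by
          rw [Preadditive.sub_comp, sub_eq_zero] at hs
          simpa using hs.symm)
        (fun s hs m hm => by rw [← hm, reassoc_of% hg])⟩⟩⟩

end regular

end ScalarExtension

namespace ScalarExtension

/-! ### Von Neumann regular rings and separable algebras -/

section ring

/-- In a von Neumann regular ring, every finite set `s` has a right identity in the left ideal that
it generates. -/
lemma exists_right_identity_of_regular {R : Type*} [Ring R] (hR : ∀ r : R, ∃ y, r * y * r = r)
    (s : Finset R) : ∃ e ∈ Ideal.span (s : Set R), ∀ b ∈ s, b * e = b := by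
  classical
  induction s using Finset.induction_on with
  | empty => exact ⟨0, zero_mem _, by simp⟩
  | insert b s hb ih =>
    obtain ⟨e, he, hes⟩ := ih
    -- The correction added to `e` begins with `1 - e`, so it is killed by every element that `e`
    -- already fixes; `d` is chosen so that it restores the missing part `b - b * e` of `b`.
    obtain ⟨d, hd⟩ := hR (b - b * e)
    have he' : e ∈ Ideal.span ((insert b s : Finset R) : Set R) :=
      Ideal.span_mono (by simp) he
    have hb' : b ∈ Ideal.span ((insert b s : Finset R) : Set R) := Ideal.subset_span (by simp)
    refine ⟨e + (1 - e) * d * (b - b * e), add_mem he' (Ideal.mul_mem_left _ _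
      (sub_mem hb' (Ideal.mul_mem_left _ _ he'))), fun c hc => ?_⟩
    rcases Finset.mem_insert.1 hc with rfl | hc
    · have : c * (e + (1 - e) * d * (c - c * e)) = c * e + (c - c * e) * d * (c - c * e) := by
        noncomm_ring
      rw [this, hd]; abel
    · have : c * (e + (1 - e) * d * (b - b * e)) = c * e + (c - c * e) * d * (b - b * e) := by
        noncomm_ring
      rw [this, hes c hc]; simp

/-- A ring which is a direct summand, as a bimodule, of a von Neumann regular ring is itself
von Neumann regular. -/
lemma regular_of_bimodule_retraction {R B : Type*} [Ring R] [Ring B]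
    (hB : ∀ r : B, ∃ y, r * y * r = r) (θ : R → B) (π : B → R)
    (hπ : ∀ r y r', π (θ r * y * θ r') = r * π y * r') (hθ : ∀ r, π (θ r) = r) (r : R) :
    ∃ y, r * y * r = r := by
  obtain ⟨y, hy⟩ := hB (θ r)
  exact ⟨π y, by rw [← hπ, hy, hθ]⟩

/-- A finite dimensional algebra `D` with an anti-isomorphism `μ : D → D'` is separable as soon as
the ring `D ⊗ D'` is von Neumann regular. -/
lemma isSeparableAlgebra_of_regular {k D D' : Type*} [Field k] [Ring D] [Algebra k D]
    [Module.Finite k D] [Ring D'] [Algebra k D'] (μ : D ≃ₗ[k] D')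
    (hμ : ∀ a b, μ (a * b) = μ b * μ a)
    (hR : ∀ r : D ⊗[k] D', ∃ y, r * y * r = r) : IsSeparableAlgebra k D := by
  classical
  have hμ1 : μ 1 = 1 := by
    obtain ⟨x, hx⟩ := μ.surjective 1
    have := hμ 1 x
    rwa [one_mul, hx, one_mul, eq_comm] at this
  let N : D ⊗[k] D' ≃ₗ[k] D ⊗[k] D := TensorProduct.congr (LinearEquiv.refl k D) μ.symm
  let M : D ⊗[k] D' →ₗ[k] D := LinearMap.mul' k D ∘ₗ N.toLinearMap
  -- The elements `δ a` lie in the kernel of the multiplication `M`, and so does the left ideal that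
  -- they generate. If `e` in this ideal is a right identity for them, then `M (1 - e) = 1` and `δ a
  -- * (1 - e) = 0`, which are the two conditions on a separability idempotent.
  let δ : D →ₗ[k] D ⊗[k] D' := (TensorProduct.mk k D D').flip 1 -
    (TensorProduct.mk k D D' 1) ∘ₗ μ.toLinearMap
  have hδ : ∀ a, δ a = a ⊗ₜ 1 - 1 ⊗ₜ μ a := fun a => rfl
  have hM1 : M 1 = 1 := by
    change LinearMap.mul' k D (N (1 ⊗ₜ 1)) = 1
    simp [N, ← hμ1]
  have hMδ : ∀ x a, M (x * δ a) = 0 := by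
    intro x a
    induction x using TensorProduct.induction_on with
    | zero => simp
    | add x y hx hy => rw [add_mul, map_add, hx, hy, add_zero]
    | tmul c d =>
      obtain ⟨d, rfl⟩ := μ.surjective d
      rw [hδ, mul_sub, Algebra.TensorProduct.tmul_mul_tmul, Algebra.TensorProduct.tmul_mul_tmul,
        ← hμ, mul_one, mul_one]
      simp [M, N, mul_assoc]
  -- Finite dimensionality reduces the requirement on `e` to finitely many `δ (b i)`.
  obtain ⟨n, b, hb⟩ := Module.Finite.exists_fin (R := k) (M := D)
  obtain ⟨e, he, hbe⟩ := exists_right_identity_of_regular hR (Finset.univ.image fun i => δ (b i))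
  have hMe : M e = 0 := by
    have : ∀ x : D ⊗[k] D', M (x * e) = 0 := by
      refine Submodule.span_induction (p := fun y _ => ∀ x : D ⊗[k] D', M (x * y) = 0)
        ?_ ?_ ?_ ?_ he
      · intro y hy x
        obtain ⟨i, -, rfl⟩ := Finset.mem_image.1 hy
        exact hMδ x _
      · simp
      · intro y z _ _ hy hz x
        rw [mul_add, map_add, hy, hz, add_zero]
      · intro r y _ hy x
        rw [smul_eq_mul, ← mul_assoc, hy]
    simpa using this 1
  have hδe : ∀ a, δ a * (1 - e) = 0 := by
    intro a
    have ha : a ∈ Submodule.span k (Set.range b) := hb ▸ Submodule.mem_top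
    induction ha using Submodule.span_induction with
    | mem x hx =>
      obtain ⟨i, rfl⟩ := hx
      rw [mul_sub, hbe _ (Finset.mem_image_of_mem _ (Finset.mem_univ i)), mul_one, sub_self]
    | zero => simp
    | add x y _ _ hx hy => rw [map_add, add_mul, hx, hy, add_zero]
    | smul r x _ hx => rw [map_smul, smul_mul_assoc, hx, smul_zero]
  have h₁ : ∀ a x, LinearMap.rTensor D (LinearMap.mulLeft k a) (N x) = N (a ⊗ₜ 1 * x) := by
    intro a x
    induction x using TensorProduct.induction_on with
    | zero => simp
    | add x y hx hy => rw [mul_add, map_add, map_add, map_add, hx, hy]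
    | tmul c d => simp [N]
  have h₂ : ∀ a x, LinearMap.lTensor D (LinearMap.mulRight k a) (N x) = N (1 ⊗ₜ μ a * x) := by
    intro a x
    induction x using TensorProduct.induction_on with
    | zero => simp
    | add x y hx hy => rw [mul_add, map_add, map_add, map_add, hx, hy]
    | tmul c d =>
      obtain ⟨d, rfl⟩ := μ.surjective d
      rw [Algebra.TensorProduct.tmul_mul_tmul, ← hμ]
      simp [N]
  refine ⟨N (1 - e), ?_, fun a => ?_⟩
  · change M (1 - e) = 1
    rw [map_sub, hM1, hMe, sub_zero]
  · rw [h₁, h₂, ← sub_eq_zero, ← map_sub, ← sub_mul, ← hδ, hδe, map_zero]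

/-- Let `A` be a separable `k`-algebra, `B` an algebra over an extension `K` of `k`, generated as a
vector space by the image of `A`. Then every right ideal of `B` has a left identity. -/
lemma IsSeparableAlgebra.exists_left_identity {k K A B : Type*} [Field k] [Field K] [Algebra k K]
    [Ring A] [Algebra k A] [Ring B] [Algebra K B] [Algebra k B] [IsScalarTower k K B]
    (hA : IsSeparableAlgebra k A) (j : A →ₐ[k] B)
    (hj : Submodule.span K (Set.range j) = ⊤) (I : Submodule K B)
    (hI : ∀ m ∈ I, ∀ b, m * b ∈ I) : ∃ e ∈ I, ∀ a ∈ I, e * a = a := by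
  obtain ⟨s, hs1, hs⟩ := hA
  -- A `K`-linear projection onto `I`, in general not linear for the right action of `B`. The map `m
  -- ↦ ρ m s` below is its average over the separability idempotent `s`.
  obtain ⟨r, hr⟩ := I.subtype.exists_leftInverse_of_injective (by simp)
  replace hr : ∀ m (hm : m ∈ I), r m = ⟨m, hm⟩ := fun m hm => LinearMap.congr_fun hr ⟨m, hm⟩
  let ρ (m : B) : A ⊗[k] A →ₗ[k] B := TensorProduct.lift
    (((LinearMap.mul k B).compl₁₂ ((I.subtype ∘ₗ r).restrictScalars k ∘ₗ LinearMap.mulLeft k m ∘ₗ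
      j.toLinearMap) j.toLinearMap))
  have hρ : ∀ m a b, ρ m (a ⊗ₜ b) = (r (m * j a) : B) * j b := fun m a b => rfl
  have hρI : ∀ m t, ρ m t ∈ I := by
    intro m t
    induction t using TensorProduct.induction_on with
    | zero => simp
    | add x y hx hy => rw [map_add]; exact add_mem hx hy
    | tmul a b => exact hI _ (r _).2 _
  have hρm : ∀ m ∈ I, ρ m s = m := by
    intro m hm
    have : ∀ t, ρ m t = m * j (LinearMap.mul' k A t) := by
      intro t
      induction t using TensorProduct.induction_on with
      | zero => simp
      | add x y hx hy => rw [map_add, map_add, map_add, mul_add, hx, hy]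
      | tmul a b => rw [hρ, hr _ (hI m hm _)]; simp [mul_assoc]
    rw [this, hs1, map_one, mul_one]
  -- The relation satisfied by `s` moves `a` from the inside of the projection to the outside: the
  -- averaged projection is linear for the right action of `A`.
  have hρj : ∀ m a, ρ (m * j a) s = ρ m s * j a := by
    intro m a
    have h₁ : ∀ t, ρ (m * j a) t = ρ m (LinearMap.rTensor A (LinearMap.mulLeft k a) t) := by
      intro t
      induction t using TensorProduct.induction_on with
      | zero => simp
      | add x y hx hy => rw [map_add, map_add, map_add, hx, hy]
      | tmul c b => rw [LinearMap.rTensor_tmul, hρ, hρ]; simp [mul_assoc]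
    have h₂ : ∀ t, ρ m (LinearMap.lTensor A (LinearMap.mulRight k a) t) = ρ m t * j a := by
      intro t
      induction t using TensorProduct.induction_on with
      | zero => simp
      | add x y hx hy => rw [map_add, map_add, map_add, add_mul, hx, hy]
      | tmul c b => rw [LinearMap.lTensor_tmul, hρ, hρ]; simp [mul_assoc]
    rw [h₁, hs, h₂]
  have hadd : ∀ m m' t, ρ (m + m') t = ρ m t + ρ m' t := by
    intro m m' t
    induction t using TensorProduct.induction_on with
    | zero => simp
    | add x y hx hy => rw [map_add, map_add, map_add, hx, hy]; abel
    | tmul c b => simp only [hρ, add_mul, map_add, Submodule.coe_add]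
  have hsmul : ∀ (c : K) m t, ρ (c • m) t = c • ρ m t := by
    intro c m t
    induction t using TensorProduct.induction_on with
    | zero => simp
    | add x y hx hy => rw [map_add, map_add, hx, hy, smul_add]
    | tmul a b => simp only [hρ, smul_mul_assoc, map_smul, Submodule.coe_smul]
  -- Linearity over `K` and over the image of `A` gives linearity over `B`. A right linear
  -- endomorphism of `B` is left multiplication by its value at `1`, which is the required left
  -- identity.
  have key : ∀ b, ρ b s = ρ 1 s * b := by
    intro b
    have hb : b ∈ Submodule.span K (Set.range j) := hj ▸ Submodule.mem_top
    induction hb using Submodule.span_induction with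
    | mem x hx =>
      obtain ⟨a, rfl⟩ := hx
      simpa using hρj 1 a
    | zero => simpa using hsmul 0 0 s
    | add x y _ _ hx hy => rw [hadd, hx, hy, mul_add]
    | smul c x _ hx => rw [hsmul, hx, mul_smul_comm]
  exact ⟨ρ 1 s, hρI 1 s, fun a ha => by rw [← key, hρm a ha]⟩

end ring

end ScalarExtension

namespace ScalarExtension

/-! ### Duality, partial traces and separability of endomorphism algebras -/

section dual

variable {k : Type v} [Field k] {T : Type u} [Category.{v'} T] [Preadditive T] [Linear k T]
  [MonoidalCategory T] [MonoidalPreadditive T] [MonoidalLinear k T]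
  (X Y Z : T) [ExactPairing X Y]

variable (k) in
/-- The linear map `End X → Hom(Y ⊗ X, 𝟙)` given by inserting an endomorphism into the evaluation. -/
def evalRight : End X →ₗ[k] (Y ⊗ X ⟶ 𝟙_ T) where
  toFun a := Y ◁ (a : X ⟶ X) ≫ ε_ X Y
  map_add' a b := by
    rw [← Preadditive.add_comp, ← MonoidalPreadditive.whiskerLeft_add]
  map_smul' r a := by
    rw [RingHom.id_apply, ← Linear.smul_comp, ← MonoidalLinear.whiskerLeft_smul]

variable (k) in
/-- The linear map `End Y → Hom(Y ⊗ X, 𝟙)` given by inserting an endomorphism into the evaluation. -/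
def evalLeft : End Y →ₗ[k] (Y ⊗ X ⟶ 𝟙_ T) where
  toFun a := (a : Y ⟶ Y) ▷ X ≫ ε_ X Y
  map_add' a b := by
    rw [← Preadditive.add_comp, ← MonoidalPreadditive.add_whiskerRight]
  map_smul' r a := by
    rw [RingHom.id_apply, ← Linear.smul_comp, ← MonoidalLinear.smul_whiskerRight]

lemma evalLeft_apply (a : Y ⟶ Y) : evalLeft k X Y a = a ▷ X ≫ ε_ X Y := rfl

/-- This is the duality bijection between `Hom(Y ⊗ X, 𝟙)` and `Hom(X, X ⊗ 𝟙)`, with the right unitor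
absorbed. -/
lemma evalRight_bijective : Function.Bijective (evalRight k X Y) := by
  have : ⇑(evalRight k X Y) = (tensorLeftHomEquiv X X Y (𝟙_ T)).symm ∘ fun a => a ≫ (ρ_ X).inv := by
    funext a
    change Y ◁ (a : X ⟶ X) ≫ ε_ X Y = Y ◁ (a ≫ (ρ_ X).inv) ≫ _ ≫ _ ▷ _ ≫ _
    simp [unitors_equal]
  rw [this]
  exact (Equiv.bijective _).comp ((ρ_ X).symm.homToEquiv (X := X)).bijective

lemma evalLeft_bijective : Function.Bijective (evalLeft k X Y) := by
  have : ⇑(evalLeft k X Y) = (tensorRightHomEquiv Y X Y (𝟙_ T)).symm ∘ fun a => a ≫ (λ_ Y).inv := by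
    funext a
    change (a : Y ⟶ Y) ▷ X ≫ ε_ X Y = (a ≫ (λ_ Y).inv) ▷ X ≫ _ ≫ _ ◁ _ ≫ _
    simp [← unitors_equal]
  rw [this]
  exact (Equiv.bijective _).comp ((λ_ Y).symm.homToEquiv (X := Y)).bijective

variable (k) in
/-- The linear isomorphism `End X ≃ End Y` for a dual `Y` of `X`. -/
def mateEquiv : End X ≃ₗ[k] End Y :=
  (LinearEquiv.ofBijective _ (evalRight_bijective (k := k) X Y)).trans
    (LinearEquiv.ofBijective _ (evalLeft_bijective (k := k) X Y)).symm

lemma mateEquiv_spec (a : X ⟶ X) :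
    (mateEquiv k X Y a : Y ⟶ Y) ▷ X ≫ ε_ X Y = Y ◁ a ≫ ε_ X Y :=
  (LinearEquiv.ofBijective _ (evalLeft_bijective (k := k) X Y)).apply_symm_apply
    (evalRight k X Y a)

/-- Sliding two endomorphisms one after the other through the evaluation reverses their order. Thus
`End Y` serves as the opposite algebra of `End X`. -/
lemma mateEquiv_mul (a b : End X) :
    mateEquiv k X Y (a * b) = mateEquiv k X Y b * mateEquiv k X Y a := by
  apply (evalLeft_bijective (k := k) X Y).1
  rw [End.mul_def, End.mul_def, evalLeft_apply, evalLeft_apply, mateEquiv_spec,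
    comp_whiskerRight, Category.assoc, mateEquiv_spec, ← whisker_exchange_assoc, mateEquiv_spec,
    MonoidalCategory.whiskerLeft_comp, Category.assoc]

variable {X Y}

/-- The partial trace of an endomorphism of `X ⊗ Z` along `v : 𝟙 ⟶ Y ⊗ X`. -/
def partialTrace (v : 𝟙_ T ⟶ Y ⊗ X) (y : X ⊗ Z ⟶ X ⊗ Z) : Z ⟶ Z :=
  (λ_ Z).inv ≫ v ▷ Z ≫ (α_ Y X Z).hom ≫ Y ◁ y ≫ (α_ Y X Z).inv ≫ ε_ X Y ▷ Z ≫ (λ_ Z).hom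

/-- The endomorphism applied first is absorbed into `v`; the one applied last meets the evaluation
and passes to the other strand as its mate. The twist of `v` that results is the bimodule action to
be matched on `End X ⊗ End Z`. -/
lemma partialTrace_left (v : 𝟙_ T ⟶ Y ⊗ X) (y : X ⊗ Z ⟶ X ⊗ Z) (a a' : X ⟶ X) :
    partialTrace Z v (a' ▷ Z ≫ y ≫ a ▷ Z) =
      partialTrace Z (v ≫ Y ◁ a' ≫ (mateEquiv k X Y a : Y ⟶ Y) ▷ X) y := by
  have h : Y ◁ a ▷ Z ≫ (α_ Y X Z).inv ≫ ε_ X Y ▷ Z =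
      (mateEquiv k X Y a : Y ⟶ Y) ▷ (X ⊗ Z) ≫ (α_ Y X Z).inv ≫ ε_ X Y ▷ Z := by
    have := congrArg (fun q => (α_ Y X Z).inv ≫ q ▷ Z) (mateEquiv_spec (k := k) X Y a)
    simpa using this.symm
  simp only [partialTrace, MonoidalCategory.whiskerLeft_comp, Category.assoc, comp_whiskerRight,
    reassoc_of% h]
  rw [whisker_exchange_assoc]
  simp

lemma partialTrace_right (v : 𝟙_ T ⟶ Y ⊗ X) (y : X ⊗ Z ⟶ X ⊗ Z) (b b' : Z ⟶ Z) :
    partialTrace Z v (X ◁ b' ≫ y ≫ X ◁ b) = b' ≫ partialTrace Z v y ≫ b := by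
  simp only [partialTrace, MonoidalCategory.whiskerLeft_comp, Category.assoc]
  have h : Y ◁ X ◁ b ≫ (α_ Y X Z).inv ≫ ε_ X Y ▷ Z ≫ (λ_ Z).hom =
      (α_ Y X Z).inv ≫ ε_ X Y ▷ Z ≫ (λ_ Z).hom ≫ b := by
    rw [← leftUnitor_naturality, ← whisker_exchange_assoc]; simp
  rw [h, leftUnitor_inv_naturality_assoc, whisker_exchange_assoc]
  simp

/-- On a pure tensor the `X`-loop is disjoint from the strand `Z` and evaluates to the scalar `c`.
-/
lemma partialTrace_tensor (v : 𝟙_ T ⟶ Y ⊗ X) (a : X ⟶ X) (b : Z ⟶ Z) (c : k)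
    (h : v ≫ Y ◁ a ≫ ε_ X Y = c • 𝟙 (𝟙_ T)) : partialTrace Z v (X ◁ b ≫ a ▷ Z) = c • b := by
  have : X ◁ b ≫ a ▷ Z = X ◁ b ≫ a ▷ Z ≫ X ◁ 𝟙 Z := by simp
  rw [this, partialTrace_right]
  have h' := congrArg (fun q => (λ_ Z).inv ≫ q ▷ Z ≫ (λ_ Z).hom) h
  simp only [comp_whiskerRight, Category.assoc, MonoidalLinear.smul_whiskerRight,
    Linear.smul_comp, Linear.comp_smul, id_whiskerRight, Category.id_comp, Iso.inv_hom_id] at h'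
  have : partialTrace Z v (a ▷ Z) = c • 𝟙 Z := by
    rw [← h']; simp [partialTrace]
  rw [this]; simp

lemma partialTrace_add (v : 𝟙_ T ⟶ Y ⊗ X) (y y' : X ⊗ Z ⟶ X ⊗ Z) :
    partialTrace Z v (y + y') = partialTrace Z v y + partialTrace Z v y' := by
  simp [partialTrace]

lemma partialTrace_smul (v : 𝟙_ T ⟶ Y ⊗ X) (r : k) (y : X ⊗ Z ⟶ X ⊗ Z) :
    partialTrace Z v (r • y) = r • partialTrace Z v y := by
  simp [partialTrace]

variable (k Y) in
/-- The partial trace as a linear map. -/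
def partialTraceLinear : End (X ⊗ Z) →ₗ[k] (𝟙_ T ⟶ Y ⊗ X) →ₗ[k] End Z :=
  LinearMap.mk₂ k (fun y v => partialTrace Z v y)
    (fun y y' v => partialTrace_add Z v y y')
    (fun r y v => partialTrace_smul Z v r y)
    (by intros; simp [partialTrace])
    (by intros; simp [partialTrace])

/-- If every morphism has a quasi-inverse and `End 𝟙 = k`, then `End X ⊗ End Z` is von Neumann
regular for every object `X` with a right dual. -/
theorem regular_end_tensor_end {X : T} (Y Z : T) [ExactPairing X Y]
    [Module.Finite k (𝟙_ T ⟶ Y ⊗ X)] (hreg : IsRegularCategory T)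
    (hk : Function.Bijective (algebraMap k (End (𝟙_ T)))) (r : End X ⊗[k] End Z) :
    ∃ y, r * y * r = r := by
  let κ : k ≃ₗ[k] End (𝟙_ T) := LinearEquiv.ofBijective (Algebra.linearMap k (End (𝟙_ T))) hk
  have hκ : ∀ q : 𝟙_ T ⟶ 𝟙_ T, q = κ.symm q • 𝟙 (𝟙_ T) := fun q => by
    conv_lhs => rw [← κ.apply_symm_apply q]
    exact Algebra.algebraMap_eq_smul_one (A := End (𝟙_ T)) (κ.symm q)
  -- The pairing `(v, a) ↦ v ≫ Y ◁ a ≫ ε`, read as an element of `k` through `End 𝟙 = k`.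
  let p : (𝟙_ T ⟶ Y ⊗ X) →ₗ[k] End X →ₗ[k] k :=
    ((Linear.comp (S := k) (𝟙_ T) (Y ⊗ X) (𝟙_ T)).compl₁₂ LinearMap.id
      (evalRight k X Y)).compr₂ κ.symm.toLinearMap
  have hp : ∀ (v : 𝟙_ T ⟶ Y ⊗ X) (a : X ⟶ X), v ≫ Y ◁ a ≫ ε_ X Y = p v a • 𝟙 (𝟙_ T) :=
    fun v a => hκ _
  have hp' : ∀ (v : 𝟙_ T ⟶ Y ⊗ X) (a a' b : X ⟶ X),
      p (v ≫ Y ◁ a' ≫ (mateEquiv k X Y a : Y ⟶ Y) ▷ X) b = p v (a' ≫ b ≫ a) := by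
    intro v a a' b
    refine congrArg κ.symm ?_
    change (v ≫ Y ◁ a' ≫ _ ▷ X) ≫ Y ◁ b ≫ ε_ X Y = v ≫ Y ◁ (a' ≫ b ≫ a) ≫ ε_ X Y
    simp only [MonoidalCategory.whiskerLeft_comp, Category.assoc]
    rw [← whisker_exchange_assoc, mateEquiv_spec]
  -- A quasi-inverse `q` of `v` is a morphism to `𝟙`, hence comes from some `a`. If `v` pairs to
  -- zero with everything, then `v ≫ q = 0` and `v = v ≫ q ≫ v = 0`. The other side is symmetric.
  have h₁ : Function.Injective p := by
    rw [injective_iff_map_eq_zero]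
    intro v hv
    obtain ⟨q, hq⟩ := hreg v
    obtain ⟨a, rfl⟩ := (evalRight_bijective (k := k) X Y).2 q
    have h : v ≫ evalRight k X Y a = 0 := by
      rw [hκ (v ≫ evalRight k X Y a)]
      change p v a • _ = _
      rw [hv]; simp
    rw [← hq, reassoc_of% h, zero_comp]
  have h₂ : Function.Injective p.flip := by
    rw [injective_iff_map_eq_zero]
    intro a ha
    apply (evalRight_bijective (k := k) X Y).1
    obtain ⟨v, hv⟩ := hreg (evalRight k X Y a)
    have h : v ≫ evalRight k X Y a = 0 := by
      rw [hκ (v ≫ evalRight k X Y a)]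
      change p.flip a v • _ = _
      rw [ha]; simp
    rw [← hv, h, comp_zero, map_zero]
  have : p.IsPerfPair := .of_injective h₁ h₂
  -- Perfectness identifies `End X` with the dual of `Hom(𝟙, Y ⊗ X)`; with this model the partial
  -- traces along all `v` together define an element of `End X ⊗ End Z`.
  let Θ : End X ⊗[k] End Z ≃ₗ[k] ((𝟙_ T ⟶ Y ⊗ X) →ₗ[k] End Z) :=
    (TensorProduct.congr p.flip.toPerfPair (LinearEquiv.refl k (End Z))).trans
      (dualTensorHomEquiv k _ _)
  have hΘ : ∀ (a : End X) (b : End Z) v, Θ (a ⊗ₜ b) v = p v a • b := fun a b v => rfl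
  let θ : End X ⊗[k] End Z →ₗ[k] End (X ⊗ Z) := TensorProduct.lift
    (LinearMap.mk₂ k (fun a b => X ◁ (b : Z ⟶ Z) ≫ (a : X ⟶ X) ▷ Z)
      (fun a b c => by
        rw [← Preadditive.comp_add, ← MonoidalPreadditive.add_whiskerRight])
      (fun r a b => by
        rw [← Linear.comp_smul, ← MonoidalLinear.smul_whiskerRight])
      (fun a b c => by
        rw [← Preadditive.add_comp, ← MonoidalPreadditive.whiskerLeft_add])
      (fun r a b => by
        rw [← Linear.smul_comp, ← MonoidalLinear.whiskerLeft_smul]))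
  have hθ : ∀ (a : X ⟶ X) (b : Z ⟶ Z), θ (a ⊗ₜ b) = X ◁ b ≫ a ▷ Z := fun a b => rfl
  let f := partialTraceLinear k Y (X := X) Z
  have hf : ∀ y v, f y v = partialTrace Z v y := fun _ _ => rfl
  -- `Θ` and `f` transform under multiplication on both sides by the same twist of `v`. Therefore
  -- `Θ.symm ∘ f` is a bimodule map.
  have hΘmul : ∀ (a a' : End X) (b b' : End Z) (t : End X ⊗[k] End Z) v,
      Θ (a ⊗ₜ b * t * a' ⊗ₜ b') v =
        b * Θ t (v ≫ Y ◁ (a' : X ⟶ X) ≫ (mateEquiv k X Y a : Y ⟶ Y) ▷ X) * b' := by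
    intro a a' b b' t v
    induction t using TensorProduct.induction_on with
    | zero => simp
    | add x y hx hy =>
      rw [mul_add, add_mul, map_add, LinearMap.add_apply, hx, hy, map_add, LinearMap.add_apply,
        mul_add, add_mul]
    | tmul c d =>
      rw [Algebra.TensorProduct.tmul_mul_tmul, Algebra.TensorProduct.tmul_mul_tmul, hΘ, hΘ, hp',
        mul_smul_comm, smul_mul_assoc]
      rfl
  have hfmul : ∀ (a a' : End X) (b b' : End Z) (y : End (X ⊗ Z)) v,
      f (θ (a ⊗ₜ b) * y * θ (a' ⊗ₜ b')) v =
        b * f y (v ≫ Y ◁ (a' : X ⟶ X) ≫ (mateEquiv k X Y a : Y ⟶ Y) ▷ X) * b' := by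
    intro a a' b b' y v
    rw [hf, hf, ← partialTrace_left]
    refine Eq.trans ?_ (partialTrace_right Z v _ b b')
    refine congrArg (partialTrace Z v) ?_
    simp only [End.mul_def, hθ, Category.assoc]
    rw [whisker_exchange, whisker_exchange_assoc]
  refine regular_of_bimodule_retraction (B := End (X ⊗ Z)) 
    (fun y => by obtain ⟨g, hg⟩ := hreg (y : X ⊗ Z ⟶ X ⊗ Z); exact ⟨g, hg⟩) θ
    (fun y => Θ.symm (f y)) ?_ ?_ r
  · intro r y r'
    rw [LinearEquiv.symm_apply_eq]
    induction r using TensorProduct.induction_on with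
    | zero => simp
    | add x y hx hy => simp only [map_add, add_mul, hx, hy]
    | tmul a b =>
      induction r' using TensorProduct.induction_on with
      | zero => simp
      | add x y hx hy => simp only [map_add, mul_add, hx, hy]
      | tmul a' b' =>
        refine LinearMap.ext fun v => ?_
        rw [hΘmul, LinearEquiv.apply_symm_apply, hfmul]
  · intro r
    rw [LinearEquiv.symm_apply_eq]
    induction r using TensorProduct.induction_on with
    | zero => simp
    | add x y hx hy => simp only [map_add, hx, hy]
    | tmul a b =>
      refine LinearMap.ext fun v => ?_
      exact partialTrace_tensor Z v a b _ (hp v a)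

/-- Endomorphism algebras in a semisimple artinian tensor category are separable. -/
theorem isSeparableAlgebra_end (hreg : IsRegularCategory T)
    (hk : Function.Bijective (algebraMap k (End (𝟙_ T)))) (X : T) [HasRightDual X]
    (hfin : ∀ X Y : T, Module.Finite k (X ⟶ Y)) : IsSeparableAlgebra k (End X) := by
  have : Module.Finite k (End X) := hfin X X
  have := hfin (𝟙_ T) (Xᘁ ⊗ X)
  -- Here the dual `Xᘁ` plays both roles: it is the dual used for tracing and also the second factor
  -- `Z`, so that `End X ⊗ End Xᘁ` is the enveloping algebra.
  exact isSeparableAlgebra_of_regular (mateEquiv k X Xᘁ) (mateEquiv_mul X Xᘁ)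
    (regular_end_tensor_end Xᘁ Xᘁ hreg hk)

end dual

end ScalarExtension

namespace ScalarExtension

open Idempotents

/-! ### Decomposition into simple objects -/

section semisimple

variable {C : Type u'} [Category.{v'} C] [Preadditive C]

/-- `X` is a finite direct sum of simple objects, indexed by an arbitrary finite type. -/
def IsFiniteSumOfSimples (X : C) : Prop :=
  ∃ (J : Type) (_ : Fintype J) (S : J → C) (i : ∀ j, S j ⟶ X) (p : ∀ j, X ⟶ S j),
    (∀ j, Simple (S j)) ∧ (∀ j, i j ≫ p j = 𝟙 _) ∧ (∀ j j', j ≠ j' → i j ≫ p j' = 0) ∧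
      ∑ j, p j ≫ i j = 𝟙 X

lemma IsFiniteSumOfSimples.exists_bicone {X : C} (h : IsFiniteSumOfSimples X) :
    ∃ (n : ℕ) (S : Fin n → C) (b : Bicone S),
      (∀ i, Simple (S i)) ∧ Nonempty b.IsBilimit ∧ Nonempty (X ≅ b.pt) := by
  classical
  obtain ⟨J, _, S, i, p, hS, hid, hne, htot⟩ := h
  let e := (Fintype.equivFin J).symm
  refine ⟨Fintype.card J, fun n => S (e n),
    { pt := X, π := fun n => p (e n), ι := fun n => i (e n), ι_π := fun n m => ?_ },
    fun n => hS _, ⟨isBilimitOfTotal _ ?_⟩, ⟨Iso.refl X⟩⟩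
  · split_ifs with h
    · subst h
      exact hid _
    · exact hne _ _ fun h' => h (e.injective h')
  · exact (e.sum_comp fun j => p j ≫ i j).trans htot

lemma IsFiniteSumOfSimples.of_decomposition {X Z W : C} (hZ : IsFiniteSumOfSimples Z)
    (hW : IsFiniteSumOfSimples W) (i : Z ⟶ X) (r : X ⟶ Z) (i' : W ⟶ X) (r' : X ⟶ W)
    (h₁ : i ≫ r = 𝟙 Z) (h₂ : i' ≫ r' = 𝟙 W) (h : r ≫ i + r' ≫ i' = 𝟙 X) :
    IsFiniteSumOfSimples X := by
  obtain ⟨J, _, S, f, p, hS, hid, hne, htot⟩ := hZ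
  obtain ⟨J', _, S', f', p', hS', hid', hne', htot'⟩ := hW
  -- Composing `h` with `i` and `r'` counts `i ≫ r'` twice on one side and once on the other.
  have h₃ : i ≫ r' = 0 := by
    have := i ≫= h =≫ r'
    simp only [Preadditive.comp_add, reassoc_of% h₁, Category.comp_id, Preadditive.add_comp,
      Category.assoc, h₂] at this
    simpa using this
  have h₄ : i' ≫ r = 0 := by
    have := i' ≫= h =≫ r
    simp only [Preadditive.comp_add, reassoc_of% h₂, Category.comp_id, Preadditive.add_comp,
      Category.assoc, h₁] at this
    simpa using this
  refine ⟨J ⊕ J', inferInstance, Sum.elim S S',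
    fun j => match j with
      | .inl j => f j ≫ i
      | .inr j => f' j ≫ i',
    fun j => match j with
      | .inl j => r ≫ p j
      | .inr j => r' ≫ p' j, ?_, ?_, ?_, ?_⟩
  · rintro (j | j)
    · exact hS j
    · exact hS' j
  · rintro (j | j)
    · simp [reassoc_of% h₁, hid]
    · simp [reassoc_of% h₂, hid']
  · rintro (j | j) (j' | j') hj
    · change (f j ≫ i) ≫ r ≫ p j' = 0
      rw [Category.assoc, reassoc_of% h₁, hne j j' fun h => hj (h ▸ rfl)]
    · change (f j ≫ i) ≫ r' ≫ p' j' = 0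
      rw [Category.assoc, reassoc_of% h₃, zero_comp, comp_zero]
    · change (f' j ≫ i') ≫ r ≫ p j' = 0
      rw [Category.assoc, reassoc_of% h₄, zero_comp, comp_zero]
    · change (f' j ≫ i') ≫ r' ≫ p' j' = 0
      rw [Category.assoc, reassoc_of% h₂, hne' j j' fun h => hj (h ▸ rfl)]
  · rw [Fintype.sum_sum_type, ← h]
    congr 1
    · have := congrArg (fun q => r ≫ q ≫ i) htot
      simpa [Preadditive.comp_sum, Preadditive.sum_comp] using this
    · have := congrArg (fun q => r' ≫ q ≫ i') htot'
      simpa [Preadditive.comp_sum, Preadditive.sum_comp] using this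

variable (K : Type*) [Field K] [Linear K C]

/-- The map `a ↦ r ≫ a ≫ i` embeds `End Z` in `End X` and misses the identity when the retract is
proper. This supplies the measure for decomposing into simple objects. -/
lemma finrank_end_lt_of_retract {X Z : C} [Module.Finite K (X ⟶ X)] (i : Z ⟶ X) (r : X ⟶ Z)
    (h : i ≫ r = 𝟙 Z) (h' : r ≫ i ≠ 𝟙 X) :
    Module.finrank K (Z ⟶ Z) < Module.finrank K (X ⟶ X) := by
  let f : (Z ⟶ Z) →ₗ[K] (X ⟶ X) := Linear.leftComp K X r ∘ₗ Linear.rightComp K Z i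
  have hf : ∀ a, f a = r ≫ a ≫ i := fun a => rfl
  have hinj : Function.Injective f := fun a b hab => by
    have := congrArg (fun q => i ≫ q ≫ r) hab
    simpa [hf, h, reassoc_of% h] using this
  rw [← LinearMap.finrank_range_of_inj hinj]
  refine Submodule.finrank_lt fun htop => ?_
  obtain ⟨a, ha⟩ : 𝟙 X ∈ LinearMap.range f := htop ▸ Submodule.mem_top
  have h1 : a ≫ i = i := by
    have := i ≫= ha
    rwa [hf, reassoc_of% h, Category.comp_id] at this
  exact h' (by rw [← ha, hf, h1])

/-- An idempotent complete linear category in which every morphism has a quasi-inverse and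
morphism spaces are finite dimensional is semisimple. -/
theorem IsRegularCategory.isSemisimpleCategory (h : IsRegularCategory C) [IsIdempotentComplete C]
    (hfin : ∀ X Y : C, Module.Finite K (X ⟶ Y)) : IsSemisimpleCategory C := by
  -- Strong induction on the dimension of `End X`: a nonzero object that is not simple has a proper
  -- nonzero subobject, which splits off, and both pieces have smaller endomorphism algebras.
  suffices H : ∀ (n : ℕ) (X : C), Module.finrank K (X ⟶ X) = n → IsFiniteSumOfSimples X from
    fun X => (H _ X rfl).exists_bicone
  intro n
  induction n using Nat.strong_induction_on with
  | _ n ih =>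
    intro X hX
    have := hfin X X
    by_cases h0 : 𝟙 X = 0
    · exact ⟨Empty, inferInstance, Empty.elim, fun j => j.elim, fun j => j.elim, fun j => j.elim,
        fun j => j.elim, fun j => j.elim, by simp [h0]⟩
    by_cases hs : ∀ {Z : C} (f : Z ⟶ X) [Mono f], f ≠ 0 → IsIso f
    · exact ⟨Unit, inferInstance, fun _ => X, fun _ => 𝟙 X, fun _ => 𝟙 X,
        fun _ => ⟨fun f _ => ⟨fun hf h0' => h0 (by
          have := IsIso.inv_hom_id f
          rw [← this]
          exact (congrArg (inv f ≫ ·) h0').trans comp_zero), hs f⟩⟩, by simp, by simp, by simp⟩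
    push Not at hs
    obtain ⟨Z, f, hf, hf0, hfiso⟩ := hs
    obtain ⟨r, hr⟩ := h.exists_retraction f
    have hne : r ≫ f ≠ 𝟙 X := fun h => hfiso ⟨r, hr, h⟩
    obtain ⟨W, i', r', hi', hr'⟩ := IsIdempotentComplete.idempotents_split (C := C) X
      (𝟙 X - r ≫ f) (by simp [reassoc_of% hr])
    have hne' : r' ≫ i' ≠ 𝟙 X := fun h => hf0 (by
      rw [hr', sub_eq_self] at h
      have := f ≫= h
      rwa [reassoc_of% hr, comp_zero] at this)
    exact IsFiniteSumOfSimples.of_decomposition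
      (ih _ (hX ▸ finrank_end_lt_of_retract K f r hr hne) Z rfl)
      (ih _ (hX ▸ finrank_end_lt_of_retract K i' r' hi' hne') W rfl) f r i' r' hr hi'
      (by rw [hr']; abel)

end semisimple

/-! ### Regularity, smallness and duals in the idempotent completion -/

section karoubi

variable {C : Type u} [Category.{v} C]

lemma IsRegularCategory.karoubi (h : IsRegularCategory C) : IsRegularCategory (Karoubi C) := by
  intro P Q f
  obtain ⟨g, hg⟩ := h f.f
  refine ⟨⟨Q.p ≫ g ≫ P.p, by simp⟩, ?_⟩
  ext
  simp [hg]

/-- Each `(X, p)` is isomorphic to a pair whose object comes from the small model, and the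
idempotents of such an object form a small set. -/
lemma essentiallySmall_karoubi [EssentiallySmall.{v} C] : EssentiallySmall.{v} (Karoubi C) := by
  rw [essentiallySmall_iff]
  refine ⟨?_, inferInstance⟩
  let e := equivSmallModel.{v} C
  let F : (Σ X : SmallModel.{v} C, {p : e.inverse.obj X ⟶ e.inverse.obj X // p ≫ p = p}) →
      Skeleton (Karoubi C) := fun x => toSkeleton ⟨e.inverse.obj x.1, x.2.1, x.2.2⟩
  refine small_of_surjective (f := F) fun s => ?_
  obtain ⟨P, rfl⟩ := Quotient.exists_rep s
  let i : e.inverse.obj (e.functor.obj P.X) ≅ P.X := (e.unitIso.app P.X).symm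
  refine ⟨⟨e.functor.obj P.X, i.hom ≫ P.p ≫ i.inv, by simp⟩, ?_⟩
  refine Quotient.sound ⟨⟨⟨i.hom ≫ P.p, by simp⟩, ⟨P.p ≫ i.inv, by simp⟩, ?_, ?_⟩⟩
  · ext; simp
  · ext; simp

variable [Preadditive C] [MonoidalCategory C]

/-- An exact pairing descends to the images of idempotents that are adjoint to each other. -/
@[reducible]
def karoubiExactPairing (P Q : Karoubi C) [ExactPairing P.X Q.X]
    (hη : η_ P.X Q.X ≫ P.X ◁ Q.p = η_ P.X Q.X ≫ P.p ▷ Q.X)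
    (hε : Q.p ▷ P.X ≫ ε_ P.X Q.X = Q.X ◁ P.p ≫ ε_ P.X Q.X) : ExactPairing P Q := by
  -- Since the idempotents are adjoint, one of the two projections is redundant next to the
  -- coevaluation. The zigzag identities then reduce to those of `P.X` and `Q.X` with a single
  -- idempotent carried along.
  have h₁ : η_ P.X Q.X ≫ (P.p ⊗ₘ Q.p) = η_ P.X Q.X ≫ P.X ◁ Q.p := by
    rw [MonoidalCategory.tensorHom_def, ← reassoc_of% hη, ← MonoidalCategory.whiskerLeft_comp,
      Q.idem]
  have h₂ : (Q.p ⊗ₘ P.p) ≫ ε_ P.X Q.X = Q.X ◁ P.p ≫ ε_ P.X Q.X := by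
    rw [tensorHom_def', Category.assoc, hε, ← MonoidalCategory.whiskerLeft_comp_assoc, P.idem]
  exact
  { coevaluation' := ⟨η_ P.X Q.X ≫ (P.p ⊗ₘ Q.p), by
      change 𝟙 _ ≫ (_ ≫ _) ≫ (P.p ⊗ₘ Q.p) = _
      simp [MonoidalCategory.tensorHom_comp_tensorHom]⟩
    evaluation' := ⟨(Q.p ⊗ₘ P.p) ≫ ε_ P.X Q.X, by
      change (Q.p ⊗ₘ P.p) ≫ (_ ≫ _) ≫ 𝟙 _ = _
      simp [MonoidalCategory.tensorHom_comp_tensorHom_assoc]⟩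
    coevaluation_evaluation' := by
      ext
      change (Q.p ⊗ₘ (η_ P.X Q.X ≫ (P.p ⊗ₘ Q.p))) ≫ ((Q.p ⊗ₘ (P.p ⊗ₘ Q.p)) ≫ (α_ _ _ _).inv) ≫
        (((Q.p ⊗ₘ P.p) ≫ ε_ P.X Q.X) ⊗ₘ Q.p) = ((Q.p ⊗ₘ 𝟙 _) ≫ (ρ_ _).hom) ≫ Q.p ≫ (λ_ _).inv
      have h₃ : (((Q.p ⊗ₘ P.p) ≫ ε_ P.X Q.X) ⊗ₘ Q.p) =
          ((Q.p ⊗ₘ P.p) ⊗ₘ Q.p) ≫ ε_ P.X Q.X ▷ Q.X := by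
        rw [← tensorHom_id, MonoidalCategory.tensorHom_comp_tensorHom, Category.comp_id]
      rw [h₃, Category.assoc, ← associator_inv_naturality_assoc,
        MonoidalCategory.tensorHom_comp_tensorHom_assoc,
        MonoidalCategory.tensorHom_comp_tensorHom_assoc]
      simp only [Category.assoc, Karoubi.idem, MonoidalCategory.tensorHom_comp_tensorHom]
      rw [h₁, MonoidalCategory.tensorHom_def, MonoidalCategory.whiskerLeft_comp]
      have h₄ : Q.X ◁ P.X ◁ Q.p ≫ (α_ Q.X P.X Q.X).inv ≫ ε_ P.X Q.X ▷ Q.X =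
          (α_ Q.X P.X Q.X).inv ≫ ε_ P.X Q.X ▷ Q.X ≫ 𝟙_ C ◁ Q.p := by
        rw [← whisker_exchange]; simp
      simp only [Category.assoc]
      rw [h₄, ExactPairing.coevaluation_evaluation_assoc, tensorHom_id, leftUnitor_inv_naturality]
    evaluation_coevaluation' := by
      ext
      change ((η_ P.X Q.X ≫ (P.p ⊗ₘ Q.p)) ⊗ₘ P.p) ≫ (((P.p ⊗ₘ Q.p) ⊗ₘ P.p) ≫ (α_ _ _ _).hom) ≫
        (P.p ⊗ₘ ((Q.p ⊗ₘ P.p) ≫ ε_ P.X Q.X)) = ((𝟙 _ ⊗ₘ P.p) ≫ (λ_ _).hom) ≫ P.p ≫ (ρ_ _).inv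
      have h₃ : (P.p ⊗ₘ ((Q.p ⊗ₘ P.p) ≫ ε_ P.X Q.X)) =
          (P.p ⊗ₘ (Q.p ⊗ₘ P.p)) ≫ P.X ◁ ε_ P.X Q.X := by
        rw [← id_tensorHom, MonoidalCategory.tensorHom_comp_tensorHom, Category.comp_id]
      rw [h₃, Category.assoc, ← associator_naturality_assoc,
        MonoidalCategory.tensorHom_comp_tensorHom_assoc,
        MonoidalCategory.tensorHom_comp_tensorHom_assoc]
      simp only [Category.assoc, Karoubi.idem, MonoidalCategory.tensorHom_comp_tensorHom]
      rw [h₁, hη, tensorHom_def', comp_whiskerRight]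
      have h₄ : P.p ▷ Q.X ▷ P.X ≫ (α_ P.X Q.X P.X).hom ≫ P.X ◁ ε_ P.X Q.X =
          (α_ P.X Q.X P.X).hom ≫ P.X ◁ ε_ P.X Q.X ≫ P.p ▷ 𝟙_ C := by
        rw [whisker_exchange]; simp
      simp only [Category.assoc]
      rw [h₄, ExactPairing.evaluation_coevaluation_assoc, id_tensorHom, rightUnitor_inv_naturality] }

/-- The dual of the image of an idempotent is the image of the mate of that idempotent. -/
lemma karoubi_hasRightDual (P : Karoubi C) [HasRightDual P.X] : Nonempty (HasRightDual P) := by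
  let Q : Karoubi C := ⟨(P.X)ᘁ, P.pᘁ, by rw [← comp_rightAdjointMate, P.idem]⟩
  let _ : ExactPairing P.X Q.X := inferInstanceAs (ExactPairing P.X (P.X)ᘁ)
  have := karoubiExactPairing P Q (coevaluation_comp_rightAdjointMate P.p)
    (rightAdjointMate_comp_evaluation P.p)
  exact ⟨⟨Q⟩⟩

lemma karoubi_hasLeftDual (P : Karoubi C) [HasLeftDual P.X] : Nonempty (HasLeftDual P) := by
  let Q : Karoubi C := ⟨(ᘁ(P.X)), (ᘁP.p), by rw [← comp_leftAdjointMate, P.idem]⟩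
  let _ : ExactPairing Q.X P.X := inferInstanceAs (ExactPairing (ᘁ(P.X)) P.X)
  have := karoubiExactPairing Q P (coevaluation_comp_leftAdjointMate P.p).symm
    (leftAdjointMate_comp_evaluation P.p).symm
  exact ⟨⟨Q⟩⟩

end karoubi

end ScalarExtension

namespace ScalarExtension

open Idempotents

/-! ### The naive extension of scalars -/

section naive

variable (k : Type v) [Field k] (K : Type v) [Field K] [Algebra k K]
  {T : Type u} [Category.{v} T] [Preadditive T] [Linear k T]

instance : (toNaive k K T).Additive where
  map_add := toNaive_map_add k K _ _

variable {k K} in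
lemma Naive.tm_eq_smul {X Y : Naive k K T} (a : K) (f : X.obj ⟶ Y.obj) :
    (tm a f : X ⟶ Y) = a • (tm 1 f : X ⟶ Y) := by
  rw [smul_tm, mul_one]

/-- Multiplication in `End` is composition in the opposite order, so stability under precomposition
means being a right ideal of `K ⊗ End X`, and a left identity `e` satisfies `a ≫ e = a`. -/
lemma Naive.exists_left_identity {X : T} (hX : IsSeparableAlgebra k (End X))
    (I : Submodule K ((⟨X⟩ : Naive k K T) ⟶ ⟨X⟩))
    (hI : ∀ m ∈ I, ∀ b : (⟨X⟩ : Naive k K T) ⟶ ⟨X⟩, b ≫ m ∈ I) :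
    ∃ e ∈ I, ∀ a ∈ I, a ≫ e = a := by
  let B := End (⟨X⟩ : Naive k K T)
  let _ : Algebra k B := Algebra.compHom B (algebraMap k K)
  have : IsScalarTower k K B := .of_algebraMap_eq fun _ => rfl
  let j : End X →ₐ[k] B :=
    { toFun := fun f => Naive.tm 1 f
      map_one' := rfl
      map_mul' := fun f g => by
        rw [End.mul_def, End.mul_def, Naive.tm_comp, mul_one]
      map_zero' := (toNaive k K T).map_zero X X
      map_add' := fun f g => toNaive_map_add k K f g
      commutes' := fun r => by
        rw [Algebra.algebraMap_eq_smul_one, Algebra.algebraMap_eq_smul_one]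
        exact toNaive_map_smul k K r (𝟙 X) }
  have hj : Submodule.span K (Set.range j) = ⊤ := by
    rw [eq_top_iff]
    rintro f -
    induction f using Naive.hom_induction with
    | zero => exact zero_mem _
    | add f g hf hg => exact add_mem hf hg
    | tmul a f =>
      rw [Naive.tm_eq_smul]
      exact Submodule.smul_mem _ _ (Submodule.subset_span ⟨f, rfl⟩)
  exact hX.exists_left_identity j hj I hI

/-- If all endomorphism algebras of `T` are separable, then every morphism of the naive extension of
scalars has a quasi-inverse. -/
theorem isRegularCategory_naive [HasBinaryBiproducts T]
    (hT : ∀ X : T, IsSeparableAlgebra k (End X)) : IsRegularCategory (Naive k K T) := by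
  have key : ∀ (X : T) (f : (⟨X⟩ : Naive k K T) ⟶ ⟨X⟩), ∃ g, f ≫ g ≫ f = f := by
    intro X f
    -- The right ideal generated by `f` consists of the `g ≫ f`. Its left identity has this form,
    -- and applied to `f` itself it says that `g` is a quasi-inverse.
    obtain ⟨e, ⟨g, hg⟩, he⟩ := Naive.exists_left_identity k K (hT X)
      (LinearMap.range (Linear.rightComp K (⟨X⟩ : Naive k K T) f))
      (by rintro _ ⟨g, rfl⟩ b; exact ⟨b ≫ g, Category.assoc b g f⟩)
    have := he f ⟨𝟙 _, Category.id_comp f⟩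
    rw [← hg] at this
    exact ⟨g, this⟩
  intro X Y f
  let F := toNaive k K T
  -- A morphism `X ⟶ Y` is a corner of an endomorphism of `X ⊞ Y`; the corresponding corner of a
  -- quasi-inverse is a quasi-inverse.
  let Z := X.obj ⊞ Y.obj
  let i₁ : X ⟶ F.obj Z := F.map biprod.inl
  let i₂ : Y ⟶ F.obj Z := F.map biprod.inr
  let p₁ : F.obj Z ⟶ X := F.map biprod.fst
  let p₂ : F.obj Z ⟶ Y := F.map biprod.snd
  have h₁ : i₁ ≫ p₁ = 𝟙 X :=
    (F.map_comp _ _).symm.trans ((congrArg F.map biprod.inl_fst).trans (F.map_id _))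
  have h₂ : i₂ ≫ p₂ = 𝟙 Y :=
    (F.map_comp _ _).symm.trans ((congrArg F.map biprod.inr_snd).trans (F.map_id _))
  obtain ⟨g, hg⟩ : ∃ g : F.obj Z ⟶ F.obj Z, (p₁ ≫ f ≫ i₂) ≫ g ≫ p₁ ≫ f ≫ i₂ = p₁ ≫ f ≫ i₂ :=
    key Z (p₁ ≫ f ≫ i₂)
  refine ⟨i₂ ≫ g ≫ p₁, ?_⟩
  have := congrArg (fun q => i₁ ≫ q ≫ p₂) hg
  simpa only [Category.assoc, reassoc_of% h₁, h₂, Category.comp_id] using this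

lemma hasFiniteBiproducts_naive [HasFiniteBiproducts T] : HasFiniteBiproducts (Naive k K T) where
  out _ := ⟨fun F => ⟨⟨⟨(toNaive k K T).mapBicone (biproduct.bicone fun j => (F j).obj),
    isBilimitOfPreserves (toNaive k K T) (biproduct.isBilimit fun j => (F j).obj)⟩⟩⟩⟩

lemma essentiallySmall_naive [EssentiallySmall.{v} T] : EssentiallySmall.{v} (Naive k K T) := by
  rw [essentiallySmall_iff]
  refine ⟨?_, inferInstance⟩
  let e := equivSmallModel.{v} T
  let F : SmallModel.{v} T → Skeleton (Naive k K T) := fun x => toSkeleton ⟨e.inverse.obj x⟩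
  refine small_of_surjective (f := F) fun s => ?_
  obtain ⟨P, rfl⟩ := Quotient.exists_rep s
  exact ⟨e.functor.obj P.obj, Quotient.sound ⟨Naive.isoOf (e.unitIso.app P.obj).symm⟩⟩

variable [MonoidalCategory T] [MonoidalPreadditive T] [MonoidalLinear k T]

lemma Naive.whiskerLeft_tm (P : Naive k K T) {X Y : Naive k K T} (a : K) (f : X.obj ⟶ Y.obj) :
    P ◁ (tm a f : X ⟶ Y) = (tm a (P.obj ◁ f) : P ⊗ X ⟶ P ⊗ Y) := by
  refine (tensorNaive_tm 1 a (𝟙 P.obj) f).trans ?_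
  rw [one_mul, id_tensorHom]

lemma Naive.whiskerRight_tm {X Y : Naive k K T} (a : K) (f : X.obj ⟶ Y.obj) (P : Naive k K T) :
    (tm a f : X ⟶ Y) ▷ P = (tm a (f ▷ P.obj) : X ⊗ P ⟶ Y ⊗ P) := by
  refine (tensorNaive_tm a 1 f (𝟙 P.obj)).trans ?_
  rw [mul_one, tensorHom_id]

/-- An exact pairing in `T` gives an exact pairing in the naive extension of scalars. -/
@[reducible]
def naiveExactPairing (X Y : Naive k K T) [ExactPairing X.obj Y.obj] : ExactPairing X Y where
  coevaluation' := Naive.tm 1 (η_ X.obj Y.obj)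
  evaluation' := Naive.tm 1 (ε_ X.obj Y.obj)
  coevaluation_evaluation' := by
    rw [Naive.whiskerLeft_tm, Naive.whiskerRight_tm]
    refine Eq.trans ?_ ((congrArg (Naive.tm 1)
      (ExactPairing.coevaluation_evaluation X.obj Y.obj)).trans ?_)
    · exact (congrArg (_ ≫ ·) (Naive.tm_comp 1 1 _ _)).trans
        ((Naive.tm_comp 1 (1 * 1) _ _).trans (by rw [mul_one, mul_one]))
    · exact ((Naive.tm_comp 1 1 _ _).trans (by rw [mul_one])).symm
  evaluation_coevaluation' := by
    rw [Naive.whiskerLeft_tm, Naive.whiskerRight_tm]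
    refine Eq.trans ?_ ((congrArg (Naive.tm 1)
      (ExactPairing.evaluation_coevaluation X.obj Y.obj)).trans ?_)
    · exact (congrArg (_ ≫ ·) (Naive.tm_comp 1 1 _ _)).trans
        ((Naive.tm_comp 1 (1 * 1) _ _).trans (by rw [mul_one, mul_one]))
    · exact ((Naive.tm_comp 1 1 _ _).trans (by rw [mul_one])).symm

variable {k K} in
lemma naive_hasRightDual {X : Naive k K T} (h : Nonempty (HasRightDual X.obj)) :
    Nonempty (HasRightDual X) := by
  obtain ⟨h⟩ := h
  have := naiveExactPairing k K X ⟨X.objᘁ⟩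
  exact ⟨⟨⟨X.objᘁ⟩⟩⟩

variable {k K} in
lemma naive_hasLeftDual {X : Naive k K T} (h : Nonempty (HasLeftDual X.obj)) :
    Nonempty (HasLeftDual X) := by
  obtain ⟨h⟩ := h
  have := naiveExactPairing k K ⟨(ᘁ(X.obj))⟩ X
  exact ⟨⟨⟨(ᘁ(X.obj))⟩⟩⟩

end naive

/-! ### The pseudo-abelian extension as a semisimple tensor category -/

section pseudoAbelian

variable (k : Type v) [Field k] (K : Type v) [Field K] [Algebra k K]
  {T : Type u} [Category.{v} T] [Preadditive T] [Linear k T]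

lemma pseudoAbelianExt_finite_hom (hfin : ∀ X Y : T, Module.Finite k (X ⟶ Y))
    (P Q : PseudoAbelianExt k K T) : Module.Finite K (P ⟶ Q) := by
  have := hfin P.X.obj Q.X.obj
  have : Module.Finite K (P.X ⟶ Q.X) :=
    inferInstanceAs (Module.Finite K (K ⊗[k] (P.X.obj ⟶ Q.X.obj)))
  let f : (P ⟶ Q) →ₗ[K] (P.X ⟶ Q.X) :=
    { toFun := fun f => f.f
      map_add' := fun _ _ => rfl
      map_smul' := fun _ _ => rfl }
  exact Module.Finite.of_injective f fun f g h => Karoubi.hom_ext _ _ h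

theorem isRegularCategory_pseudoAbelianExt [HasBinaryBiproducts T]
    (hT : ∀ X : T, IsSeparableAlgebra k (End X)) : IsRegularCategory (PseudoAbelianExt k K T) :=
  (isRegularCategory_naive k K hT).karoubi

lemma hasFiniteProducts_pseudoAbelianExt [HasFiniteBiproducts T] :
    HasFiniteProducts (PseudoAbelianExt k K T) := by
  have := hasFiniteBiproducts_naive k K (T := T)
  infer_instance

variable [MonoidalCategory T] [MonoidalPreadditive T] [MonoidalLinear k T]

/-- The unit carries the identity idempotent, so its endomorphisms are `K ⊗ End 𝟙 = K ⊗ k = K`. -/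
lemma bijective_algebraMap_end_unit_pseudoAbelianExt
    (hk : Function.Bijective (algebraMap k (End (𝟙_ T)))) :
    Function.Bijective (algebraMap K (End (𝟙_ (PseudoAbelianExt k K T)))) := by
  let κ : k ≃ₗ[k] (𝟙_ T ⟶ 𝟙_ T) := LinearEquiv.ofBijective (Algebra.linearMap k (End (𝟙_ T))) hk
  let φ : K ≃ₗ[K] K ⊗[k] (𝟙_ T ⟶ 𝟙_ T) :=
    (TensorProduct.AlgebraTensorModule.rid k K K).symm.trans
      (TensorProduct.AlgebraTensorModule.congr (LinearEquiv.refl K K) κ)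
  have hφ : ∀ a, φ a = a ⊗ₜ 𝟙 (𝟙_ T) := fun a => by
    have : κ 1 = 𝟙 (𝟙_ T) := map_one (algebraMap k (End (𝟙_ T)))
    simp [φ, this]
  have hf : ∀ a : K, (algebraMap K (End (𝟙_ (PseudoAbelianExt k K T))) a).f = φ a := fun a => by
    rw [hφ, Algebra.algebraMap_eq_smul_one]
    refine (karoubi_smul_f a (𝟙 (𝟙_ (PseudoAbelianExt k K T)))).trans ?_
    exact (Naive.smul_tm a 1 (𝟙 (𝟙_ T))).trans (by rw [mul_one]; rfl)
  refine ⟨fun a b h => φ.injective ?_, fun f => ?_⟩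
  · rw [← hf, ← hf, h]
  · obtain ⟨a, ha⟩ := φ.surjective f.f
    exact ⟨a, Karoubi.hom_ext _ _ ((hf a).trans ha)⟩

/-- The pseudo-abelian extension of scalars of `T` is a tensor category when all endomorphism
algebras of `T` are separable. -/
theorem isTensorCategory_pseudoAbelianExt (hT : IsTensorCategory k T)
    (hsep : ∀ X : T, IsSeparableAlgebra k (End X)) :
    IsTensorCategory K (PseudoAbelianExt k K T) := by
  have := hT.essentiallySmall
  have := essentiallySmall_naive k K (T := T)
  have := hT.abelian.hasFiniteProducts
  have : HasFiniteBiproducts T := .of_hasFiniteProducts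
  have : HasBinaryBiproducts T := hasBinaryBiproducts_of_finite_biproducts T
  have := hasFiniteProducts_pseudoAbelianExt k K (T := T)
  exact
  { essentiallySmall := essentiallySmall_karoubi
    bijective_algebraMap_end_unit :=
      bijective_algebraMap_end_unit_pseudoAbelianExt k K hT.bijective_algebraMap_end_unit
    rigid := fun P => by
      obtain ⟨h₁⟩ := naive_hasLeftDual (X := P.X) (hT.rigid P.X.obj).1
      obtain ⟨h₂⟩ := naive_hasRightDual (X := P.X) (hT.rigid P.X.obj).2
      exact ⟨karoubi_hasLeftDual P, karoubi_hasRightDual P⟩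
    abelian := (isRegularCategory_pseudoAbelianExt k K hsep).isAbelianCategory }

theorem isSemisimpleCategory_pseudoAbelianExt [HasBinaryBiproducts T]
    (hsep : ∀ X : T, IsSeparableAlgebra k (End X)) (hfin : ∀ X Y : T, Module.Finite k (X ⟶ Y)) :
    IsSemisimpleCategory (PseudoAbelianExt k K T) :=
  (isRegularCategory_pseudoAbelianExt k K hsep).isSemisimpleCategory K
    (pseudoAbelianExt_finite_hom k K hfin)

end pseudoAbelian

end ScalarExtension

namespace ScalarExtension

open Idempotents

/-! ### Full faithfulness of the functor to `T_K` -/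

section fullyFaithful

variable (k : Type v) [Field k] (K : Type v) [Field K] [Algebra k K]
  {T : Type u} [Category.{v} T] [Preadditive T] [Linear k T]

lemma yonedaInv_zero {H : Tᵒᵖ ⥤ ModuleCat.{v} K} (hH : IsScalarLinear k K T H) {X : T} (Y : T)
    (x : K ⊗[k] (Y ⟶ X)) : yonedaInv k K hH (0 : H.obj (op X)) Y x = 0 := by
  induction x using TensorProduct.induction_on with
  | zero => simp
  | add x y hx hy => rw [map_add, hx, hy, add_zero]
  | tmul a f => rw [yonedaInv_tmul, map_zero, smul_zero]

/-- Morphisms of presheaves are compatible with the action of morphisms of the pseudo-abelian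
extension. -/
lemma app_comp_eq_yonedaInv {P : PseudoAbelianExt k K T} {H : Tᵒᵖ ⥤ ModuleCat.{v} K}
    (hH : IsScalarLinear k K T H) (φ : (restrictedYoneda k K T).obj P ⟶ H) {X Y : T}
    (g : free k K T Y ⟶ free k K T X) (x : free k K T X ⟶ P) :
    φ.app (op Y) (g ≫ x) = yonedaInv k K hH (φ.app (op X) x) Y g.f := by
  have := yonedaInv_app k K hH ((restrictedYoneda k K T).map x ≫ φ) g
  have h1 : ((restrictedYoneda k K T).map x ≫ φ).app (op X) (𝟙 (free k K T X)) =
      φ.app (op X) x :=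
    congrArg (φ.app (op X)) (Category.id_comp x)
  rw [h1] at this
  exact this.symm

lemma app_comp_eq_zero {P : PseudoAbelianExt k K T} {H : Tᵒᵖ ⥤ ModuleCat.{v} K}
    (hH : IsScalarLinear k K T H) (φ : (restrictedYoneda k K T).obj P ⟶ H) {X Y : T}
    (g : free k K T Y ⟶ free k K T X) (x : free k K T X ⟶ P) (hx : φ.app (op X) x = 0) :
    φ.app (op Y) (g ≫ x) = 0 := by
  exact (app_comp_eq_yonedaInv k K hH φ g x).trans
    ((congrArg (fun z => yonedaInv k K hH z Y g.f) hx).trans (yonedaInv_zero k K hH Y g.f))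

/-- A morphism out of `P` is recovered from its composite with the retraction `K ⊗ P.X.obj ⟶ P`,
which is the generic section of `P`. -/
instance : (restrictedYoneda k K T).Faithful where
  map_injective {P Q f g} h := by
    have : (retractFree k K T P).r ≫ f = (retractFree k K T P).r ≫ g :=
      congrArg (fun φ : (restrictedYoneda k K T).obj P ⟶ (restrictedYoneda k K T).obj Q =>
        φ.app (op P.X.obj) (retractFree k K T P).r) h
    rw [← (retractFree k K T P).retract_assoc f, this, (retractFree k K T P).retract_assoc]

instance : (restrictedYoneda k K T).Full where
  map_surjective {P Q} φ := by
    let r := retractFree k K T P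
    let y : free k K T P.X.obj ⟶ Q := φ.app (op P.X.obj) r.r
    -- Naturality of `φ` is given only for morphisms of `T`; `K`-linearity extends it to all
    -- morphisms between free objects.
    have key : ∀ {X Y : T} (g : free k K T Y ⟶ free k K T X) (x : free k K T X ⟶ P),
        φ.app (op Y) (g ≫ x) = g ≫ (φ.app (op X) x : free k K T X ⟶ Q) := by
      intro X Y g x
      have hQ := restrictedYoneda_linear k K T Q
      rw [app_comp_eq_yonedaInv k K hQ]
      refine (congrArg (fun z => yonedaInv k K hQ z Y g.f) ?_).trans
        (app_comp_eq_yonedaInv k K hQ (𝟙 ((restrictedYoneda k K T).obj Q)) g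
          (φ.app (op X) x)).symm
      rfl
    refine ⟨r.i ≫ y, ?_⟩
    ext X x
    let x' : free k K T X.unop ⟶ P := x
    have hx : (x' ≫ r.i) ≫ r.r = x' := by rw [Category.assoc, r.retract, Category.comp_id]
    have h := (congrArg (φ.app X) hx).symm.trans (key (x' ≫ r.i) r.r)
    exact (h.trans (Category.assoc x' r.i y)).symm

instance : (toIndExt k K T).Full :=
  inferInstanceAs (ObjectProperty.lift _ (restrictedYoneda k K T) _).Full

instance : (toIndExt k K T).Faithful :=
  inferInstanceAs (ObjectProperty.lift _ (restrictedYoneda k K T) _).Faithful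

instance : (toCompactExt k K T).Full :=
  inferInstanceAs (ObjectProperty.lift _ (toIndExt k K T) _).Full

instance : (toCompactExt k K T).Faithful :=
  inferInstanceAs (ObjectProperty.lift _ (toIndExt k K T) _).Faithful

instance : (toCompactExt k K T).Additive where
  map_add {P Q f g} := by
    apply (ObjectProperty.ι _ ⋙ ObjectProperty.ι _).map_injective
    ext X x
    exact Preadditive.comp_add _ _ _ x f g

instance : (toCompactExt k K T).Linear K where
  map_smul {P Q} f r := by
    apply (ObjectProperty.ι _ ⋙ ObjectProperty.ι _).map_injective
    ext X x
    exact Linear.comp_smul _ _ _ x r f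

end fullyFaithful

/-! ### Left exactness of additive functors -/

section leftExact

variable {C : Type u} [Category.{v} C] [Preadditive C]

/-- An additive functor preserves the kernels of morphisms that have a quasi-inverse. -/
lemma preservesLimit_parallelPair_of_quasi_inverse {D : Type u'} [Category.{v'} D] [Preadditive D]
    (F : C ⥤ D) [F.Additive] {X Y : C} (f : X ⟶ Y) (hf : ∃ g, f ≫ g ≫ f = f) :
    PreservesLimit (parallelPair f 0) F := by
  obtain ⟨g, hg⟩ := hf
  refine ⟨fun {c} hc => ?_⟩
  let c : KernelFork f := c
  have hc : IsLimit c := hc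
  have hι : Mono c.ι := Fork.IsLimit.mono hc
  -- The kernel of `f` is the image of the idempotent `𝟙 X - f ≫ g`. It is therefore described by
  -- equations that any additive functor respects.
  obtain ⟨r, hr⟩ : ∃ r : X ⟶ c.pt, r ≫ c.ι = 𝟙 X - f ≫ g :=
    ⟨hc.lift (KernelFork.ofι (𝟙 X - f ≫ g) (by simp [hg])), Fork.IsLimit.lift_ι hc⟩
  have hr' : c.ι ≫ r = 𝟙 _ := by
    rw [← cancel_mono c.ι, Category.assoc, hr]
    simp [reassoc_of% c.condition]
  refine ⟨(KernelFork.isLimitMapConeEquiv c F).symm ?_⟩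
  refine KernelFork.IsLimit.ofι (F.map c.ι) (c.map_condition F) (fun s _ => s ≫ F.map r) (fun s hs => ?_) (fun s hs m hm => ?_)
  · rw [Category.assoc, ← F.map_comp, hr, F.map_sub, F.map_id, F.map_comp, Preadditive.comp_sub,
      reassoc_of% hs]
    simp
  · rw [← hm, Category.assoc, ← F.map_comp, hr', F.map_id, Category.comp_id]

/-- Kernels in a regular category are split, so additivity alone implies left exactness. Applied to
`Tᵒᵖ`, this puts subpresheaves generated by sections into `(Ind T)_K`. -/
lemma IsRegularCategory.preservesFiniteLimits (h : IsRegularCategory C) [HasFiniteProducts C]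
    [HasKernels C] {D : Type u'} [Category.{v'} D] [Preadditive D] [HasZeroObject D]
    (F : C ⥤ D) [F.Additive] : PreservesFiniteLimits F := by
  have : ∀ {X Y : C} (f : X ⟶ Y), PreservesLimit (parallelPair f 0) F := fun f =>
    preservesLimit_parallelPair_of_quasi_inverse F f (h f)
  have : HasEqualizers C := Preadditive.hasEqualizers_of_hasKernels
  have : HasBinaryBiproducts C := .of_hasBinaryProducts
  have : HasZeroObject C := hasZeroObject_of_hasTerminal_object
  exact F.preservesFiniteLimits_of_preservesKernels

end leftExact

/-! ### Compact objects are quotients of free objects -/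

section generated

variable (k : Type v) [Field k] {K : Type v} [Field K] [Algebra k K]
  {T : Type u} [Category.{v} T]

/-- The values of the subpresheaf generated by a set of sections. -/
def generatedSubmodule (H : Tᵒᵖ ⥤ ModuleCat.{v} K) (S : Set (Σ X : T, H.obj (op X))) (Y : Tᵒᵖ) :
    Submodule K (H.obj Y) :=
  Submodule.span K {y | ∃ s ∈ S, ∃ f : op s.1 ⟶ Y, H.map f s.2 = y}

lemma generatedSubmodule_le_comap (H : Tᵒᵖ ⥤ ModuleCat.{v} K) (S : Set (Σ X : T, H.obj (op X)))
    {Y Z : Tᵒᵖ} (g : Y ⟶ Z) :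
    generatedSubmodule H S Y ≤ (generatedSubmodule H S Z).comap (H.map g).hom := by
  refine Submodule.span_le.2 ?_
  rintro _ ⟨s, hs, f, rfl⟩
  exact Submodule.subset_span ⟨s, hs, f ≫ g, by rw [H.map_comp]; rfl⟩

lemma generatedSubmodule_mono (H : Tᵒᵖ ⥤ ModuleCat.{v} K) {S S' : Set (Σ X : T, H.obj (op X))}
    (h : S ⊆ S') (Y : Tᵒᵖ) : generatedSubmodule H S Y ≤ generatedSubmodule H S' Y :=
  Submodule.span_mono fun _ ⟨s, hs, f, hf⟩ => ⟨s, h hs, f, hf⟩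

/-- The subpresheaf generated by a set of sections. -/
def generatedSubpresheaf (H : Tᵒᵖ ⥤ ModuleCat.{v} K) (S : Set (Σ X : T, H.obj (op X))) :
    Tᵒᵖ ⥤ ModuleCat.{v} K where
  obj Y := ModuleCat.of K (generatedSubmodule H S Y)
  map g := ModuleCat.ofHom ((H.map g).hom.restrict (generatedSubmodule_le_comap H S g))
  map_id Y := by
    refine ModuleCat.hom_ext (LinearMap.ext fun x => Subtype.ext ?_)
    exact congrArg (fun q : H.obj Y ⟶ H.obj Y => q x.1) (H.map_id Y)
  map_comp f g := by
    refine ModuleCat.hom_ext (LinearMap.ext fun x => Subtype.ext ?_)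
    exact congrArg (fun q => q.hom x.1) (H.map_comp f g)

/-- The inclusion of the subpresheaf generated by a set of sections. -/
def generatedSubpresheafι (H : Tᵒᵖ ⥤ ModuleCat.{v} K) (S : Set (Σ X : T, H.obj (op X))) :
    generatedSubpresheaf H S ⟶ H where
  app Y := ModuleCat.ofHom (generatedSubmodule H S Y).subtype

/-- The inclusion between two generated subpresheaves. -/
def generatedSubpresheafMap (H : Tᵒᵖ ⥤ ModuleCat.{v} K) {S S' : Set (Σ X : T, H.obj (op X))}
    (h : S ⊆ S') : generatedSubpresheaf H S ⟶ generatedSubpresheaf H S' where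
  app Y := ModuleCat.ofHom (Submodule.inclusion (generatedSubmodule_mono H h Y))

variable [Preadditive T] [Linear k T]

lemma isScalarLinear_generatedSubpresheaf {H : Tᵒᵖ ⥤ ModuleCat.{v} K}
    (hH : IsScalarLinear k K T H) (S : Set (Σ X : T, H.obj (op X))) :
    IsScalarLinear k K T (generatedSubpresheaf H S) := by
  refine ⟨⟨fun {X Y f g} => ?_⟩, fun X Y r f => ?_⟩
  · ext x
    exact Subtype.ext (congrArg (fun q => q.hom x.1) (hH.1.map_add (f := f) (g := g)))
  · ext x
    exact Subtype.ext (congrArg (fun q => q.hom x.1) (hH.2 r f))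

/-- If all additive presheaves are left exact, a compact object of `(Ind T)_K` is a quotient of a free
object. -/
theorem exists_surjective_from_free [EssentiallySmall.{v} T] [HasFiniteBiproducts T]
    (hreg : IsRegularCategory T) [HasKernels Tᵒᵖ] (M : CompactExt k K T) :
    ∃ (X : T) (φ : (restrictedYoneda k K T).obj (free k K T X) ⟶ M.obj.obj),
      ∀ Y, Function.Surjective (φ.app Y) := by
  classical
  let H := M.obj.obj
  have hH : IsScalarLinear k K T H := M.obj.property.2
  have hH' : H.Additive := hH.1
  let e := equivSmallModel.{v} T
  -- Sections are taken over the small model so that the finite sets of sections form a directed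
  -- diagram of the size that finite presentability allows.
  let ι := Σ X : SmallModel.{v} T, H.obj (op (e.inverse.obj X))
  let S : Finset ι → Set (Σ X : T, H.obj (op X)) := fun F => {s | ∃ x ∈ F, s = ⟨_, x.2⟩}
  have hS : ∀ {F G : Finset ι}, F ≤ G → S F ⊆ S G := fun h s ⟨x, hx, hs⟩ => ⟨x, h hx, hs⟩
  have : HasFiniteProducts Tᵒᵖ := inferInstance
  let D : Finset ι ⥤ IndExt k K T :=
    { obj := fun F => ⟨generatedSubpresheaf H (S F), by
        have hlin := isScalarLinear_generatedSubpresheaf k hH (S F)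
        have := hlin.1
        exact ⟨hreg.op.preservesFiniteLimits _, hlin⟩⟩
      map := fun f => ObjectProperty.homMk (generatedSubpresheafMap H (hS (leOfHom f)))
      map_id := fun _ => rfl
      map_comp := fun _ _ => rfl }
  let c : Cocone D :=
    { pt := M.obj
      ι := { app := fun F => ObjectProperty.homMk (generatedSubpresheafι H (S F)) } }
  have hc : IsColimit c := by
    refine isColimitOfReflects (ObjectProperty.ι _) (evaluationJointlyReflectsColimits _ fun Y => ?_)
    refine isColimitOfReflects (CategoryTheory.forget (ModuleCat.{v} K)) ?_
    refine Types.FilteredColimit.isColimitOf _ _ (fun y => ?_) (fun F G x y hxy => ?_)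
    · let i := e.unitIso.app Y.unop
      let y' : H.obj (op Y.unop) := y
      let x : ι := ⟨e.functor.obj Y.unop, H.map i.inv.op y'⟩
      have hx : H.map i.hom.op x.2 = y' := by
        have h2 := H.map_comp i.inv.op i.hom.op
        rw [← op_comp, i.hom_inv_id] at h2
        exact (congrArg (fun q => q.hom y') (h2.symm.trans (H.map_id (op Y.unop))))
      exact ⟨{x}, ⟨y', Submodule.subset_span
        ⟨⟨e.inverse.obj x.1, x.2⟩, ⟨x, Finset.mem_singleton_self _, rfl⟩, i.hom.op, hx⟩⟩, rfl⟩
    · exact ⟨F ⊔ G, homOfLE le_sup_left, homOfLE le_sup_right, Subtype.ext hxy⟩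
  have : IsFinitelyPresentable.{v} M.obj := M.property
  -- Compactness factors the identity of `M` through one stage, so the finitely many sections in `F`
  -- generate `M`.
  obtain ⟨F, p, hp⟩ := IsFinitelyPresentable.exists_hom_of_isColimit hc (𝟙 M.obj)
  have hF : ∀ Y (y : H.obj Y), y ∈ generatedSubmodule H (S F) Y := by
    intro Y y
    have : (p.hom ≫ generatedSubpresheafι H (S F)).app Y y = y :=
      congrArg (fun q : M.obj ⟶ M.obj => q.hom.app Y y) hp
    rw [← this]
    exact (p.hom.app Y y).2
  let Z : F → T := fun x => e.inverse.obj x.1.1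
  let B : T := ⨁ Z
  -- Finitely many generating sections are combined into one over the direct sum of their objects;
  -- restriction along the inclusions recovers each of them.
  let h : H.obj (op B) := ∑ x, H.map (biproduct.π Z x).op x.1.2
  have hh : ∀ x, H.map (biproduct.ι Z x).op h = x.1.2 := by
    intro x
    have key : ∀ y, H.map (biproduct.ι Z x).op (H.map (biproduct.π Z y).op y.1.2) =
        H.map (biproduct.ι Z x ≫ biproduct.π Z y).op y.1.2 := fun y => by
      rw [op_comp, H.map_comp]; rfl
    simp only [h, map_sum]
    rw [Finset.sum_eq_single x]
    · rw [key, biproduct.ι_π_self]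
      exact congrArg (fun q => q.hom x.1.2) (H.map_id _)
    · intro y _ hy
      rw [key, biproduct.ι_π_ne Z hy.symm, op_zero, H.map_zero]
      rfl
    · simp
  let φ := (freeHomEquiv k K T B H hH).symm h
  have hφ : φ.app (op B) (𝟙 (free k K T B)) = h := (freeHomEquiv k K T B H hH).apply_symm_apply h
  refine ⟨B, φ, fun Y y => ?_⟩
  suffices generatedSubmodule H (S F) Y ≤ LinearMap.range (φ.app Y).hom from this (hF Y y)
  refine Submodule.span_le.2 ?_
  rintro _ ⟨_, ⟨x, hx, rfl⟩, f, rfl⟩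
  let g : op B ⟶ Y := (biproduct.ι Z ⟨x, hx⟩).op ≫ f
  refine ⟨((restrictedYoneda k K T).obj (free k K T B)).map g (𝟙 (free k K T B)), ?_⟩
  refine (congrArg (fun q => q.hom (𝟙 (free k K T B))) (φ.naturality g)).trans ?_
  change H.map g (φ.app (op B) (𝟙 (free k K T B))) = _
  rw [hφ, H.map_comp]
  exact congrArg (H.map f) (hh ⟨x, hx⟩)

end generated

/-! ### Quotients of free objects are representable -/

section essSurj

variable (k : Type v) [Field k] (K : Type v) [Field K] [Algebra k K]
  {T : Type u} [Category.{v} T] [Preadditive T] [Linear k T]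

/-- The functor from the naive extension of scalars to its pseudo-abelian envelope, as a linear map
on morphisms. -/
def freeMapLinear (X Y : T) :
    ((⟨X⟩ : Naive k K T) ⟶ ⟨Y⟩) →ₗ[K] (free k K T X ⟶ free k K T Y) where
  toFun a := (toKaroubi (Naive k K T)).map a
  map_add' _ _ := rfl
  map_smul' _ _ := Karoubi.hom_ext _ _ rfl

/-- A quotient of a free object is represented by an object of the pseudo-abelian extension. -/
theorem exists_iso_restrictedYoneda [HasBinaryBiproducts T]
    (hsep : ∀ X : T, IsSeparableAlgebra k (End X)) {H : Tᵒᵖ ⥤ ModuleCat.{v} K}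
    (hH : IsScalarLinear k K T H) {X : T}
    (φ : (restrictedYoneda k K T).obj (free k K T X) ⟶ H)
    (hφ : ∀ Y, Function.Surjective (φ.app Y)) :
    ∃ Q : PseudoAbelianExt k K T, Nonempty ((restrictedYoneda k K T).obj Q ≅ H) := by
  -- The relations over `X` itself: endomorphisms of `K ⊗ X` killed by `φ`. The left identity `e` of
  -- this right ideal is idempotent, as `e` lies in the ideal.
  let I : Submodule K ((⟨X⟩ : Naive k K T) ⟶ ⟨X⟩) :=
    (LinearMap.ker (φ.app (op X)).hom).comap
      (freeMapLinear k K X X)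
  have hI : ∀ a : (⟨X⟩ : Naive k K T) ⟶ ⟨X⟩,
      a ∈ I ↔ φ.app (op X) ((toKaroubi (Naive k K T)).map a) = 0 := fun a => Iff.rfl
  obtain ⟨e, he, heI⟩ := Naive.exists_left_identity k K (hsep X) I (fun m hm b => by
    refine (hI _).2 ((congrArg (φ.app (op X)) ((toKaroubi (Naive k K T)).map_comp b m)).trans ?_)
    exact app_comp_eq_zero k K hH φ ((toKaroubi (Naive k K T)).map b) _ ((hI m).1 hm))
  have hee : e ≫ e = e := heI e he
  let E : free k K T X ⟶ free k K T X := (toKaroubi (Naive k K T)).map e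
  have hE : φ.app (op X) E = 0 := he
  let Q : PseudoAbelianExt k K T := ⟨⟨X⟩, 𝟙 _ - e, by simp [hee]⟩
  let j := (retractFree k K T Q).i
  let r := (retractFree k K T Q).r
  have hj : j ≫ E = 0 := by
    ext
    change (𝟙 _ - e) ≫ e = 0
    rw [Preadditive.sub_comp, hee]
    exact sub_eq_zero.2 (Category.id_comp e)
  have hr : r ≫ j = 𝟙 _ - E := by
    ext
    change (𝟙 _ - e) ≫ (𝟙 _ - e) = 𝟙 _ - e
    simp [hee]
  have hadd : ∀ {Y : T} (x y : free k K T Y ⟶ free k K T X),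
      φ.app (op Y) (x - y) = φ.app (op Y) x - φ.app (op Y) y :=
    fun x y => map_sub (φ.app (op _)).hom _ _
  let ψ := (restrictedYoneda k K T).map j ≫ φ
  have hψ : ∀ {Y : T} (q : free k K T Y ⟶ Q), ψ.app (op Y) q = φ.app (op Y) (q ≫ j) :=
    fun q => rfl
  have hbij : ∀ Y : T, Function.Bijective (ψ.app (op Y)) := by
    intro Y
    constructor
    · refine (injective_iff_map_eq_zero (ψ.app (op Y)).hom).2 fun (q : free k K T Y ⟶ Q) hq => ?_
      replace hq : φ.app (op Y) (q ≫ j) = 0 := hq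
      -- A quasi-inverse `g` turns a relation `q ≫ j` over an arbitrary `Y` into the endomorphism `g
      -- ≫ q ≫ j` of `K ⊗ X`. That lies in `I`, hence is fixed by `E`, whereas `j ≫ E = 0`.
      obtain ⟨g, hg⟩ := isRegularCategory_pseudoAbelianExt k K hsep (q ≫ j)
      have h1 : (g ≫ q ≫ j).f ∈ I := (hI _).2 (app_comp_eq_zero k K hH φ g _ hq)
      have h2 : (g ≫ q ≫ j) ≫ E = g ≫ q ≫ j := Karoubi.hom_ext _ _ (heI _ h1)
      have h3 : q ≫ j = 0 := by
        rw [← hg, ← h2]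
        simp only [Category.assoc, hj, comp_zero]
      have : j ≫ r = 𝟙 Q := (retractFree k K T Q).retract
      rw [← Category.comp_id q, ← this, reassoc_of% h3, zero_comp]
      rfl
    · intro y
      obtain ⟨x, rfl⟩ := hφ (op Y) y
      let x' : free k K T Y ⟶ free k K T X := x
      -- The section `x'` differs from its projection `x' ≫ r ≫ j` by `x' ≫ E`, which `φ` kills.
      refine ⟨(x' ≫ r : free k K T Y ⟶ Q), ?_⟩
      rw [hψ, Category.assoc, hr, Preadditive.comp_sub, Category.comp_id, hadd,
        app_comp_eq_zero k K hH φ x' E hE, sub_zero]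
  have : ∀ Y, IsIso (ψ.app Y) := fun Y =>
    (ConcreteCategory.isIso_iff_bijective (ψ.app Y)).2 (hbij Y.unop)
  have : IsIso ψ := NatIso.isIso_of_isIso_app ψ
  exact ⟨Q, ⟨asIso ψ⟩⟩

/-- If `T` is semisimple and has separable endomorphism algebras, then the canonical functor from the
pseudo-abelian extension to `T_K` is an equivalence. -/
theorem isEquivalence_toCompactExt [EssentiallySmall.{v} T] [HasFiniteBiproducts T]
    (hreg : IsRegularCategory T) [HasKernels Tᵒᵖ]
    (hsep : ∀ X : T, IsSeparableAlgebra k (End X)) : (toCompactExt k K T).IsEquivalence where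
  essSurj := ⟨fun M => by
    have : HasBinaryBiproducts T := hasBinaryBiproducts_of_finite_biproducts T
    obtain ⟨X, φ, hφ⟩ := exists_surjective_from_free k hreg M
    obtain ⟨Q, ⟨i⟩⟩ := exists_iso_restrictedYoneda k K hsep M.obj.property.2 φ hφ
    exact ⟨Q, ⟨ObjectProperty.isoMk _ (ObjectProperty.isoMk _ i)⟩⟩⟩

end essSurj

end ScalarExtension

namespace ScalarExtension

open Idempotents

/-! ### The universal bilinear transformation -/

section bilinear

variable (k : Type v) [Field k] (K : Type v) [Field K] [Algebra k K]
  {T : Type u} [Category.{v} T] [Preadditive T] [Linear k T] [MonoidalCategory T]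
  [MonoidalPreadditive T] [MonoidalLinear k T]

/-- The tensor product of `f : K ⊗ X ⟶ P` and `g : K ⊗ Y ⟶ Q` as a morphism
`K ⊗ (X ⊗ Y) ⟶ P ⊗ Q`. -/
def freeTensor {P Q : PseudoAbelianExt k K T} {X Y : T} (f : free k K T X ⟶ P)
    (g : free k K T Y ⟶ Q) : free k K T (X ⊗ Y) ⟶ P ⊗ Q where
  f := f.f ⊗ₘ g.f
  comm := by
    refine (Category.id_comp _).trans ?_
    refine (MonoidalCategory.tensorHom_comp_tensorHom f.f g.f P.p Q.p).trans ?_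
    rw [Karoubi.comp_p, Karoubi.comp_p]
    rfl

variable {k K}

lemma freeTensor_comp {P Q P' Q' : PseudoAbelianExt k K T} {X Y : T} (f : free k K T X ⟶ P)
    (g : free k K T Y ⟶ Q) (a : P ⟶ P') (b : Q ⟶ Q') :
    freeTensor k K (f ≫ a) (g ≫ b) = freeTensor k K f g ≫ (a ⊗ₘ b) :=
  Karoubi.hom_ext _ _ (MonoidalCategory.tensorHom_comp_tensorHom f.f g.f a.f b.f).symm

lemma comp_freeTensor {P Q : PseudoAbelianExt k K T} {X Y X' Y' : T} (u : X' ⟶ X) (w : Y' ⟶ Y)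
    (f : free k K T X ⟶ P) (g : free k K T Y ⟶ Q) :
    freeTensor k K ((toKaroubi _).map ((toNaive k K T).map u) ≫ f)
        ((toKaroubi _).map ((toNaive k K T).map w) ≫ g) =
      (toKaroubi _).map ((toNaive k K T).map (u ⊗ₘ w)) ≫ freeTensor k K f g := by
  apply Karoubi.hom_ext
  refine (MonoidalCategory.tensorHom_comp_tensorHom ((toNaive k K T).map u) ((toNaive k K T).map w)
    f.f g.f).symm.trans ?_
  refine congrArg (· ≫ (f.f ⊗ₘ g.f)) ?_
  refine (Naive.tensorHom_tm (1 : K) 1 u w).trans ?_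
  rw [mul_one]
  rfl

variable (k K) in
/-- The bilinear transformation `(f, g) ↦ f ⊗ g`. -/
def freeTensorBilinear (P Q : PseudoAbelianExt k K T) :
    BilinearTransformation K ((restrictedYoneda k K T).obj P) ((restrictedYoneda k K T).obj Q)
      ((restrictedYoneda k K T).obj (P ⊗ Q)) where
  app X Y := LinearMap.mk₂ K
    (fun (f : free k K T X ⟶ P) (g : free k K T Y ⟶ Q) => freeTensor k K f g)
    (fun f f' g => Karoubi.hom_ext _ _ (Naive.tensorNaive_add_left f.f f'.f g.f))
    (fun r f g => Karoubi.hom_ext _ _ (Naive.tensorNaive_smul_left r f.f g.f))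
    (fun f g g' => Karoubi.hom_ext _ _ (Naive.tensorNaive_add_right f.f g.f g'.f))
    (fun r f g => Karoubi.hom_ext _ _ (Naive.tensorNaive_smul_right r f.f g.f))
  naturality u w f g := comp_freeTensor u w f g

/-- A bilinear transformation is determined by its value on the generators. -/
lemma BilinearTransformation.app_eq_yonedaInv {P Q : PseudoAbelianExt k K T}
    {H : Tᵒᵖ ⥤ ModuleCat.{v} K} (hH : IsScalarLinear k K T H)
    (β : BilinearTransformation K ((restrictedYoneda k K T).obj P)
      ((restrictedYoneda k K T).obj Q) H) {X Y : T} (f : free k K T X ⟶ P)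
    (g : free k K T Y ⟶ Q) :
    β.app X Y f g = yonedaInv k K hH
      (β.app P.X.obj Q.X.obj (retractFree k K T P).r (retractFree k K T Q).r) (X ⊗ Y)
      (freeTensor k K f g).f := by
  let rP : ((restrictedYoneda k K T).obj P).obj (op P.X.obj) := (retractFree k K T P).r
  let rQ : ((restrictedYoneda k K T).obj Q).obj (op Q.X.obj) := (retractFree k K T Q).r
  -- Projecting an arbitrary morphism into `R.X` to a section of `R` makes it possible to argue on
  -- pure tensors, which need not themselves be compatible with the idempotent of `R`.
  let L : ∀ {R : PseudoAbelianExt k K T} (Z : T),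
      ((⟨Z⟩ : Naive k K T) ⟶ R.X) →ₗ[K] ((restrictedYoneda k K T).obj R).obj (op Z) :=
    fun {R} Z => LinearMap.comp
      (Linear.rightComp K (free k K T Z) (retractFree k K T R).r) (freeMapLinear k K Z R.X.obj)
  have hL : ∀ {R : PseudoAbelianExt k K T} {Z : T} (x : free k K T Z ⟶ R), L Z x.f = x :=
    fun {R} {Z} x => Karoubi.hom_ext _ _ (Karoubi.comp_p x)
  have hLtm : ∀ {R : PseudoAbelianExt k K T} {Z : T} (s : K) (u : Z ⟶ R.X.obj),
      L (R := R) Z (Naive.tm s u) =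
        s • ((restrictedYoneda k K T).obj R).map u.op (retractFree k K T R).r := by
    intro R Z s u
    rw [Naive.tm_eq_smul, map_smul]
    rfl
  have key : ∀ (a : (⟨X⟩ : Naive k K T) ⟶ P.X) (b : (⟨Y⟩ : Naive k K T) ⟶ Q.X),
      β.app X Y (L X a) (L Y b) = yonedaInv k K hH (β.app P.X.obj Q.X.obj rP rQ) (X ⊗ Y)
        (Naive.tensorNaive a b) := by
    intro a b
    induction a using Naive.hom_induction with
    | zero =>
      rw [Naive.tensorNaive_zero_left, map_zero, map_zero]
      exact (map_zero (yonedaInv k K hH (β.app P.X.obj Q.X.obj rP rQ) (X ⊗ Y))).symm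
    | add a a' ha ha' =>
      rw [Naive.tensorNaive_add_left, map_add, map_add, LinearMap.add_apply, ha, ha']
      exact (map_add (yonedaInv k K hH (β.app P.X.obj Q.X.obj rP rQ) (X ⊗ Y)) _ _).symm
    | tmul s u =>
      induction b using Naive.hom_induction with
      | zero =>
        rw [Naive.tensorNaive_zero_right, map_zero, map_zero]
        exact (map_zero (yonedaInv k K hH (β.app P.X.obj Q.X.obj rP rQ) (X ⊗ Y))).symm
      | add a a' ha ha' =>
        rw [Naive.tensorNaive_add_right, map_add, map_add, ha, ha']
        exact (map_add (yonedaInv k K hH (β.app P.X.obj Q.X.obj rP rQ) (X ⊗ Y)) _ _).symm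
      | tmul t w =>
        rw [hLtm, hLtm, map_smul, map_smul, LinearMap.smul_apply, smul_smul]
        refine (congrArg _ (β.naturality u w rP rQ)).trans ?_
        rw [mul_comm t s]
        rfl
  have := key f.f g.f
  rw [hL, hL] at this
  exact this

/-- The bilinear transformation `(f, g) ↦ f ⊗ g` is universal. -/
theorem freeTensorBilinear_universal (P Q : PseudoAbelianExt k K T) (H : Tᵒᵖ ⥤ ModuleCat.{v} K)
    (hH : IsScalarLinear k K T H) :
    Function.Bijective fun φ : (restrictedYoneda k K T).obj (P ⊗ Q) ⟶ H =>
      (freeTensorBilinear k K P Q).postcomp φ := by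
  let ρ := retractFree k K T (P ⊗ Q)
  constructor
  · intro φ φ' h
    have h' : φ.app (op (P.X.obj ⊗ Q.X.obj)) ρ.r = φ'.app (op (P.X.obj ⊗ Q.X.obj)) ρ.r :=
      congrArg (fun β : BilinearTransformation K _ _ H => β.app P.X.obj Q.X.obj
        (retractFree k K T P).r (retractFree k K T Q).r) h
    ext X x
    let x' : free k K T X.unop ⟶ P ⊗ Q := x
    have hx : (x' ≫ ρ.i) ≫ ρ.r = x' := by rw [Category.assoc, ρ.retract, Category.comp_id]
    refine (congrArg (φ.app X) hx).symm.trans (Eq.trans ?_ (congrArg (φ'.app X) hx))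
    refine (app_comp_eq_yonedaInv k K hH φ (x' ≫ ρ.i) ρ.r).trans
      (Eq.trans ?_ (app_comp_eq_yonedaInv k K hH φ' (x' ≫ ρ.i) ρ.r).symm)
    exact congrArg (fun z => yonedaInv k K hH z X.unop (x' ≫ ρ.i).f) h'
  · intro β
    -- The value on the generic pair of sections defines a morphism from `K ⊗ (P.X.obj ⊗ Q.X.obj)`,
    -- which is then restricted to its retract `P ⊗ Q`.
    let h := β.app P.X.obj Q.X.obj (retractFree k K T P).r (retractFree k K T Q).r
    let ψ := (freeHomEquiv k K T (P.X.obj ⊗ Q.X.obj) H hH).symm h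
    refine ⟨(restrictedYoneda k K T).map ρ.i ≫ ψ, ?_⟩
    ext X Y f g
    refine Eq.trans ?_ (β.app_eq_yonedaInv hH f g).symm
    change yonedaInv k K hH h (X ⊗ Y) (freeTensor k K f g ≫ ρ.i).f = _
    exact congrArg (yonedaInv k K hH h (X ⊗ Y)) (Karoubi.comp_p (freeTensor k K f g))

end bilinear

end ScalarExtension

namespace ScalarExtension

open Idempotents

/-! ### Compatibility of the tensor of sections with the constraints -/

section freeTensorConstraints

variable {k : Type v} [Field k] {K : Type v} [Field K] [Algebra k K]
  {T : Type u} [Category.{v} T] [Preadditive T] [Linear k T] [MonoidalCategory T]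
  [MonoidalPreadditive T] [MonoidalLinear k T]

lemma freeTensor_associator {P Q R : PseudoAbelianExt k K T} {X Y Z : T} (f : free k K T X ⟶ P)
    (g : free k K T Y ⟶ Q) (h : free k K T Z ⟶ R) :
    freeTensor k K (freeTensor k K f g) h ≫ (α_ P Q R).hom =
      (toKaroubi _).map ((toNaive k K T).map (α_ X Y Z).hom) ≫
        freeTensor k K f (freeTensor k K g h) := by
  apply Karoubi.hom_ext
  change ((f.f ⊗ₘ g.f) ⊗ₘ h.f) ≫ ((P.p ⊗ₘ Q.p) ⊗ₘ R.p) ≫ (α_ P.X Q.X R.X).hom =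
    (α_ (⟨X⟩ : Naive k K T) ⟨Y⟩ ⟨Z⟩).hom ≫ (f.f ⊗ₘ (g.f ⊗ₘ h.f))
  refine Eq.trans ?_ (MonoidalCategory.associator_naturality f.f g.f h.f)
  rw [← Category.assoc]
  refine congrArg (· ≫ (α_ P.X Q.X R.X).hom) ?_
  exact congrArg Karoubi.Hom.f (Category.comp_id (freeTensor k K (freeTensor k K f g) h))

variable (k K T) in
/-- The identity of `K ⊗ 𝟙`, as a morphism to the unit of the pseudo-abelian extension. -/
def freeUnit : free k K T (𝟙_ T) ⟶ 𝟙_ (PseudoAbelianExt k K T) := 𝟙 (free k K T (𝟙_ T))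

lemma freeTensor_leftUnitor {P : PseudoAbelianExt k K T} {X : T} (f : free k K T X ⟶ P) :
    freeTensor k K (freeUnit k K T) f ≫ (λ_ P).hom =
      (toKaroubi _).map ((toNaive k K T).map (λ_ X).hom) ≫ f := by
  apply Karoubi.hom_ext
  change (𝟙 (𝟙_ (Naive k K T)) ⊗ₘ f.f) ≫ (𝟙 (𝟙_ (Naive k K T)) ⊗ₘ P.p) ≫ (λ_ P.X).hom =
    (λ_ (⟨X⟩ : Naive k K T)).hom ≫ f.f
  rw [← Category.assoc, MonoidalCategory.tensorHom_comp_tensorHom, Karoubi.comp_p,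
    Category.comp_id, id_tensorHom, MonoidalCategory.leftUnitor_naturality]
  rfl

lemma freeTensor_rightUnitor {P : PseudoAbelianExt k K T} {X : T} (f : free k K T X ⟶ P) :
    freeTensor k K f (freeUnit k K T) ≫ (ρ_ P).hom =
      (toKaroubi _).map ((toNaive k K T).map (ρ_ X).hom) ≫ f := by
  apply Karoubi.hom_ext
  change (f.f ⊗ₘ 𝟙 (𝟙_ (Naive k K T))) ≫ (P.p ⊗ₘ 𝟙 (𝟙_ (Naive k K T))) ≫ (ρ_ P.X).hom =
    (ρ_ (⟨X⟩ : Naive k K T)).hom ≫ f.f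
  rw [← Category.assoc, MonoidalCategory.tensorHom_comp_tensorHom, Karoubi.comp_p,
    Category.comp_id, tensorHom_id, MonoidalCategory.rightUnitor_naturality]
  rfl

end freeTensorConstraints

section precomp

variable {k : Type v} [Field k] {K : Type v} [Field K] [Algebra k K]
  {T : Type u} [Category.{v} T] [MonoidalCategory T]

/-- Composition of a bilinear transformation with a pair of morphisms. -/
def BilinearTransformation.precomp {M N M' N' H : Tᵒᵖ ⥤ ModuleCat.{v} K}
    (a : M' ⟶ M) (b : N' ⟶ N) (β : BilinearTransformation K M N H) :
    BilinearTransformation K M' N' H where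
  app X Y := (β.app X Y).compl₁₂ (a.app (op X)).hom (b.app (op Y)).hom
  naturality {X X' Y Y'} f g m n := by
    have ha : a.app (op X') (M'.map f.op m) = M.map f.op (a.app (op X) m) :=
      congrArg (fun q => q.hom m) (a.naturality f.op)
    have hb : b.app (op Y') (N'.map g.op n) = N.map g.op (b.app (op Y) n) :=
      congrArg (fun q => q.hom n) (b.naturality g.op)
    refine Eq.trans ?_ (β.naturality f g (a.app (op X) m) (b.app (op Y) n))
    rw [← ha, ← hb]
    rfl

lemma BilinearTransformation.precomp_bijective {M N M' N' H : Tᵒᵖ ⥤ ModuleCat.{v} K}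
    (a : M' ≅ M) (b : N' ≅ N) : Function.Bijective
      fun β : BilinearTransformation K M N H => β.precomp a.hom b.hom := by
  refine Function.bijective_iff_has_inverse.2
    ⟨fun β => β.precomp a.inv b.inv, fun β => ?_, fun β => ?_⟩
  · ext X Y m n
    have ha : a.hom.app (op X) (a.inv.app (op X) m) = m :=
      congrArg (fun q : M ⟶ M => q.app (op X) m) a.inv_hom_id
    have hb : b.hom.app (op Y) (b.inv.app (op Y) n) = n :=
      congrArg (fun q : N ⟶ N => q.app (op Y) n) b.inv_hom_id
    exact congrArg₂ (fun x y => β.app X Y x y) ha hb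
  · ext X Y m n
    have ha : a.inv.app (op X) (a.hom.app (op X) m) = m :=
      congrArg (fun q : M' ⟶ M' => q.app (op X) m) a.hom_inv_id
    have hb : b.inv.app (op Y) (b.hom.app (op Y) n) = n :=
      congrArg (fun q : N' ⟶ N' => q.app (op Y) n) b.hom_inv_id
    exact congrArg₂ (fun x y => β.app X Y x y) ha hb

end precomp

/-! ### The transported tensor product is the tensor product over `K` -/

section relativeTensor

variable (k : Type v) [Field k] (K : Type v) [Field K] [Algebra k K]
  {T : Type u} [Category.{v} T] [Preadditive T] [Linear k T]

variable {k K} in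
/-- The action of a morphism of `T_K` on sections. -/
def onSections {M N : CompactExt k K T} (a : M ⟶ N) (X : T) (m : M.obj.obj.obj (op X)) :
    N.obj.obj.obj (op X) := a.hom.hom.app (op X) m

variable {k K} in
lemma onSections_map {M N : CompactExt k K T} (a : M ⟶ N) {X Y : T} (f : Y ⟶ X)
    (m : M.obj.obj.obj (op X)) :
    onSections a Y (M.obj.obj.map f.op m) = N.obj.obj.map f.op (onSections a X m) :=
  congrArg (fun q => q.hom m) (a.hom.hom.naturality f.op)

variable {k K} in
/-- A morphism `K ⊗ X ⟶ P` as a section over `X` of the object of `T_K` defined by `P`. -/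
def toSection {P : PseudoAbelianExt k K T} {X : T} (f : free k K T X ⟶ P) :
    ((toCompactExt k K T).obj P).obj.obj.obj (op X) := f

variable {k K} in
-- By essential surjectivity, identities between sections of objects of `T_K` may be checked on
-- morphisms of the pseudo-abelian extension.
lemma exists_onSections_eq [(toCompactExt k K T).IsEquivalence] (M : CompactExt k K T) (X : T)
    (m : M.obj.obj.obj (op X)) :
    ∃ (P : PseudoAbelianExt k K T) (a : (toCompactExt k K T).obj P ⟶ M) (f : free k K T X ⟶ P),
      onSections a X (toSection f) = m :=
  let θ := (toCompactExt k K T).objObjPreimageIso M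
  ⟨_, θ.hom, onSections θ.inv X m,
    congrArg (fun q : M ⟶ M => onSections q X m) θ.inv_hom_id⟩

variable [MonoidalCategory T] [MonoidalPreadditive T] [MonoidalLinear k T]
  [MonoidalCategory (CompactExt k K T)] [(toCompactExt k K T).Monoidal]
  [(toCompactExt k K T).IsEquivalence]

open Functor.OplaxMonoidal Functor.LaxMonoidal

/-- The bilinear transformation `(m, n) ↦ m ⊗ n` for the tensor product of `T_K` obtained from that of
the pseudo-abelian extension. -/
def transportedMul (M N : CompactExt k K T) :
    BilinearTransformation K M.obj.obj N.obj.obj (M ⊗ N).obj.obj :=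
  let Φ := toCompactExt k K T
  let θ := Φ.objObjPreimageIso
  ((freeTensorBilinear k K (Φ.objPreimage M) (Φ.objPreimage N)).precomp
    (θ M).inv.hom.hom (θ N).inv.hom.hom).postcomp
      (δ Φ (Φ.objPreimage M) (Φ.objPreimage N) ≫ ((θ M).hom ⊗ₘ (θ N).hom)).hom.hom

variable {k K}

/-- The product is defined with chosen preimages of `M` and `N`. By fullness, any other presentation
maps to the chosen one through the pseudo-abelian extension, and naturality of `δ` shows that the
formula does not depend on the choice. -/
lemma transportedMul_onSections {M N : CompactExt k K T} {P Q : PseudoAbelianExt k K T}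
    (a : (toCompactExt k K T).obj P ⟶ M) (b : (toCompactExt k K T).obj Q ⟶ N) {X Y : T}
    (f : free k K T X ⟶ P) (g : free k K T Y ⟶ Q) :
    (transportedMul k K M N).app X Y (onSections a X (toSection f))
        (onSections b Y (toSection g)) =
      onSections (δ (toCompactExt k K T) P Q ≫ (a ⊗ₘ b)) (X ⊗ Y)
        (toSection (freeTensor k K f g)) := by
  let Φ := toCompactExt k K T
  let θ := Φ.objObjPreimageIso
  obtain ⟨a', ha⟩ := Φ.map_surjective (a ≫ (θ M).inv)
  obtain ⟨b', hb⟩ := Φ.map_surjective (b ≫ (θ N).inv)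
  have ha' : onSections (θ M).inv X (onSections a X (toSection f)) = toSection (f ≫ a') :=
    (congrArg (fun q => onSections q X (toSection f)) ha).symm
  have hb' : onSections (θ N).inv Y (onSections b Y (toSection g)) = toSection (g ≫ b') :=
    (congrArg (fun q => onSections q Y (toSection g)) hb).symm
  have h : Φ.map (a' ⊗ₘ b') ≫ δ Φ _ _ ≫ ((θ M).hom ⊗ₘ (θ N).hom) = δ Φ P Q ≫ (a ⊗ₘ b) := by
    rw [← δ_natural_assoc, MonoidalCategory.tensorHom_comp_tensorHom, ha, hb]
    simp
  refine Eq.trans ?_ (congrArg (fun q => onSections q (X ⊗ Y) (toSection (freeTensor k K f g))) h)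
  refine (congrArg₂ (fun m n => onSections (δ Φ _ _ ≫ ((θ M).hom ⊗ₘ (θ N).hom)) (X ⊗ Y)
    ((freeTensorBilinear k K _ _).app X Y m n)) ha' hb').trans ?_
  exact congrArg (onSections (δ Φ _ _ ≫ ((θ M).hom ⊗ₘ (θ N).hom)) (X ⊗ Y))
    (freeTensor_comp f g a' b')

variable (k K T)

/-- Up to isomorphisms in the source and the target, this is the universal property already known
for objects of the pseudo-abelian extension. -/
lemma transportedMul_universal (M N : CompactExt k K T) (H : IndExt k K T) :
    Function.Bijective fun φ : (M ⊗ N).obj.obj ⟶ H.obj =>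
      (transportedMul k K M N).postcomp φ := by
  let Φ := toCompactExt k K T
  let F : CompactExt k K T ⥤ Tᵒᵖ ⥤ ModuleCat.{v} K := ObjectProperty.ι _ ⋙ ObjectProperty.ι _
  let θ := Φ.objObjPreimageIso
  let i : Φ.obj (Φ.objPreimage M ⊗ Φ.objPreimage N) ≅ M ⊗ N :=
    (Functor.Monoidal.μIso Φ _ _).symm ≪≫ (θ M ⊗ᵢ θ N)
  have h1 : Function.Bijective fun φ : (M ⊗ N).obj.obj ⟶ H.obj => (F.mapIso i).hom ≫ φ :=
    ((F.mapIso i).homFromEquiv (Z := H.obj)).symm.bijective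
  have h2 := freeTensorBilinear_universal (Φ.objPreimage M) (Φ.objPreimage N) H.obj H.property.2
  have h3 := BilinearTransformation.precomp_bijective (H := H.obj) (F.mapIso (θ M)).symm
    (F.mapIso (θ N)).symm
  exact (h3.comp h2).comp h1

/-- The tensor product of `T_K` transported from the pseudo-abelian extension is the tensor product of
`K`-modules. -/
def transportedRelativeTensor : RelativeTensor k K T where
  mul M N := transportedMul k K M N
  one := onSections (η (toCompactExt k K T)) (𝟙_ T) (toSection (freeUnit k K T))
  mul_universal := transportedMul_universal k K T
  one_universal H := by
    let Φ := toCompactExt k K T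
    let F : CompactExt k K T ⥤ Tᵒᵖ ⥤ ModuleCat.{v} K := ObjectProperty.ι _ ⋙ ObjectProperty.ι _
    let i : Φ.obj (𝟙_ _) ≅ 𝟙_ (CompactExt k K T) := (Functor.Monoidal.εIso Φ).symm
    have h1 : Function.Bijective fun φ : (𝟙_ (CompactExt k K T)).obj.obj ⟶ H.obj =>
        (F.mapIso i).hom ≫ φ := ((F.mapIso i).homFromEquiv (Z := H.obj)).symm.bijective
    exact (freeHomEquiv k K T (𝟙_ T) H.obj H.property.2).bijective.comp h1
  tensorHom_mul {M M' N N'} φ ψ X Y m n := by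
    obtain ⟨P, a, f, rfl⟩ := exists_onSections_eq M X m
    obtain ⟨Q, b, g, rfl⟩ := exists_onSections_eq N Y n
    rw [transportedMul_onSections]
    refine Eq.trans ?_ (transportedMul_onSections (a ≫ φ) (b ≫ ψ) f g).symm
    rw [← MonoidalCategory.tensorHom_comp_tensorHom, ← Category.assoc]
    rfl
  associator_mul M N P X Y Z m n p := by
    obtain ⟨A, a, f, rfl⟩ := exists_onSections_eq M X m
    obtain ⟨B, b, g, rfl⟩ := exists_onSections_eq N Y n
    obtain ⟨C, c, h, rfl⟩ := exists_onSections_eq P Z p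
    let Φ := toCompactExt k K T
    rw [transportedMul_onSections, transportedMul_onSections, transportedMul_onSections,
      transportedMul_onSections]
    -- Associativity of the oplax structure `δ` reduces the claim to the associator of the
    -- pseudo-abelian extension.
    have h1 : (δ Φ (A ⊗ B) C ≫ ((δ Φ A B ≫ (a ⊗ₘ b)) ⊗ₘ c)) ≫ (α_ M N P).hom =
        Φ.map (α_ A B C).hom ≫ δ Φ A (B ⊗ C) ≫ (a ⊗ₘ (δ Φ B C ≫ (b ⊗ₘ c))) := by
      have h2 : (δ Φ A B ≫ (a ⊗ₘ b)) ⊗ₘ c = (δ Φ A B ▷ Φ.obj C) ≫ ((a ⊗ₘ b) ⊗ₘ c) := by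
        rw [← tensorHom_id, MonoidalCategory.tensorHom_comp_tensorHom, Category.id_comp]
      have h3 : a ⊗ₘ (δ Φ B C ≫ (b ⊗ₘ c)) = (Φ.obj A ◁ δ Φ B C) ≫ (a ⊗ₘ (b ⊗ₘ c)) := by
        rw [← id_tensorHom, MonoidalCategory.tensorHom_comp_tensorHom, Category.id_comp]
      rw [h2, h3, ← Functor.OplaxMonoidal.associativity_assoc]
      simp only [Category.assoc, MonoidalCategory.associator_naturality]
    refine (congrArg (fun q => onSections q ((X ⊗ Y) ⊗ Z)
      (toSection (freeTensor k K (freeTensor k K f g) h))) h1).trans ?_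
    let d := δ Φ A (B ⊗ C) ≫ (a ⊗ₘ (δ Φ B C ≫ (b ⊗ₘ c)))
    exact (congrArg (fun x => onSections d ((X ⊗ Y) ⊗ Z) (toSection x))
      (freeTensor_associator f g h)).trans (onSections_map d (α_ X Y Z).hom _)
  leftUnitor_mul M X m := by
    obtain ⟨A, a, f, rfl⟩ := exists_onSections_eq M X m
    let Φ := toCompactExt k K T
    rw [transportedMul_onSections]
    have h1 : (δ Φ (𝟙_ _) A ≫ (η Φ ⊗ₘ a)) ≫ (λ_ M).hom = Φ.map (λ_ A).hom ≫ a := by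
      rw [Functor.Monoidal.map_leftUnitor, MonoidalCategory.tensorHom_def]
      simp only [Category.assoc, MonoidalCategory.leftUnitor_naturality]
    refine (congrArg (fun q => onSections q (𝟙_ T ⊗ X)
      (toSection (freeTensor k K (freeUnit k K T) f))) h1).trans ?_
    exact (congrArg (fun x => onSections a (𝟙_ T ⊗ X) (toSection x))
      (freeTensor_leftUnitor f)).trans (onSections_map a (λ_ X).hom _)
  rightUnitor_mul M X m := by
    obtain ⟨A, a, f, rfl⟩ := exists_onSections_eq M X m
    let Φ := toCompactExt k K T
    rw [transportedMul_onSections]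
    have h1 : (δ Φ A (𝟙_ _) ≫ (a ⊗ₘ η Φ)) ≫ (ρ_ M).hom = Φ.map (ρ_ A).hom ≫ a := by
      rw [Functor.Monoidal.map_rightUnitor, MonoidalCategory.tensorHom_def']
      simp only [Category.assoc, MonoidalCategory.rightUnitor_naturality]
    refine (congrArg (fun q => onSections q (X ⊗ 𝟙_ T)
      (toSection (freeTensor k K f (freeUnit k K T)))) h1).trans ?_
    exact (congrArg (fun x => onSections a (X ⊗ 𝟙_ T) (toSection x))
      (freeTensor_rightUnitor f)).trans (onSections_map a (ρ_ X).hom _)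

lemma isCanonicalMonoidal_transported :
    IsCanonicalMonoidal k K (transportedRelativeTensor k K T) where
  tensor P Q X Y f g := by
    let Φ := toCompactExt k K T
    have h := congrArg (onSections (μ Φ P Q) (X ⊗ Y))
      (transportedMul_onSections (𝟙 (Φ.obj P)) (𝟙 (Φ.obj Q)) f g)
    have h' : (δ Φ P Q ≫ (𝟙 (Φ.obj P) ⊗ₘ 𝟙 (Φ.obj Q))) ≫ μ Φ P Q = 𝟙 _ := by
      rw [id_tensorHom_id, Category.comp_id, Functor.Monoidal.δ_μ]
    have h'' := h.trans
      (congrArg (fun q => onSections q (X ⊗ Y) (toSection (freeTensor k K f g))) h')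
    exact congrArg (fun q : free k K T (X ⊗ Y) ⟶ P ⊗ Q => q.f) h''
  unit := by
    let Φ := toCompactExt k K T
    have h := congrArg (fun q => onSections q (𝟙_ T) (toSection (freeUnit k K T)))
      (Functor.Monoidal.η_ε Φ)
    exact congrArg (fun q : free k K T (𝟙_ T) ⟶ 𝟙_ (PseudoAbelianExt k K T) => q.f) h

end relativeTensor

end ScalarExtension

namespace ScalarExtension

open Idempotents

/-! ### Transport of tensor categories along equivalences -/

section transport

lemma hasFiniteProducts_of_equivalence {C : Type u} [Category.{v} C] {D : Type u'}
    [Category.{v'} D] (F : C ⥤ D) [F.IsEquivalence] [HasFiniteProducts C] :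
    HasFiniteProducts D where
  out _ := Adjunction.hasLimitsOfShape_of_equivalence F.inv

variable {K : Type v} [Field K] {C : Type u} [Category.{v} C] [MonoidalCategory C] [Preadditive C]
  [Linear K C] [MonoidalPreadditive C] [MonoidalLinear K C] {D : Type u'} [Category.{v'} D]
  [MonoidalCategory D] [Preadditive D] [Linear K D] [MonoidalPreadditive D] [MonoidalLinear K D]

/-- A category that is monoidally and linearly equivalent to a tensor category is a tensor category. -/
theorem IsTensorCategory.of_equivalence (h : IsTensorCategory K C)
    (hreg : IsRegularCategory C) (F : C ⥤ D) [F.IsEquivalence] [F.Additive] [F.Linear K]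
    [F.Monoidal] : IsTensorCategory K D where
  essentiallySmall := (essentiallySmall_congr F.asEquivalence).1 h.essentiallySmall
  bijective_algebraMap_end_unit := by
    let i := Functor.Monoidal.εIso F
    let e : End (𝟙_ C) ≃ End (𝟙_ D) :=
      (Functor.FullyFaithful.ofFullyFaithful F).homEquiv.trans (i.symm.homCongr i.symm)
    have he : ∀ r : K, e (algebraMap K (End (𝟙_ C)) r) = algebraMap K (End (𝟙_ D)) r := by
      intro r
      rw [Algebra.algebraMap_eq_smul_one, Algebra.algebraMap_eq_smul_one]
      change i.hom ≫ F.map (r • 𝟙 _) ≫ i.inv = r • 𝟙 _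
      rw [F.map_smul, F.map_id, Linear.smul_comp, Linear.comp_smul, Category.id_comp,
        i.hom_inv_id]
    have := e.bijective.comp h.bijective_algebraMap_end_unit
    rwa [show e ∘ algebraMap K (End (𝟙_ C)) = algebraMap K (End (𝟙_ D)) from funext he] at this
  rigid Y := by
    let G := F.asEquivalence.inverse
    let _ : F.asEquivalence.functor.Monoidal := inferInstanceAs F.Monoidal
    let _ : G.Monoidal := F.asEquivalence.inverseMonoidal
    let adj := F.asEquivalence.symm.toAdjunction
    let _ := (h.rigid (G.obj Y)).1.some
    let _ := (h.rigid (G.obj Y)).2.some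
    exact ⟨⟨hasLeftDualOfEquivalence (F := G) adj Y⟩, ⟨hasRightDualOfEquivalence (F := G) adj Y⟩⟩
  -- Regularity, idempotent completeness and finite products pass along the equivalence, and
  -- together they give abelianness again.
  abelian := by
    have := h.abelian.hasFiniteProducts
    have := h.abelian.hasKernels
    have : IsIdempotentComplete C :=
      (isIdempotentComplete_iff_idempotents_have_kernels C).2 fun _ _ _ => inferInstance
    have : IsIdempotentComplete D :=
      (isIdempotentComplete_iff_of_equivalence F.asEquivalence).1 inferInstance
    have := hasFiniteProducts_of_equivalence F
    exact (hreg.of_equivalence F).isAbelianCategory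

end transport

/-! ### The structure on `T_K` and the conclusion -/

section main

variable (k : Type v) [Field k] (K : Type v) [Field K] [Algebra k K]
  {T : Type u} [Category.{v} T] [Preadditive T] [Linear k T] [MonoidalCategory T]
  [MonoidalPreadditive T] [MonoidalLinear k T]

/-- The monoidal structure on `T_K` transported from the pseudo-abelian extension. -/
@[reducible]
def compactExtMonoidalCategory [(toCompactExt k K T).IsEquivalence] :
    MonoidalCategory (CompactExt k K T) :=
  Monoidal.transport (toCompactExt k K T).asEquivalence

/-- The canonical functor is monoidal for the transported structure. -/
@[reducible]
def toCompactExtMonoidal [(toCompactExt k K T).IsEquivalence] :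
    letI := compactExtMonoidalCategory k K (T := T)
    (toCompactExt k K T).Monoidal :=
  inferInstanceAs
    (Monoidal.equivalenceTransported (toCompactExt k K T).asEquivalence).functor.Monoidal

variable (T) in
/-- If the canonical functor is an equivalence, then the pseudo-abelian extension equals `T_K`. -/
theorem scalarExtensionEqPseudoAbelian_of_isEquivalence [(toCompactExt k K T).IsEquivalence] :
    ScalarExtensionEqPseudoAbelian k K T := by
  let _ := compactExtMonoidalCategory k K (T := T)
  let _ := toCompactExtMonoidal k K (T := T)
  exact ⟨inferInstance, inferInstance, inferInstance, inferInstance,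
    transportedRelativeTensor k K T, inferInstance, isCanonicalMonoidal_transported k K T⟩

variable (T) in
/-- If the canonical functor is an equivalence and the pseudo-abelian extension is a tensor category
with a quasi-inverse for every morphism, then `T_K` is a tensor category. -/
theorem scalarExtensionIsTensorCategory_of_isEquivalence [(toCompactExt k K T).IsEquivalence]
    (h : IsTensorCategory K (PseudoAbelianExt k K T))
    (hreg : IsRegularCategory (PseudoAbelianExt k K T)) :
    ScalarExtensionIsTensorCategory k K T := by
  let _ := compactExtMonoidalCategory k K (T := T)
  let _ := toCompactExtMonoidal k K (T := T)
  let e := (toCompactExt k K T).asEquivalence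
  let _ : e.functor.Monoidal := toCompactExtMonoidal k K (T := T)
  let _ : e.inverse.Monoidal := e.inverseMonoidal
  have : e.functor.Additive := inferInstanceAs (toCompactExt k K T).Additive
  have : e.functor.Linear K := inferInstanceAs ((toCompactExt k K T).Linear K)
  have : MonoidalPreadditive (CompactExt k K T) := monoidalPreadditive_of_faithful e.inverse
  have : MonoidalLinear K (CompactExt k K T) := .ofFaithful K e.inverse
  exact ⟨inferInstance, transportedRelativeTensor k K T, inferInstance, inferInstance,
    h.of_equivalence hreg (toCompactExt k K T)⟩

end main

end ScalarExtension

end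

theorem mainTheorem7 {k : Type v} [Field k] {T : Type u} [Category.{v} T] [Preadditive T]
    [Linear k T] [MonoidalCategory T] [MonoidalPreadditive T] [MonoidalLinear k T]
    (hT : ScalarExtension.IsTensorCategory k T)
    (hart : ScalarExtension.IsArtinianCategory k T)
    (hss : ScalarExtension.IsSemisimpleCategory T) :
    (∀ X : T, ScalarExtension.IsSeparableAlgebra k (End X)) ∧
    (∀ (K : Type v) [Field K] [Algebra k K],
      ScalarExtension.IsTensorCategory K (ScalarExtension.PseudoAbelianExt k K T) ∧
      ScalarExtension.IsSemisimpleCategory (ScalarExtension.PseudoAbelianExt k K T) ∧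
      ScalarExtension.ScalarExtensionEqPseudoAbelian k K T) ∧
    ScalarExtension.IsAbsolute k T := by
  have := hT.essentiallySmall
  have := hT.abelian.hasFiniteProducts
  have := hT.abelian.hasKernels
  have := hT.abelian.hasCokernels
  have : HasFiniteBiproducts T := .of_hasFiniteProducts
  have : HasBinaryBiproducts T := hasBinaryBiproducts_of_finite_biproducts T
  have : IsIdempotentComplete T :=
    (Idempotents.isIdempotentComplete_iff_idempotents_have_kernels T).2 fun _ _ _ => inferInstance
  have hreg := ScalarExtension.isRegularCategory_of_isSemisimpleCategory hss
  have : HasKernels Tᵒᵖ := hreg.op.hasKernels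
  have hsep : ∀ X : T, ScalarExtension.IsSeparableAlgebra k (End X) := fun X => by
    let _ := (hT.rigid X).2.some
    exact ScalarExtension.isSeparableAlgebra_end hreg hT.bijective_algebraMap_end_unit X
      hart.finite_hom
  refine ⟨hsep, fun K _ _ => ?_, fun K _ _ => ?_⟩
  · have := ScalarExtension.isEquivalence_toCompactExt k K hreg hsep
    exact ⟨ScalarExtension.isTensorCategory_pseudoAbelianExt k K hT hsep,
      ScalarExtension.isSemisimpleCategory_pseudoAbelianExt k K hsep hart.finite_hom,
      ScalarExtension.scalarExtensionEqPseudoAbelian_of_isEquivalence k K T⟩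
  · have := ScalarExtension.isEquivalence_toCompactExt k K hreg hsep
    exact ScalarExtension.scalarExtensionIsTensorCategory_of_isEquivalence k K T
      (ScalarExtension.isTensorCategory_pseudoAbelianExt k K hT hsep)
      (ScalarExtension.isRegularCategory_pseudoAbelianExt k K hsep)
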